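/- Let $k,m\ge 2$ and $n\ge 0$. All metrics below are smooth Kähler metrics $g=(g_{i\bar j})_{1\le i,j\le n}$ on open sets of $\mathbb C^n$: $g$ is smooth, Hermitian positive definite, and $\partial_l g_{i\bar j}=\partial_i g_{l\bar j}$. Write $g_{a_1\bar b_1a_2\cdots a_k\bar b_2\cdots\bar b_m}=\partial_{a_2}\cdots\partial_{a_k}\partial_{\bar b_2}\cdots\partial_{\bar b_m}g_{a_1\bar b_1}$, which is symmetric in the $a_i$ and in the $\bar b_j$, and let $g^{r\bar s}$ be the inverse metric, $\sum_s g^{r\bar s}g_{t\bar s}=\delta_{rt}$. *Invariants.* A family $D=(D_{a_1\cdots a_k\bar b_1\cdots\bar b_m})$ of polynomials in the partial derivatives $g_{a_1\bar b_1a_2\cdots a_p\bar b_2\cdots\bar b_q}$ ($p,q\ge1$) and the $g^{r\bar s}$ is called *invariant* if it is a covariant tensor: for every biholomorphic map $\phi:U\to V$ of open sets of $\mathbb C^n$, every Kähler metric $g$ on $V$ and every $z\in U$, $$D_{a\bar b}(\phi^*g)(z)=\sum_{c,d}D_{c\bar d}(g)(\phi(z))\prod_{i=1}^k\partial_{a_i}\phi_{c_i}(z)\prod_{j=1}^m\overline{\partial_{b_j}\phi_{d_j}(z)},$$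 where $(\phi^*g)_{i\bar j}(z)=\sum_{p,q}g_{p\bar q}(\phi(z))\,\partial_i\phi_p(z)\,\overline{\partial_j\phi_q(z)}$. The coordinates are *normal to order $N$* at a point $p$ (the center) if $g_{i\bar j}(p)=\delta_{ij}$ and all pure derivatives $g_{i\bar j\alpha_1\cdots\alpha_r}(p)$ and $g_{i\bar j\bar\alpha_1\cdots\bar\alpha_r}(p)$ with $1\le r\le N$ vanish. $D$ is a *canonical invariant polynomial* for $g_{a_1\bar b_1a_2\cdots a_k\bar b_2\cdots\bar b_m}$, written $D(g_{a_1\bar b_1a_2\cdots a_k\bar b_2\cdots\bar b_m})$, if it is invariant and there is an $N$ such that, for all $a,b$, $D_{a\bar b}$ equals $g_{a_1\bar b_1a_2\cdots a_k\bar b_2\cdots\bar b_m}$ at the center of all coordinates normal to order $N$. *Trees.* A *decorated tree* is a directed tree $T$ with $k$ outward external legs labelled $a_1,\dots,a_k$ and $m$ inward external legs labelled $\bar b_1,\dots,\bar b_m$ attached to its vertices. The outward (inward) degree $\deg^+(v)$ ($\deg^-(v)$) counts the outgoing (incoming) edges and outward (inward) legs at $v$. $T$ is *semistable* if $\deg^+(v)\ge1$,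 $\deg^-(v)\ge1$ and $\deg^+(v)+\deg^-(v)\ge3$ for every vertex $v$, and *contractible* if $\deg^+(u)=1$ or $\deg^-(v)=1$ for every edge $u\to v$. Let $\mathscr T_g(a_1\cdots a_k|\bar b_1\cdots\bar b_m)$ be the (finite) set of isomorphism classes of contractible semistable decorated trees, isomorphisms preserving the labelled legs. Let $g_T$ be the polynomial obtained by assigning to each vertex the partial derivative of the metric whose unbarred (barred) indices are those of its outward (inward) half-edges, and contracting the unbarred index $r$ at the tail and the barred index $\bar s$ at the head of each edge with $g^{r\bar s}$. **Theorem.** The family $$\sum_{T\in\mathscr T_g(a_1\cdots a_k|\bar b_1\cdots\bar b_m)}(-1)^{|V(T)|+1}g_T$$ is a canonical invariant polynomial for $g_{a_1\bar b_1a_2\cdots a_k\bar b_2\cdots\bar b_m}$: it is invariant, and it equals $g_{a_1\bar b_1a_2\cdots a_k\bar b_2\cdots\bar b_m}$ at the center of normal coordinates. Moreover, every canonical invariant polynomial takes the same value as this sum for every Kähler metric at every point, so that $$D(g_{a_1\bar b_1a_2\cdots a_k\bar b_2\cdots\bar b_m})=\sum_{T\in\mathscr T_g(a_1\cdots a_k|\bar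 b_1\cdots\bar b_m)}(-1)^{|V(T)|+1}g_T .$$ -/

import Mathlib

open scoped ContDiff ComplexOrder

noncomputable section

namespace KahlerTree

/-! ### Kähler metrics in local holomorphic coordinates

Points of a coordinate domain of complex dimension `n` are vectors `Fin n → ℂ`, and the metric is
its coefficient matrix `g z i j`, standing for `g_{i j̄}(z)`. -/

/-- The Wirtinger derivative `∂f/∂z_i = (∂f/∂x_i - √-1 ∂f/∂y_i)/2`. -/
def dz {n : ℕ} (i : Fin n) (f : (Fin n → ℂ) → ℂ) (p : Fin n → ℂ) : ℂ :=
  (fderiv ℝ f p (Pi.single i 1) - Complex.I * fderiv ℝ f p (Pi.single i Complex.I)) / 2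

/-- The Wirtinger derivative `∂f/∂z̄_i = (∂f/∂x_i + √-1 ∂f/∂y_i)/2`. -/
def dzbar {n : ℕ} (i : Fin n) (f : (Fin n → ℂ) → ℂ) (p : Fin n → ℂ) : ℂ :=
  (fderiv ℝ f p (Pi.single i 1) + Complex.I * fderiv ℝ f p (Pi.single i Complex.I)) / 2

/-- `∂_{α₁} ∂_{α₂} ⋯ f` for a list `α` of indices. -/
def iterDz {n : ℕ} (α : List (Fin n)) (f : (Fin n → ℂ) → ℂ) : (Fin n → ℂ) → ℂ :=
  α.foldr dz f

/-- `∂_{β̄₁} ∂_{β̄₂} ⋯ f` for a list `β` of indices. -/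
def iterDzbar {n : ℕ} (β : List (Fin n)) (f : (Fin n → ℂ) → ℂ) : (Fin n → ℂ) → ℂ :=
  β.foldr dzbar f

/-- `g` is (the coefficient matrix of) a smooth Kähler metric on the open set `U`: it is smooth,
Hermitian positive definite, and satisfies `∂_l g_{i j̄} = ∂_i g_{l j̄}`, i.e. the Kähler form is
closed (the conjugate equations follow because `g` is Hermitian). -/
structure IsKahlerOn {n : ℕ} (g : (Fin n → ℂ) → Matrix (Fin n) (Fin n) ℂ)
    (U : Set (Fin n → ℂ)) : Prop where
  isOpen : IsOpen U
  smooth : ∀ i j, ContDiffOn ℝ ∞ (fun z => g z i j) U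
  posDef : ∀ z ∈ U, (g z).PosDef
  closed : ∀ z ∈ U, ∀ i j l, dz l (fun w => g w i j) z = dz i (fun w => g w l j) z

/-- `metricDeriv g [a₁, …, a_k] [b₁, …, b_m] p` is the partial derivative
`g_{a₁ b̄₁ a₂ ⋯ a_k b̄₂ ⋯ b̄_m} = ∂_{a₂} ⋯ ∂_{a_k} ∂_{b̄₂} ⋯ ∂_{b̄_m} g_{a₁ b̄₁}` at `p`.
(Only nonempty lists have a meaning, and only those occur at semistable vertices; the value for an
empty list is set to `0`.) -/
def metricDeriv {n : ℕ} (g : (Fin n → ℂ) → Matrix (Fin n) (Fin n) ℂ) :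
    List (Fin n) → List (Fin n) → (Fin n → ℂ) → ℂ
  | i :: α, j :: β, p => iterDz α (iterDzbar β (fun z => g z i j)) p
  | _, _, _ => 0

/-- The coordinates are normal to order `N` at `p`: `g_{i j̄}(p) = δ_{ij}`, and all the pure
derivatives `g_{i j̄ α₁ ⋯ α_r}` and `g_{i j̄ ᾱ₁ ⋯ ᾱ_r}`, `1 ≤ r ≤ N`, vanish at `p`. -/
structure IsNormalAt {n : ℕ} (N : ℕ) (g : (Fin n → ℂ) → Matrix (Fin n) (Fin n) ℂ)
    (p : Fin n → ℂ) : Prop where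
  metric_eq_one : g p = 1
  dz_eq_zero : ∀ (i j : Fin n) (α : List (Fin n)), 1 ≤ α.length → α.length ≤ N →
    iterDz α (fun z => g z i j) p = 0
  dzbar_eq_zero : ∀ (i j : Fin n) (α : List (Fin n)), 1 ≤ α.length → α.length ≤ N →
    iterDzbar α (fun z => g z i j) p = 0

/-! ### Changes of coordinates -/

/-- `φ` maps the open set `U` biholomorphically onto the open set `V`. -/
def IsBiholomorphic {n : ℕ} (φ : (Fin n → ℂ) → (Fin n → ℂ)) (U V : Set (Fin n → ℂ)) : Prop :=
  IsOpen U ∧ IsOpen V ∧ DifferentiableOn ℂ φ U ∧ Set.MapsTo φ U V ∧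
    ∃ ψ : (Fin n → ℂ) → (Fin n → ℂ), DifferentiableOn ℂ ψ V ∧ Set.MapsTo ψ V U ∧
      Set.LeftInvOn ψ φ U ∧ Set.RightInvOn ψ φ V

/-- The holomorphic Jacobian matrix: `jacobian φ z p i = ∂_i φ_p (z)`. -/
def jacobian {n : ℕ} (φ : (Fin n → ℂ) → (Fin n → ℂ)) (z : Fin n → ℂ) :
    Matrix (Fin n) (Fin n) ℂ :=
  fun p i => fderiv ℂ φ z (Pi.single i 1) p

/-- The metric in the new coordinates:
`(φ^* g)_{i j̄}(z) = ∑_{p, q} g_{p q̄}(φ(z)) ∂_i φ_p(z) \overline{∂_j φ_q(z)}`. -/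
def pullback {n : ℕ} (φ : (Fin n → ℂ) → (Fin n → ℂ))
    (g : (Fin n → ℂ) → Matrix (Fin n) (Fin n) ℂ) :
    (Fin n → ℂ) → Matrix (Fin n) (Fin n) ℂ :=
  fun z i j => ∑ p, ∑ q, g (φ z) p q * jacobian φ z p i * star (jacobian φ z q j)

/-! ### Polynomials in the derivatives of the metric -/

/-- The variables of Weyl polynomials: `deriv A B` stands for the partial derivative of the metric
with the (nonempty) multisets `A` of unbarred and `B` of barred indices, and `inv r s` for the
entry `g^{r s̄}` of the inverse metric. By the Kähler condition a derivative of the metric is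
symmetric in its unbarred indices and symmetric in its barred indices. -/
inductive MetricVar (n : ℕ) : Type
  | deriv (A B : Multiset (Fin n))
  | inv (r s : Fin n)

/-- The value of a variable for the metric `g` at the point `p`. The inverse metric is normalised
by `∑_s g^{r s̄} g_{t s̄} = δ_{rt}`. -/
def MetricVar.value {n : ℕ} (g : (Fin n → ℂ) → Matrix (Fin n) (Fin n) ℂ) (p : Fin n → ℂ) :
    MetricVar n → ℂ
  | .deriv A B => metricDeriv g (A.sort (· ≤ ·)) (B.sort (· ≤ ·)) p
  | .inv r s => (g p)⁻¹ s r

/-- A family of polynomials in the metric variables with `k` unbarred and `m` barred indices. -/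
abbrev PolyTensor (n k m : ℕ) : Type :=
  (Fin k → Fin n) → (Fin m → Fin n) → MvPolynomial (MetricVar n) ℂ

/-- The component with indices `a`, `b̄` of the family `D`, for the metric `g` at `p`. -/
def PolyTensor.eval {n k m : ℕ} (D : PolyTensor n k m)
    (g : (Fin n → ℂ) → Matrix (Fin n) (Fin n) ℂ) (p : Fin n → ℂ)
    (a : Fin k → Fin n) (b : Fin m → Fin n) : ℂ :=
  MvPolynomial.eval (MetricVar.value g p) (D a b)

/-- `D` is a Weyl invariant: under every holomorphic change of coordinates it transforms as a
covariant tensor with `k` unbarred and `m` barred indices. -/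
def PolyTensor.IsInvariant {n k m : ℕ} (D : PolyTensor n k m) : Prop :=
  ∀ (φ : (Fin n → ℂ) → (Fin n → ℂ)) (U V : Set (Fin n → ℂ)), IsBiholomorphic φ U V →
    ∀ g : (Fin n → ℂ) → Matrix (Fin n) (Fin n) ℂ, IsKahlerOn g V →
      ∀ z ∈ U, ∀ (a : Fin k → Fin n) (b : Fin m → Fin n),
        D.eval (pullback φ g) z a b =
          ∑ c : Fin k → Fin n, ∑ d : Fin m → Fin n,
            D.eval g (φ z) c d * (∏ i, jacobian φ z (c i) (a i)) *
              ∏ j, star (jacobian φ z (d j) (b j))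

/-- `D` is a canonical invariant polynomial `D(g_{a₁ b̄₁ a₂ ⋯ a_k b̄₂ ⋯ b̄_m})`: it is invariant, and
it equals `g_{a₁ b̄₁ a₂ ⋯ a_k b̄₂ ⋯ b̄_m}` at the center of every normal coordinate system (normal to
a sufficiently high order). -/
def PolyTensor.IsCanonicalInvariant {n k m : ℕ} (D : PolyTensor n k m) : Prop :=
  D.IsInvariant ∧ ∃ N : ℕ,
    ∀ (g : (Fin n → ℂ) → Matrix (Fin n) (Fin n) ℂ) (U : Set (Fin n → ℂ)), IsKahlerOn g U →
      ∀ p ∈ U, IsNormalAt N g p → ∀ (a : Fin k → Fin n) (b : Fin m → Fin n),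
        D.eval g p a b = metricDeriv g (List.ofFn a) (List.ofFn b) p

/-! ### Decorated trees -/

/-- A directed tree on the vertices `0, …, numV - 1`, whose vertices are decorated by `k` labelled
outward and `m` labelled inward external legs. -/
structure DecoratedTree (k m : ℕ) where
  /-- number of vertices -/
  numV : ℕ
  /-- `(u, v) ∈ edges` is a directed edge from `u` to `v` -/
  edges : Finset (Fin numV × Fin numV)
  /-- the vertex that carries a given outward leg -/
  outLeg : Fin k → Fin numV
  /-- the vertex that carries a given inward leg -/
  inLeg : Fin m → Fin numV
  asymm : ∀ u v, (u, v) ∈ edges → (v, u) ∉ edges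
  isTree : (SimpleGraph.fromRel fun u v => (u, v) ∈ edges).IsTree

namespace DecoratedTree

variable {k m : ℕ}

/-- The outward degree: the number of outgoing edges and outward legs at `v`. -/
def degOut (T : DecoratedTree k m) (v : Fin T.numV) : ℕ :=
  (T.edges.filter fun e => e.1 = v).card + (Finset.univ.filter fun i => T.outLeg i = v).card

/-- The inward degree: the number of incoming edges and inward legs at `v`. -/
def degIn (T : DecoratedTree k m) (v : Fin T.numV) : ℕ :=
  (T.edges.filter fun e => e.2 = v).card + (Finset.univ.filter fun j => T.inLeg j = v).card

/-- Every vertex is semistable. -/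
def IsSemistable (T : DecoratedTree k m) : Prop :=
  ∀ v, 1 ≤ T.degIn v ∧ 1 ≤ T.degOut v ∧ 3 ≤ T.degIn v + T.degOut v

/-- Every edge `uv` is contractible, that is `deg⁺(u) = 1` or `deg⁻(v) = 1` (`u ≠ v` is automatic
in a tree). -/
def IsContractible (T : DecoratedTree k m) : Prop :=
  ∀ e ∈ T.edges, T.degOut e.1 = 1 ∨ T.degIn e.2 = 1

/-- Isomorphism of decorated trees: a bijection of the vertices that respects the directed edges
and the labelled legs. -/
def Iso (T T' : DecoratedTree k m) : Prop :=
  ∃ σ : Fin T.numV ≃ Fin T'.numV,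
    (∀ u v, (u, v) ∈ T.edges ↔ (σ u, σ v) ∈ T'.edges) ∧
      (∀ i, σ (T.outLeg i) = T'.outLeg i) ∧ ∀ j, σ (T.inLeg j) = T'.inLeg j

theorem Iso.refl (T : DecoratedTree k m) : T.Iso T :=
  ⟨Equiv.refl _, by simp, by simp, by simp⟩

theorem Iso.symm {T T' : DecoratedTree k m} (h : T.Iso T') : T'.Iso T := by
  obtain ⟨σ, h1, h2, h3⟩ := h
  refine ⟨σ.symm, fun u v => ?_, fun i => ?_, fun j => ?_⟩
  · rw [h1]; simp
  · rw [← h2]; simp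
  · rw [← h3]; simp

theorem Iso.trans {T T' T'' : DecoratedTree k m} (h : T.Iso T') (h' : T'.Iso T'') :
    T.Iso T'' := by
  obtain ⟨σ, h1, h2, h3⟩ := h
  obtain ⟨τ, h1', h2', h3'⟩ := h'
  refine ⟨σ.trans τ, fun u v => ?_, fun i => ?_, fun j => ?_⟩
  · rw [h1, h1']; rfl
  · rw [Equiv.trans_apply, h2, h2']
  · rw [Equiv.trans_apply, h3, h3']

/-- The unbarred indices at the vertex `v`, when the edges carry the unbarred indices `r` at their
tails and the outward legs carry the indices `a`. -/
def outIndices {n : ℕ} (T : DecoratedTree k m) (r : T.edges → Fin n) (a : Fin k → Fin n)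
    (v : Fin T.numV) : Multiset (Fin n) :=
  (∑ e : T.edges with e.1.1 = v, {r e}) + ∑ i : Fin k with T.outLeg i = v, {a i}

/-- The barred indices at the vertex `v`, when the edges carry the barred indices `s` at their
heads and the inward legs carry the indices `b`. -/
def inIndices {n : ℕ} (T : DecoratedTree k m) (s : T.edges → Fin n) (b : Fin m → Fin n)
    (v : Fin T.numV) : Multiset (Fin n) :=
  (∑ e : T.edges with e.1.2 = v, {s e}) + ∑ j : Fin m with T.inLeg j = v, {b j}

/-- The polynomial `g_T`: each vertex stands for the partial derivative of the metric whose unbarred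
(barred) indices are given by its outward (inward) half-edges, and each edge for the contraction of
its tail index `r` and its head index `s̄` with `g^{r s̄}`. -/
def poly {n : ℕ} (T : DecoratedTree k m) : PolyTensor n k m := fun a b =>
  ∑ r : T.edges → Fin n, ∑ s : T.edges → Fin n,
    (∏ e : T.edges, MvPolynomial.X (MetricVar.inv (r e) (s e))) *
      ∏ v : Fin T.numV, MvPolynomial.X (MetricVar.deriv (T.outIndices r a v) (T.inIndices s b v))

theorem Iso.numV_eq {T T' : DecoratedTree k m} (h : T.Iso T') : T.numV = T'.numV := by
  obtain ⟨σ, -⟩ := h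
  simpa using Fintype.card_congr σ

theorem Iso.poly_eq {n : ℕ} {T T' : DecoratedTree k m} (h : T.Iso T') :
    (T.poly : PolyTensor n k m) = T'.poly := by
  obtain ⟨σ, h1, h2, h3⟩ := h
  let ε : T.edges ≃ T'.edges := (σ.prodCongr σ).subtypeEquiv fun e => h1 e.1 e.2
  have hε1 : ∀ e, (ε e).1.1 = σ e.1.1 := fun e => rfl
  have hε2 : ∀ e, (ε e).1.2 = σ e.1.2 := fun e => rfl
  funext a b
  unfold poly
  refine Fintype.sum_equiv (ε.arrowCongr (Equiv.refl _)) _ _ fun r => ?_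
  refine Fintype.sum_equiv (ε.arrowCongr (Equiv.refl _)) _ _ fun s => ?_
  congr 1
  · exact Fintype.prod_equiv ε _ _ fun e => by simp [Equiv.arrowCongr]
  · refine Fintype.prod_equiv σ _ _ fun v => ?_
    congr 2
    · unfold outIndices
      simp only [Finset.sum_filter]
      congr 1
      · exact Fintype.sum_equiv ε _ _ fun e => by simp [Equiv.arrowCongr, hε1]
      · simp [← h2]
    · unfold inIndices
      simp only [Finset.sum_filter]
      congr 1
      · exact Fintype.sum_equiv ε _ _ fun e => by simp [Equiv.arrowCongr, hε2]
      · simp [← h3]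

theorem card_edges_lt (T : DecoratedTree k m) : T.edges.card < T.numV := by
  classical
  have hc := T.isTree.card_edgeFinset
  rw [Fintype.card_fin] at hc
  have hle : T.edges.card ≤ (SimpleGraph.fromRel fun u v => (u, v) ∈ T.edges).edgeFinset.card := by
    refine Finset.card_le_card_of_injOn (fun e => s(e.1, e.2)) ?_ ?_
    · rintro ⟨u, v⟩ he
      have he' : (u, v) ∈ T.edges := he
      simp only [SimpleGraph.coe_edgeFinset, SimpleGraph.mem_edgeSet, SimpleGraph.fromRel_adj]
      refine ⟨?_, Or.inl he'⟩
      rintro rfl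
      exact T.asymm _ _ he' he'
    · rintro ⟨u, v⟩ he ⟨u', v'⟩ he' h
      have h1 : (u, v) ∈ T.edges := he
      have h2 : (u', v') ∈ T.edges := he'
      simp only [Sym2.eq_iff] at h
      rcases h with ⟨rfl, rfl⟩ | ⟨rfl, rfl⟩
      · rfl
      · exact absurd h2 (T.asymm _ _ h1)
  omega

theorem IsSemistable.numV_lt {T : DecoratedTree k m} (h : T.IsSemistable) : T.numV < k + m := by
  have e1 : ∑ v, T.degOut v = T.edges.card + k := by
    unfold degOut
    rw [Finset.sum_add_distrib, ← Finset.card_eq_sum_card_fiberwise fun _ _ => Finset.mem_univ _,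
      ← Finset.card_eq_sum_card_fiberwise fun _ _ => Finset.mem_univ _]
    simp
  have e2 : ∑ v, T.degIn v = T.edges.card + m := by
    unfold degIn
    rw [Finset.sum_add_distrib, ← Finset.card_eq_sum_card_fiberwise fun _ _ => Finset.mem_univ _,
      ← Finset.card_eq_sum_card_fiberwise fun _ _ => Finset.mem_univ _]
    simp
  have e3 : ∑ _v : Fin T.numV, 3 ≤ ∑ v, (T.degIn v + T.degOut v) :=
    Finset.sum_le_sum fun v _ => (h v).2.2
  rw [Finset.sum_add_distrib, e1, e2] at e3
  simp only [Finset.sum_const, Finset.card_univ, Fintype.card_fin, smul_eq_mul] at e3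
  have := T.card_edges_lt
  omega

end DecoratedTree

/-- The contractible semistable decorated trees with `k` labelled outward and `m` labelled inward
external legs. -/
abbrev ContractibleTree (k m : ℕ) : Type :=
  {T : DecoratedTree k m // T.IsSemistable ∧ T.IsContractible}

instance treeSetoid (k m : ℕ) : Setoid (ContractibleTree k m) where
  r T T' := T.1.Iso T'.1
  iseqv := ⟨fun T => .refl T.1, fun h => h.symm, fun h h' => h.trans h'⟩

/-- The set `𝒯_g(a₁ ⋯ a_k | b̄₁ ⋯ b̄_m)`: contractible semistable decorated trees with the external
legs `a₁, …, a_k, b̄₁, …, b̄_m`, up to isomorphism. The legs are distinguished by their positions,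
even where the indices they carry coincide. -/
abbrev TreeClass (k m : ℕ) : Type := Quotient (treeSetoid k m)

instance finite_contractibleTree (k m : ℕ) : Finite (ContractibleTree k m) := by
  let f : ContractibleTree k m →
      Σ N : Fin (k + m), Finset (Fin N × Fin N) × (Fin k → Fin N) × (Fin m → Fin N) :=
    fun T => ⟨⟨T.1.numV, T.2.1.numV_lt⟩, T.1.edges, T.1.outLeg, T.1.inLeg⟩
  refine Finite.of_injective f ?_
  rintro ⟨⟨N, E, o, i, h1, h2⟩, h⟩ ⟨⟨N', E', o', i', h1', h2'⟩, h'⟩ hf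
  simp only [f, Sigma.mk.injEq, Fin.mk.injEq] at hf
  obtain ⟨rfl, hf⟩ := hf
  simp only [heq_eq_eq, Prod.mk.injEq] at hf
  obtain ⟨rfl, rfl, rfl⟩ := hf
  rfl

instance fintypeTreeClass (k m : ℕ) : Fintype (TreeClass k m) := Fintype.ofFinite _

/-- The signed polynomial `(-1)^{|V(T)| + 1} g_T` of an isomorphism class of trees. -/
def TreeClass.signedPoly {n k m : ℕ} (T : TreeClass k m) : PolyTensor n k m := fun a b =>
  Quotient.lift
    (fun T : ContractibleTree k m => (-1) ^ (T.1.numV + 1) * T.1.poly a b)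
    (fun _ _ h => by
      have h' : DecoratedTree.Iso _ _ := h
      simp only [h'.numV_eq, h'.poly_eq]) T

/-- The tree sum `∑_T (-1)^{|V(T)| + 1} g_T` over `𝒯_g(a₁ ⋯ a_k | b̄₁ ⋯ b̄_m)`. -/
def treeSum (n k m : ℕ) : PolyTensor n k m := fun a b =>
  ∑ T : TreeClass k m, T.signedPoly a b

end KahlerTree

end

/-! Let `φ` be a holomorphic change of coordinates whose Jacobian matrix at `z` is the identity, and
suppose that the pure derivatives of `h = φ^* g` vanish at `z` up to the order needed. By the
formula of Faà di Bruno (`kahlerDeriv_pullback`) a mixed derivative of `h` at `z` is a sum over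
pairs of set partitions, one of the unbarred and one of the barred legs. A block `C` with label `c`
contributes the weight `S_C^c`, the derivative of `φ_c` in the directions of `C` (or its conjugate),
and the labels of the blocks are the indices of a derivative of `g` at `φ(z)`.

The same formula for the vanishing pure derivatives determines these weights. Splitting off the
partition with one block and contracting with the inverse metric gives, for `|C| ≥ 2`, a recursion
`S_C^r = -∑_{|π| ≥ 2} g^{r s̄} g_{π s̄} S_π`, and similarly on the barred side; on single legs `S`
is the Kronecker delta. Unfolding it yields a sum over labelled laminar families of subsets of `C`,
that is, over rooted forests with the legs as leaves, with one sign for each cluster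
(`forestSum_eq_blockSum`). The mixed derivative of `h` is therefore a signed sum over pairs of
forests glued at a common root. The term in which all unbarred legs form one block carries a pure
derivative of `h` as a factor and drops out, so the root has at least two unbarred children.

These glued pairs are exactly the contractible semistable trees (`exists_presents`,
`DecoratedTree.exists_forests`). If `deg⁺(u) ≥ 2` and `u → v` is an edge, then `deg⁻(v) = 1` by
contractibility, hence `deg⁺(v) ≥ 2` by semistability. So the vertices with `deg⁺ = 1` form a forest
directed towards a root and the others form one directed away from it; the root exists because a
tree has fewer edges than vertices. The clusters of both forests can be read off from the tree, so
each isomorphism class is counted once (`eval_treeSum`). Hence the tree sum for `g` at `φ(z)` is the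
mixed derivative of `h` at `z` (`eval_treeSum_of_pure_eq_zero`).

With `φ` the identity this is the value in normal coordinates. For invariance under `χ` with
Jacobian matrix `L` at `z`, take such coordinates `φ` for `g` at `χ(z)`, which exist by
`exists_normal_coordinates`. Then `χ⁻¹ ∘ φ ∘ L` are such coordinates for `χ^* g` at `z`, and the two
pulled back metrics differ by the linear map `L`, under which all derivatives are tensors.
Uniqueness holds because any metric can be made normal at a given point, where all canonical
invariants have the same prescribed value. -/

noncomputable section

namespace KahlerTree

set_option linter.unusedSectionVars false

/-! ### Sums over set partitions -/

section BlockSum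

variable {ι κ : Type} [LinearOrder ι] [Fintype κ]

/-- The sum over all set partitions of `A` and all labellings of the blocks by `κ` of the product of
the block weights `S C c` with the value of `F` at the multiset of labels. The block that contains
the largest element of `A` is split off first. -/
def blockSum (S : Finset ι → κ → ℂ) (F : Multiset κ → ℂ) (A : Finset ι) : ℂ :=
  if h : A.Nonempty then
    ∑ D ∈ (A.erase (A.max' h)).powerset, ∑ c, S (insert (A.max' h) D) c *
      blockSum S (fun α => F (c ::ₘ α)) (A.erase (A.max' h) \ D)
  else F 0
termination_by A.card
decreasing_by
  exact (Finset.card_le_card Finset.sdiff_subset).trans_lt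
    (Finset.card_erase_lt_of_mem (A.max'_mem h))

/-- The part of `blockSum` that comes from the partitions into at least two blocks. -/
def properBlockSum (S : Finset ι → κ → ℂ) (F : Multiset κ → ℂ) (A : Finset ι) : ℂ :=
  if h : A.Nonempty then
    ∑ D ∈ (A.erase (A.max' h)).ssubsets, ∑ c, S (insert (A.max' h) D) c *
      blockSum S (fun α => F (c ::ₘ α)) (A.erase (A.max' h) \ D)
  else F 0

theorem blockSum_empty (S : Finset ι → κ → ℂ) (F : Multiset κ → ℂ) : blockSum S F ∅ = F 0 := by
  rw [blockSum]; simp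

theorem blockSum_insert (S : Finset ι → κ → ℂ) (F : Multiset κ → ℂ) {a : ι} {A : Finset ι}
    (h : ∀ x ∈ A, x < a) :
    blockSum S F (insert a A) = ∑ D ∈ A.powerset, ∑ c, S (insert a D) c *
      blockSum S (fun α => F (c ::ₘ α)) (A \ D) := by
  have hne : (insert a A).Nonempty := Finset.insert_nonempty _ _
  have hm : (insert a A).max' hne = a :=
    (Finset.max'_eq_iff _ _ _).2 ⟨Finset.mem_insert_self _ _, fun b hb => by
      rcases Finset.mem_insert.1 hb with rfl | hb
      · exact le_rfl
      · exact (h _ hb).le⟩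
  have ha : a ∉ A := fun ha => lt_irrefl _ (h a ha)
  rw [blockSum, dif_pos hne]
  simp only [hm, Finset.erase_insert ha]

theorem properBlockSum_insert (S : Finset ι → κ → ℂ) (F : Multiset κ → ℂ) {a : ι} {A : Finset ι}
    (h : ∀ x ∈ A, x < a) :
    properBlockSum S F (insert a A) = ∑ D ∈ A.ssubsets, ∑ c, S (insert a D) c *
      blockSum S (fun α => F (c ::ₘ α)) (A \ D) := by
  have hne : (insert a A).Nonempty := Finset.insert_nonempty _ _
  have hm : (insert a A).max' hne = a :=
    (Finset.max'_eq_iff _ _ _).2 ⟨Finset.mem_insert_self _ _, fun b hb => by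
      rcases Finset.mem_insert.1 hb with rfl | hb
      · exact le_rfl
      · exact (h _ hb).le⟩
  have ha : a ∉ A := fun ha => lt_irrefl _ (h a ha)
  rw [properBlockSum, dif_pos hne]
  simp only [hm, Finset.erase_insert ha]

theorem exists_insert_lt {A : Finset ι} (h : A.Nonempty) :
    ∃ a B, (∀ x ∈ B, x < a) ∧ A = insert a B ∧ a ∉ B := by
  refine ⟨A.max' h, A.erase (A.max' h), fun x hx => ?_, (Finset.insert_erase (A.max'_mem h)).symm,
    Finset.notMem_erase _ _⟩
  exact lt_of_le_of_ne (A.le_max' x (Finset.mem_of_mem_erase hx)) (Finset.ne_of_mem_erase hx)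

/-- Isolates the partition with a single block. When a block sum vanishes, this expresses the weight
of the full block through the weights of smaller blocks, which is the origin of the recursion for
the weights. -/
theorem blockSum_eq_proper_add (S : Finset ι → κ → ℂ) (F : Multiset κ → ℂ) {A : Finset ι}
    (h : A.Nonempty) : blockSum S F A = properBlockSum S F A + ∑ c, S A c * F {c} := by
  obtain ⟨a, B, hB, rfl, -⟩ := exists_insert_lt h
  rw [blockSum_insert S F hB, properBlockSum_insert S F hB, Finset.ssubsets,
    ← Finset.sum_erase_add _ _ (Finset.mem_powerset_self B)]
  simp [blockSum_empty]

theorem blockSum_congr {S S' : Finset ι → κ → ℂ} (F : Multiset κ → ℂ) {A : Finset ι}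
    (hS : ∀ C ⊆ A, C.Nonempty → S C = S' C) : blockSum S F A = blockSum S' F A := by
  induction hn : A.card using Nat.strong_induction_on generalizing A F with
  | _ N ih =>
    rcases A.eq_empty_or_nonempty with rfl | hne
    · rw [blockSum_empty, blockSum_empty]
    obtain ⟨a, B, hB, rfl, haB⟩ := exists_insert_lt hne
    rw [blockSum_insert _ _ hB, blockSum_insert _ _ hB]
    refine Finset.sum_congr rfl fun D hD => Finset.sum_congr rfl fun c _ => ?_
    have hDB := Finset.mem_powerset.1 hD
    rw [hS _ (Finset.insert_subset_insert a hDB) (Finset.insert_nonempty _ _)]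
    congr 1
    refine ih _ ?_ _ (fun C hC => hS C ?_) rfl
    · rw [← hn, Finset.card_insert_of_notMem haB]
      exact Nat.lt_succ_of_le (Finset.card_le_card Finset.sdiff_subset)
    · exact hC.trans (Finset.sdiff_subset.trans (Finset.subset_insert _ _))

/-- In a partition into at least two blocks, the block of the largest element is not everything and
the other blocks miss that element. So a recursion `S C = -properBlockSum S _ C` is well founded for
the cardinality. -/
theorem properBlockSum_congr {S S' : Finset ι → κ → ℂ} (F : Multiset κ → ℂ) {A : Finset ι}
    (hS : ∀ C ⊂ A, C.Nonempty → S C = S' C) : properBlockSum S F A = properBlockSum S' F A := by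
  rcases A.eq_empty_or_nonempty with rfl | hne
  · simp [properBlockSum]
  obtain ⟨a, B, hB, rfl, haB⟩ := exists_insert_lt hne
  rw [properBlockSum_insert _ _ hB, properBlockSum_insert _ _ hB]
  refine Finset.sum_congr rfl fun D hD => Finset.sum_congr rfl fun c _ => ?_
  have hDB := Finset.mem_ssubsets.1 hD
  have hlt : insert a D ⊂ insert a B := by
    obtain ⟨x, hx, hxD⟩ := (Finset.ssubset_iff_of_subset hDB.1).1 hDB
    refine (Finset.ssubset_iff_of_subset (Finset.insert_subset_insert a hDB.1)).2
      ⟨x, Finset.mem_insert_of_mem hx, fun h => ?_⟩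
    rcases Finset.mem_insert.1 h with rfl | h
    · exact haB hx
    · exact hxD h
  rw [hS _ hlt (Finset.insert_nonempty _ _)]
  congr 1
  refine blockSum_congr _ fun C hC => hS C ?_
  refine (Finset.ssubset_iff_of_subset
    (hC.trans (Finset.sdiff_subset.trans (Finset.subset_insert _ _)))).2
      ⟨a, Finset.mem_insert_self _ _, fun h => haB (Finset.sdiff_subset (hC h))⟩

/-- Linearity in `F`: contractions with the inverse metric or with a Jacobian matrix can be moved
through a block sum. -/
theorem blockSum_sum {τ : Type*} (S : Finset ι → κ → ℂ) (s : Finset τ) (w : τ → ℂ)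
    (F : τ → Multiset κ → ℂ) (A : Finset ι) :
    blockSum S (fun α => ∑ t ∈ s, w t * F t α) A = ∑ t ∈ s, w t * blockSum S (F t) A := by
  induction hn : A.card using Nat.strong_induction_on generalizing A F with
  | _ N ih =>
    rcases A.eq_empty_or_nonempty with rfl | hne
    · simp [blockSum_empty]
    obtain ⟨a, B, hB, rfl, haB⟩ := exists_insert_lt hne
    simp only [blockSum_insert _ _ hB, Finset.mul_sum]
    rw [Finset.sum_comm (s := s)]
    refine Finset.sum_congr rfl fun D hD => ?_
    rw [Finset.sum_comm (s := s)]
    refine Finset.sum_congr rfl fun c _ => ?_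
    rw [ih _ _ (fun t α => F t (c ::ₘ α)) _ rfl, Finset.mul_sum]
    · exact Finset.sum_congr rfl fun t _ => by ring
    · rw [← hn, Finset.card_insert_of_notMem haB]
      exact Nat.lt_succ_of_le (Finset.card_le_card Finset.sdiff_subset)

theorem properBlockSum_sum {τ : Type*} (S : Finset ι → κ → ℂ) (s : Finset τ) (w : τ → ℂ)
    (F : τ → Multiset κ → ℂ) {A : Finset ι} (hA : A.Nonempty) :
    properBlockSum S (fun α => ∑ t ∈ s, w t * F t α) A =
      ∑ t ∈ s, w t * properBlockSum S (F t) A := by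
  -- The claim is what remains of linearity of the full sum after cancelling the one-block terms.
  have h := blockSum_sum S s w F A
  simp only [blockSum_eq_proper_add S _ hA, mul_add, Finset.sum_add_distrib, Finset.mul_sum] at h
  rw [Finset.sum_comm (s := Finset.univ)] at h
  have h2 : ∑ y ∈ s, ∑ x, S A x * (w y * F y {x}) = ∑ x ∈ s, ∑ i, w x * (S A i * F x {i}) :=
    Finset.sum_congr rfl fun y _ => Finset.sum_congr rfl fun x _ => by ring
  rw [h2] at h
  exact add_right_cancel h

end BlockSum

/-! ### Labelled hierarchies -/

section Hierarchy

variable {ι κ : Type}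

/-- A labelled hierarchy on `A`: a laminar family of subsets of `A` with at least two elements, each
of which carries a label. -/
structure IsHierarchy (A : Finset ι) (H : Finset (Finset ι × κ)) : Prop where
  subset : ∀ p ∈ H, p.1 ⊆ A
  two_le : ∀ p ∈ H, 2 ≤ p.1.card
  inj : ∀ p ∈ H, ∀ q ∈ H, p.1 = q.1 → p = q
  laminar : ∀ p ∈ H, ∀ q ∈ H, p.1 ⊆ q.1 ∨ q.1 ⊆ p.1 ∨ Disjoint p.1 q.1

/-- `p` is the smallest cluster of `H` among those which strictly contain `s`. -/
def IsPar (H : Finset (Finset ι × κ)) (s p : Finset ι) : Prop :=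
  s ⊂ p ∧ ∀ e ∈ H, s ⊂ e.1 → p ⊆ e.1

variable [DecidableEq ι]

open Classical in
/-- The labels of the children of the cluster `p` in `H`; leaves are labelled by `b`. -/
def childLabels (b : ι → κ) (H : Finset (Finset ι × κ)) (p : Finset ι) : Multiset κ :=
  (∑ q ∈ H with IsPar H q.1 p, {q.2}) + ∑ j ∈ p with IsPar H {j} p, {b j}

open Classical in
/-- The labels of the maximal clusters of `H` and of the leaves in `A` outside all clusters. -/
def topLabels (b : ι → κ) (H : Finset (Finset ι × κ)) (A : Finset ι) : Multiset κ :=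
  (∑ q ∈ H with ∀ e ∈ H, ¬ q.1 ⊂ e.1, {q.2}) + ∑ j ∈ A with ∀ e ∈ H, ¬ {j} ⊂ e.1, {b j}

/-- The product of the vertex weights of a labelled hierarchy, each with a sign. -/
def weight (M : κ → Multiset κ → ℂ) (b : ι → κ) (H : Finset (Finset ι × κ)) : ℂ :=
  ∏ p ∈ H, -M p.2 (childLabels b H p.1)

variable [Fintype κ] [DecidableEq κ]

open Classical in
/-- The finite set of all labelled hierarchies on `A`. -/
def hierarchies (κ : Type) [Fintype κ] [DecidableEq κ] (A : Finset ι) :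
    Finset (Finset (Finset ι × κ)) :=
  (A.powerset ×ˢ Finset.univ).powerset.filter (IsHierarchy A)

theorem mem_hierarchies {A : Finset ι} {H : Finset (Finset ι × κ)} :
    H ∈ hierarchies κ A ↔ IsHierarchy A H := by
  classical
  rw [hierarchies, Finset.mem_filter, Finset.mem_powerset, and_iff_right_iff_imp]
  intro h p hp
  simp [h.subset p hp]

/-- The sum over all labelled hierarchies on `A`. -/
def forestSum (M : κ → Multiset κ → ℂ) (b : ι → κ) (F : Multiset κ → ℂ) (A : Finset ι) : ℂ :=
  ∑ H ∈ hierarchies κ A, weight M b H * F (topLabels b H A)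

open Classical in
/-- The sum over the labelled hierarchies on `A` in which `A` is not a cluster. -/
def properForestSum (M : κ → Multiset κ → ℂ) (b : ι → κ) (F : Multiset κ → ℂ) (A : Finset ι) : ℂ :=
  ∑ H ∈ hierarchies κ A with ∀ p ∈ H, p.1 ≠ A, weight M b H * F (topLabels b H A)

end Hierarchy

end KahlerTree

end

noncomputable section

namespace KahlerTree

set_option linter.unusedSectionVars false

/-! ### The recursion for sums over hierarchies -/

section ForestRecursion

variable {ι κ : Type} [DecidableEq ι] [Fintype κ] [DecidableEq κ]

theorem IsHierarchy.nonempty {A : Finset ι} {H : Finset (Finset ι × κ)} (h : IsHierarchy A H)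
    {p : Finset ι × κ} (hp : p ∈ H) : p.1.Nonempty :=
  Finset.card_pos.1 (lt_of_lt_of_le two_pos (h.two_le p hp))

theorem IsHierarchy.mono {A : Finset ι} {H H' : Finset (Finset ι × κ)} (h : IsHierarchy A H)
    (hH : H' ⊆ H) : IsHierarchy A H' :=
  ⟨fun p hp => h.subset p (hH hp), fun p hp => h.two_le p (hH hp),
    fun p hp q hq => h.inj p (hH hp) q (hH hq), fun p hp q hq => h.laminar p (hH hp) q (hH hq)⟩

/-! ### Hierarchies on disjoint sets -/

section Union

variable {C C' : Finset ι} {H₁ H₂ : Finset (Finset ι × κ)}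

theorem not_subset_of_disjoint (hC : Disjoint C C') {s t : Finset ι} (hs : s ⊆ C)
    (hne : s.Nonempty) (ht : t ⊆ C') : ¬ s ⊆ t := fun h => by
  obtain ⟨x, hx⟩ := hne
  exact Finset.disjoint_left.1 hC (hs hx) (ht (h hx))

theorem IsHierarchy.union (h₁ : IsHierarchy C H₁) (h₂ : IsHierarchy C' H₂) (hC : Disjoint C C') :
    IsHierarchy (C ∪ C') (H₁ ∪ H₂) where
  subset p hp := (Finset.mem_union.1 hp).elim
    (fun h => (h₁.subset p h).trans Finset.subset_union_left)
    (fun h => (h₂.subset p h).trans Finset.subset_union_right)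
  two_le p hp := (Finset.mem_union.1 hp).elim (h₁.two_le p) (h₂.two_le p)
  inj p hp q hq hpq := by
    rcases Finset.mem_union.1 hp with hp | hp <;> rcases Finset.mem_union.1 hq with hq | hq
    · exact h₁.inj p hp q hq hpq
    · exact absurd hpq.subset
        (not_subset_of_disjoint hC (h₁.subset p hp) (h₁.nonempty hp) (h₂.subset q hq))
    · exact absurd hpq.symm.subset
        (not_subset_of_disjoint hC (h₁.subset q hq) (h₁.nonempty hq) (h₂.subset p hp))
    · exact h₂.inj p hp q hq hpq
  laminar p hp q hq := by
    rcases Finset.mem_union.1 hp with hp | hp <;> rcases Finset.mem_union.1 hq with hq | hq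
    · exact h₁.laminar p hp q hq
    · exact Or.inr (Or.inr (Finset.disjoint_of_subset_left (h₁.subset p hp)
        (Finset.disjoint_of_subset_right (h₂.subset q hq) hC)))
    · exact Or.inr (Or.inr (Finset.disjoint_of_subset_left (h₂.subset p hp)
        (Finset.disjoint_of_subset_right (h₁.subset q hq) hC.symm)))
    · exact h₂.laminar p hp q hq

theorem disjoint_hierarchies (h₁ : IsHierarchy C H₁) (h₂ : IsHierarchy C' H₂)
    (hC : Disjoint C C') : Disjoint H₁ H₂ :=
  Finset.disjoint_left.2 fun p hp hp' =>
    not_subset_of_disjoint hC (h₁.subset p hp) (h₁.nonempty hp) (h₂.subset p hp') subset_rfl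

/-- The clusters of `H₂` lie in `C'`, so none of them contains a nonempty subset of `C`: the two
hierarchies do not interact, and weights and labels factor. -/
theorem isPar_union_left (h₂ : IsHierarchy C' H₂) (hC : Disjoint C C') {s p : Finset ι}
    (hs : s ⊆ C) (hne : s.Nonempty) : IsPar (H₁ ∪ H₂) s p ↔ IsPar H₁ s p := by
  refine and_congr_right fun _ => ⟨fun h e he => h e (Finset.mem_union_left _ he), fun h e he => ?_⟩
  rcases Finset.mem_union.1 he with he | he
  · exact h e he
  · exact fun hse => absurd hse.1 (not_subset_of_disjoint hC hs hne (h₂.subset e he))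

theorem childLabels_union_left (b : ι → κ) (h₁ : IsHierarchy C H₁) (h₂ : IsHierarchy C' H₂)
    (hC : Disjoint C C') {p : Finset ι} (hp : p ⊆ C) :
    childLabels b (H₁ ∪ H₂) p = childLabels b H₁ p := by
  classical
  unfold childLabels
  congr 1
  · refine Finset.sum_congr ?_ fun _ _ => rfl
    ext q
    simp only [Finset.mem_filter, Finset.mem_union]
    constructor
    · rintro ⟨hq | hq, hqp⟩
      · exact ⟨hq, (isPar_union_left h₂ hC (h₁.subset q hq) (h₁.nonempty hq)).1 hqp⟩
      · exact absurd hqp.1.1 (not_subset_of_disjoint hC.symm (h₂.subset q hq) (h₂.nonempty hq) hp)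
    · rintro ⟨hq, hqp⟩
      exact ⟨Or.inl hq, (isPar_union_left h₂ hC (h₁.subset q hq) (h₁.nonempty hq)).2 hqp⟩
  · refine Finset.sum_congr (Finset.filter_congr fun j hj => ?_) fun _ _ => rfl
    exact isPar_union_left h₂ hC (Finset.singleton_subset_iff.2 (hp hj))
      (Finset.singleton_nonempty j)

theorem top_union_left (h₂ : IsHierarchy C' H₂) (hC : Disjoint C C') {s : Finset ι}
    (hs : s ⊆ C) (hne : s.Nonempty) :
    (∀ e ∈ H₁ ∪ H₂, ¬ s ⊂ e.1) ↔ ∀ e ∈ H₁, ¬ s ⊂ e.1 := by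
  refine ⟨fun h e he => h e (Finset.mem_union_left _ he), fun h e he => ?_⟩
  rcases Finset.mem_union.1 he with he | he
  · exact h e he
  · exact fun hse => not_subset_of_disjoint hC hs hne (h₂.subset e he) hse.1

theorem topLabels_union (b : ι → κ) (h₁ : IsHierarchy C H₁) (h₂ : IsHierarchy C' H₂)
    (hC : Disjoint C C') :
    topLabels b (H₁ ∪ H₂) (C ∪ C') = topLabels b H₁ C + topLabels b H₂ C' := by
  classical
  unfold topLabels
  rw [Finset.filter_union, Finset.filter_union, Finset.sum_union, Finset.sum_union,
    add_add_add_comm]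
  · congr 1
    · congr 1
      · refine Finset.sum_congr (Finset.filter_congr fun q hq => ?_) fun _ _ => rfl
        exact top_union_left h₂ hC (h₁.subset q hq) (h₁.nonempty hq)
      · refine Finset.sum_congr (Finset.filter_congr fun j hj => ?_) fun _ _ => rfl
        exact top_union_left h₂ hC (Finset.singleton_subset_iff.2 hj) (Finset.singleton_nonempty j)
    · rw [Finset.union_comm]
      congr 1
      · refine Finset.sum_congr (Finset.filter_congr fun q hq => ?_) fun _ _ => rfl
        exact top_union_left h₁ hC.symm (h₂.subset q hq) (h₂.nonempty hq)
      · refine Finset.sum_congr (Finset.filter_congr fun j hj => ?_) fun _ _ => rfl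
        exact top_union_left h₁ hC.symm (Finset.singleton_subset_iff.2 hj)
          (Finset.singleton_nonempty j)
  · exact Finset.disjoint_filter_filter hC
  · exact Finset.disjoint_filter_filter (disjoint_hierarchies h₁ h₂ hC)

theorem weight_union (M : κ → Multiset κ → ℂ) (b : ι → κ) (h₁ : IsHierarchy C H₁)
    (h₂ : IsHierarchy C' H₂) (hC : Disjoint C C') :
    weight M b (H₁ ∪ H₂) = weight M b H₁ * weight M b H₂ := by
  unfold weight
  rw [Finset.prod_union (disjoint_hierarchies h₁ h₂ hC)]
  congr 1
  · exact Finset.prod_congr rfl fun p hp => by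
      rw [childLabels_union_left b h₁ h₂ hC (h₁.subset p hp)]
  · exact Finset.prod_congr rfl fun p hp => by
      rw [Finset.union_comm, childLabels_union_left b h₂ h₁ hC.symm (h₂.subset p hp)]

end Union

/-- The largest cluster of `H` that contains `a`, or `{a}` if there is none. -/
def topSet (H : Finset (Finset ι × κ)) (a : ι) : Finset ι :=
  insert a ((H.filter fun p => a ∈ p.1).biUnion Prod.fst)

/-- By laminarity the clusters containing `a` form a chain, so one of largest cardinality contains
all the others and equals their union. -/
theorem topSet_eq {A : Finset ι} {H : Finset (Finset ι × κ)} (h : IsHierarchy A H) (a : ι) :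
    topSet H a = {a} ∧ (∀ p ∈ H, a ∉ p.1) ∨ ∃ q ∈ H, a ∈ q.1 ∧ topSet H a = q.1 := by
  rcases (H.filter fun p => a ∈ p.1).eq_empty_or_nonempty with he | hne
  · left
    refine ⟨by rw [topSet, he]; rfl, fun p hp hap => ?_⟩
    exact Finset.notMem_empty p (he ▸ Finset.mem_filter.2 ⟨hp, hap⟩)
  · right
    obtain ⟨q, hq, hmax⟩ := Finset.exists_max_image _ (fun p => p.1.card) hne
    obtain ⟨hqH, haq⟩ := Finset.mem_filter.1 hq
    refine ⟨q, hqH, haq, ?_⟩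
    apply Finset.Subset.antisymm
    · refine Finset.insert_subset haq (Finset.biUnion_subset.2 fun p hp => ?_)
      obtain ⟨hpH, hap⟩ := Finset.mem_filter.1 hp
      rcases h.laminar p hpH q hqH with h1 | h1 | h1
      · exact h1
      · exact (Finset.eq_of_subset_of_card_le h1 (hmax p hp)).symm.subset
      · exact absurd haq (Finset.disjoint_left.1 h1 hap)
    · exact (Finset.subset_biUnion_of_mem Prod.fst hq).trans (Finset.subset_insert _ _)

theorem mem_topSet (H : Finset (Finset ι × κ)) (a : ι) : a ∈ topSet H a :=
  Finset.mem_insert_self _ _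

theorem subset_topSet {H : Finset (Finset ι × κ)} {a : ι} {p : Finset ι × κ} (hp : p ∈ H)
    (ha : a ∈ p.1) : p.1 ⊆ topSet H a :=
  (Finset.subset_biUnion_of_mem Prod.fst (Finset.mem_filter.2 ⟨hp, ha⟩)).trans
    (Finset.subset_insert _ _)

theorem topSet_subset {A : Finset ι} {H : Finset (Finset ι × κ)} (h : IsHierarchy A H) {a : ι}
    (ha : a ∈ A) : topSet H a ⊆ A :=
  Finset.insert_subset ha (Finset.biUnion_subset.2 fun p hp =>
    h.subset p (Finset.mem_filter.1 hp).1)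

theorem subset_or_disjoint_topSet {A : Finset ι} {H : Finset (Finset ι × κ)} (h : IsHierarchy A H)
    (a : ι) {p : Finset ι × κ} (hp : p ∈ H) :
    p.1 ⊆ topSet H a ∨ Disjoint p.1 (topSet H a) := by
  rcases topSet_eq h a with ⟨h1, h2⟩ | ⟨q, hq, haq, h1⟩
  · right
    rw [h1, Finset.disjoint_singleton_right]
    exact h2 p hp
  · rcases h.laminar p hp q hq with h3 | h3 | h3
    · exact Or.inl (h1 ▸ h3)
    · exact Or.inl (subset_topSet hp (h3 haq))
    · exact Or.inr (h1 ▸ h3)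

-- A hierarchy is cut along `C = topSet H a` into the clusters inside `C` and those disjoint from
-- it. The condition on `H₁`, that `C` is a single point or itself a cluster, says precisely that
-- `C` can be recovered as the top set.
open Classical in
theorem forestSum_split (M : κ → Multiset κ → ℂ) (b : ι → κ) (F : Multiset κ → ℂ) {A : Finset ι}
    {a : ι} (ha : a ∈ A) :
    forestSum M b F A = ∑ C ∈ A.powerset with a ∈ C,
      ∑ H₁ ∈ hierarchies κ C with C.card = 1 ∨ ∃ p ∈ H₁, p.1 = C,
        weight M b H₁ * forestSum M b (fun β => F (topLabels b H₁ C + β)) (A \ C) := by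
  unfold forestSum
  rw [← Finset.sum_fiberwise_of_maps_to (s := hierarchies κ A)
    (t := A.powerset.filter fun C => a ∈ C) (g := fun H => topSet H a)]
  swap
  · exact fun H hH => Finset.mem_filter.2
      ⟨Finset.mem_powerset.2 (topSet_subset (mem_hierarchies.1 hH) ha), mem_topSet H a⟩
  refine Finset.sum_congr rfl fun C hC => ?_
  obtain ⟨hCA, haC⟩ := Finset.mem_filter.1 hC
  rw [Finset.mem_powerset] at hCA
  simp only [Finset.mul_sum]
  rw [← Finset.sum_product']
  have hdis : Disjoint C (A \ C) := Finset.disjoint_sdiff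
  have hun : C ∪ (A \ C) = A := Finset.union_sdiff_of_subset hCA
  refine (Finset.sum_bij' (fun P _ => P.1 ∪ P.2)
    (fun H _ => (H.filter fun p => p.1 ⊆ C, H.filter fun p => ¬ p.1 ⊆ C)) ?_ ?_ ?_ ?_ ?_).symm
  · rintro ⟨H₁, H₂⟩ hH
    obtain ⟨hH₁, hH₂⟩ := Finset.mem_product.1 hH
    obtain ⟨hH₁, hfull⟩ := Finset.mem_filter.1 hH₁
    have h₁ := mem_hierarchies.1 hH₁
    have h₂ := mem_hierarchies.1 hH₂
    have h := h₁.union h₂ hdis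
    rw [hun] at h
    refine Finset.mem_filter.2 ⟨mem_hierarchies.2 h, ?_⟩
    -- No cluster of `H₂` contains `a`, so the top set stays inside `C`; it fills `C` since `C` is
    -- `{a}` or a cluster of `H₁`.
    apply Finset.Subset.antisymm
    · refine Finset.insert_subset haC (Finset.biUnion_subset.2 fun p hp => ?_)
      obtain ⟨hp, hap⟩ := Finset.mem_filter.1 hp
      rcases Finset.mem_union.1 hp with hp | hp
      · exact h₁.subset p hp
      · exact absurd (h₂.subset p hp hap) (Finset.disjoint_left.1 hdis haC)
    · rcases hfull with h1 | ⟨p, hp, rfl⟩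
      · obtain ⟨x, rfl⟩ := Finset.card_eq_one.1 h1
        rw [Finset.mem_singleton.1 haC]
        exact Finset.singleton_subset_iff.2 (mem_topSet _ _)
      · exact subset_topSet (Finset.mem_union_left _ hp) haC
  · intro H hH
    obtain ⟨hH, htop⟩ := Finset.mem_filter.1 hH
    have h := mem_hierarchies.1 hH
    refine Finset.mem_product.2 ⟨Finset.mem_filter.2 ⟨mem_hierarchies.2 ?_, ?_⟩,
      mem_hierarchies.2 ?_⟩
    · exact { h.mono (Finset.filter_subset _ _) with
        subset := fun p hp => (Finset.mem_filter.1 hp).2 }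
    · rcases topSet_eq h a with ⟨h1, -⟩ | ⟨q, hq, -, h1⟩
      · exact Or.inl (by rw [← htop, h1, Finset.card_singleton])
      · rw [htop] at h1
        exact Or.inr ⟨q, Finset.mem_filter.2 ⟨hq, h1.symm.subset⟩, h1.symm⟩
    · refine { h.mono (Finset.filter_subset _ _) with subset := fun p hp => ?_ }
      obtain ⟨hp, hpC⟩ := Finset.mem_filter.1 hp
      rcases subset_or_disjoint_topSet h a hp with h1 | h1
      · exact absurd (htop ▸ h1) hpC
      · exact Finset.subset_sdiff.2 ⟨h.subset p hp, htop ▸ h1⟩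
  · rintro ⟨H₁, H₂⟩ hH
    obtain ⟨hH₁, hH₂⟩ := Finset.mem_product.1 hH
    have h₁ := mem_hierarchies.1 (Finset.mem_filter.1 hH₁).1
    have h₂ := mem_hierarchies.1 hH₂
    have hn : ∀ p ∈ H₂, ¬ p.1 ⊆ C := fun p hp =>
      not_subset_of_disjoint hdis.symm (h₂.subset p hp) (h₂.nonempty hp) subset_rfl
    refine Prod.ext ?_ ?_
    · ext p
      simp only [Finset.mem_filter, Finset.mem_union]
      exact ⟨fun hp => hp.1.resolve_right fun h => hn p h hp.2, fun hp => ⟨Or.inl hp, h₁.subset p hp⟩⟩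
    · ext p
      simp only [Finset.mem_filter, Finset.mem_union]
      exact ⟨fun hp => hp.1.resolve_left fun h => hp.2 (h₁.subset p h), fun hp => ⟨Or.inr hp, hn p hp⟩⟩
  · intro H _
    exact Finset.filter_union_filter_not_eq _ H
  · rintro ⟨H₁, H₂⟩ hH
    obtain ⟨hH₁, hH₂⟩ := Finset.mem_product.1 hH
    have h₁ := mem_hierarchies.1 (Finset.mem_filter.1 hH₁).1
    have h₂ := mem_hierarchies.1 hH₂
    have ht := topLabels_union b h₁ h₂ hdis
    rw [hun] at ht
    simp only [weight_union M b h₁ h₂ hdis, ht, mul_assoc]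

/-! ### Hierarchies in which the whole set is a cluster -/

section Full

variable {C : Finset ι} {H : Finset (Finset ι × κ)} {c : κ}

theorem isPar_insert_full {s p : Finset ι} (hp : p ⊆ C) :
    IsPar (insert (C, c) H) s p ↔ IsPar H s p := by
  simp only [IsPar, Finset.forall_mem_insert, hp, implies_true, true_and]

/-- The cluster `C` contains everything, so it is the parent of `s` exactly when no smaller cluster
is available. Thus adding `C` turns the former top labels into the labels of the children of `C`. -/
theorem isPar_full (h : IsHierarchy C H) (hC : ∀ p ∈ H, p.1 ≠ C) {s : Finset ι} (hs : s ⊂ C) :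
    IsPar (insert (C, c) H) s C ↔ ∀ e ∈ H, ¬ s ⊂ e.1 := by
  rw [isPar_insert_full subset_rfl]
  simp only [IsPar, hs, true_and]
  exact ⟨fun h1 e he hse => hC e he (Finset.Subset.antisymm (h.subset e he) (h1 e he hse)),
    fun h1 e he hse => absurd hse (h1 e he)⟩

theorem IsHierarchy.insert_full (h : IsHierarchy C H) (hC : ∀ p ∈ H, p.1 ≠ C)
    (h2 : 2 ≤ C.card) (c : κ) : IsHierarchy C (insert (C, c) H) where
  subset := by
    simp only [Finset.forall_mem_insert]
    exact ⟨subset_rfl, h.subset⟩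
  two_le := by
    simp only [Finset.forall_mem_insert]
    exact ⟨h2, h.two_le⟩
  inj p hp q hq hpq := by
    rcases Finset.mem_insert.1 hp with rfl | hp <;> rcases Finset.mem_insert.1 hq with rfl | hq
    · rfl
    · exact absurd hpq.symm (hC q hq)
    · exact absurd hpq (hC p hp)
    · exact h.inj p hp q hq hpq
  laminar p hp q hq := by
    rcases Finset.mem_insert.1 hp with rfl | hp <;> rcases Finset.mem_insert.1 hq with rfl | hq
    · exact Or.inl subset_rfl
    · exact Or.inr (Or.inl (h.subset q hq))
    · exact Or.inl (h.subset p hp)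
    · exact h.laminar p hp q hq

theorem childLabels_insert_full (b : ι → κ) {p : Finset ι} (hp : p ⊆ C) :
    childLabels b (insert (C, c) H) p = childLabels b H p := by
  classical
  simp only [childLabels, isPar_insert_full hp]
  rw [Finset.filter_insert, if_neg]
  exact fun h1 => h1.1.2 hp

theorem childLabels_full (b : ι → κ) (h : IsHierarchy C H) (hC : ∀ p ∈ H, p.1 ≠ C)
    (h2 : 2 ≤ C.card) : childLabels b (insert (C, c) H) C = topLabels b H C := by
  classical
  unfold childLabels topLabels
  congr 1
  · rw [Finset.filter_insert, if_neg (fun h1 => h1.1.2 subset_rfl)]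
    refine Finset.sum_congr (Finset.filter_congr fun q hq => ?_) fun _ _ => rfl
    exact isPar_full h hC ((h.subset q hq).ssubset_of_ne (hC q hq))
  · refine Finset.sum_congr (Finset.filter_congr fun j hj => ?_) fun _ _ => rfl
    refine isPar_full h hC ((Finset.singleton_subset_iff.2 hj).ssubset_of_ne ?_)
    rintro rfl
    simp at h2

theorem topLabels_full (b : ι → κ) (h : IsHierarchy C H) (hC : ∀ p ∈ H, p.1 ≠ C)
    (h2 : 2 ≤ C.card) : topLabels b (insert (C, c) H) C = {c} := by
  classical
  unfold topLabels
  rw [Finset.filter_insert, if_pos, Finset.filter_false_of_mem, Finset.filter_false_of_mem]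
  · simp
  · intro j hj h1
    refine h1 _ (Finset.mem_insert_self _ _) ((Finset.singleton_subset_iff.2 hj).ssubset_of_ne ?_)
    rintro rfl
    simp at h2
  · exact fun q hq h1 => h1 _ (Finset.mem_insert_self _ _) ((h.subset q hq).ssubset_of_ne (hC q hq))
  · simp only [Finset.forall_mem_insert]
    exact ⟨fun h1 => h1.2 subset_rfl, fun e he h1 => h1.2 (h.subset e he)⟩

end Full

-- Deleting the full cluster with label `c` leaves a proper hierarchy. The deleted cluster accounts
-- for the factor `-M c` at the top labels of what remains, while `F` only sees the single label
-- `c`.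
open Classical in
theorem sum_full_hierarchies (M : κ → Multiset κ → ℂ) (b : ι → κ) (F : Multiset κ → ℂ)
    {C : Finset ι} (h2 : 2 ≤ C.card) :
    ∑ H ∈ hierarchies κ C with ∃ p ∈ H, p.1 = C, weight M b H * F (topLabels b H C) =
      ∑ c, -properForestSum M b (M c) C * F {c} := by
  simp only [properForestSum, neg_mul, Finset.sum_mul, ← Finset.sum_neg_distrib]
  rw [← Finset.sum_product']
  have key : ∀ x ∈ (Finset.univ : Finset κ) ×ˢ ((hierarchies κ C).filter fun H => ∀ p ∈ H, p.1 ≠ C),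
      IsHierarchy C x.2 ∧ ∀ p ∈ x.2, p.1 ≠ C := by
    rintro ⟨c, H⟩ hx
    obtain ⟨h1, h2⟩ := Finset.mem_filter.1 (Finset.mem_product.1 hx).2
    exact ⟨mem_hierarchies.1 h1, h2⟩
  have key2 : ∀ x ∈ (Finset.univ : Finset κ) ×ˢ ((hierarchies κ C).filter fun H => ∀ p ∈ H, p.1 ≠ C),
      (C, x.1) ∉ x.2 := fun x hx h => (key x hx).2 _ h rfl
  refine (Finset.sum_bij (fun x _ => insert (C, x.1) x.2) ?_ ?_ ?_ ?_).symm
  · intro x hx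
    obtain ⟨h, hC⟩ := key x hx
    exact Finset.mem_filter.2 ⟨mem_hierarchies.2 (h.insert_full hC h2 x.1),
      _, Finset.mem_insert_self _ _, rfl⟩
  · rintro ⟨c, H⟩ hx ⟨c', H'⟩ hx' heq
    have h1 : (C, c) ∈ insert (C, c') H' := by
      have : insert (C, c) H = insert (C, c') H' := heq
      exact this ▸ Finset.mem_insert_self _ _
    have hc : c = c' := by
      rcases Finset.mem_insert.1 h1 with h1 | h1
      · exact congrArg Prod.snd h1
      · exact absurd rfl ((key _ hx').2 _ h1)
    subst hc
    have h3 : H = H' := by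
      have e1 : (insert (C, c) H).erase (C, c) = H := Finset.erase_insert (key2 _ hx)
      have e2 : (insert (C, c) H').erase (C, c) = H' := Finset.erase_insert (key2 _ hx')
      rw [← e1, ← e2]
      exact congrArg (fun K => Finset.erase K (C, c)) heq
    rw [h3]
  · intro H hH
    obtain ⟨hH, ⟨D, c⟩, hp, hD⟩ := Finset.mem_filter.1 hH
    obtain rfl : D = C := hD
    have h := mem_hierarchies.1 hH
    refine ⟨(c, H.erase (D, c)), ?_, Finset.insert_erase hp⟩
    refine Finset.mem_product.2 ⟨Finset.mem_univ _, Finset.mem_filter.2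
      ⟨mem_hierarchies.2 (h.mono (Finset.erase_subset _ _)), fun p hp' hpD => ?_⟩⟩
    exact Finset.ne_of_mem_erase hp' (h.inj p (Finset.mem_of_mem_erase hp') _ hp hpD)
  · rintro ⟨c, H⟩ hx
    obtain ⟨h, hC⟩ := key _ hx
    simp only [topLabels_full b h hC h2, weight]
    rw [Finset.prod_insert (key2 _ hx)]
    simp only [childLabels_full b h hC h2]
    have hp : ∏ p ∈ H, -M p.2 (childLabels b (insert (C, c) H) p.1) =
        ∏ p ∈ H, -M p.2 (childLabels b H p.1) :=
      Finset.prod_congr rfl fun p hp => by rw [childLabels_insert_full b (h.subset p hp)]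
    rw [hp]
    ring

theorem forestSum_eq_proper_add (M : κ → Multiset κ → ℂ) (b : ι → κ) (F : Multiset κ → ℂ)
    {C : Finset ι} (h2 : 2 ≤ C.card) :
    forestSum M b F C = properForestSum M b F C + ∑ c, -properForestSum M b (M c) C * F {c} := by
  classical
  rw [← sum_full_hierarchies M b F h2, properForestSum, forestSum,
    ← Finset.sum_filter_add_sum_filter_not (hierarchies κ C) fun H => ∀ p ∈ H, p.1 ≠ C]
  congr 1
  refine Finset.sum_congr (Finset.filter_congr fun H _ => ?_) fun _ _ => rfl
  push Not
  rfl

theorem hierarchies_eq_of_card_le_one {C : Finset ι} (h : C.card ≤ 1) :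
    hierarchies κ C = {∅} := by
  ext H
  rw [mem_hierarchies, Finset.mem_singleton]
  constructor
  · intro hH
    refine Finset.eq_empty_of_forall_notMem fun p hp => ?_
    have := hH.two_le p hp
    have := Finset.card_le_card (hH.subset p hp)
    omega
  · rintro rfl
    exact ⟨by simp, by simp, by simp, by simp⟩

theorem topLabels_empty (b : ι → κ) (A : Finset ι) : topLabels b ∅ A = ∑ j ∈ A, {b j} := by
  simp [topLabels]

theorem forestSum_empty (M : κ → Multiset κ → ℂ) (b : ι → κ) (F : Multiset κ → ℂ) :
    forestSum M b F ∅ = F 0 := by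
  rw [forestSum, hierarchies_eq_of_card_le_one (by simp)]
  simp [weight, topLabels_empty]

end ForestRecursion

/-! ### Sums over hierarchies as sums over set partitions -/

section ForestBlock

variable {ι κ : Type} [LinearOrder ι] [Fintype κ] [DecidableEq κ]

/-- The block weights produced by the sum over hierarchies. -/
def forestBlock (M : κ → Multiset κ → ℂ) (b : ι → κ) (C : Finset ι) (c : κ) : ℂ :=
  if C.card = 1 then if {c} = topLabels b ∅ C then 1 else 0 else -properForestSum M b (M c) C

/-- The maximal clusters, together with the uncovered points, form a set partition. In the induction
the top set of the largest element of `A` is the block that `blockSum` splits off, and summing over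
the hierarchies inside it produces `forestBlock`. -/
theorem forestSum_eq_blockSum_forestBlock (M : κ → Multiset κ → ℂ) (b : ι → κ)
    (F : Multiset κ → ℂ) (A : Finset ι) :
    forestSum M b F A = blockSum (forestBlock M b) F A := by
  classical
  induction hn : A.card using Nat.strong_induction_on generalizing A F with
  | _ N ih =>
    rcases A.eq_empty_or_nonempty with rfl | hne
    · rw [forestSum_empty, blockSum_empty]
    obtain ⟨a, B, hB, rfl, haB⟩ := exists_insert_lt hne
    rw [forestSum_split M b F (Finset.mem_insert_self a B), blockSum_insert _ _ hB]
    -- Subsets containing `a` are indexed by their remaining part `D`, as in `blockSum_insert`.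
    have hset : ((insert a B).powerset.filter fun C => a ∈ C) = B.powerset.image (insert a) := by
      ext C
      simp only [Finset.mem_filter, Finset.mem_powerset, Finset.mem_image]
      constructor
      · rintro ⟨h1, h2⟩
        exact ⟨C.erase a, Finset.subset_insert_iff.1 h1, Finset.insert_erase h2⟩
      · rintro ⟨D, hD, rfl⟩
        exact ⟨Finset.insert_subset_insert a hD, Finset.mem_insert_self _ _⟩
    rw [hset, Finset.sum_image]
    swap
    · intro D hD D' hD' heq
      rw [← Finset.erase_insert (fun h => haB (Finset.mem_powerset.1 hD h)),
        ← Finset.erase_insert (fun h => haB (Finset.mem_powerset.1 hD' h)), heq]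
    refine Finset.sum_congr rfl fun D hD => ?_
    have haD : a ∉ D := fun h => haB (Finset.mem_powerset.1 hD h)
    have hsd : insert a B \ insert a D = B \ D := by
      ext x
      simp only [Finset.mem_sdiff, Finset.mem_insert, not_or]
      constructor
      · rintro ⟨rfl | h1, h2, h3⟩
        · exact absurd rfl h2
        · exact ⟨h1, h3⟩
      · rintro ⟨h1, h2⟩
        exact ⟨Or.inr h1, fun h => haB (h ▸ h1), h2⟩
    rw [hsd]
    have hlt : (B \ D).card < N := by
      rw [← hn, Finset.card_insert_of_notMem haB]
      exact Nat.lt_succ_of_le (Finset.card_le_card Finset.sdiff_subset)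
    simp only [ih _ hlt _ _ rfl]
    -- A block with one point carries no cluster and has the label of its leaf; a larger block must
    -- itself be a cluster.
    by_cases h1 : (insert a D).card = 1
    · have hD0 : D = ∅ := by
        rw [Finset.card_insert_of_notMem haD] at h1
        exact Finset.card_eq_zero.1 (by omega)
      subst hD0
      rw [hierarchies_eq_of_card_le_one h1.le]
      simp [forestBlock, weight, topLabels_empty, Finset.filter_singleton]
    · have h2 : 2 ≤ (insert a D).card := by
        have := Finset.card_pos.2 (Finset.insert_nonempty a D)
        omega
      simp only [h1, false_or, forestBlock, if_false]
      rw [sum_full_hierarchies M b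
        (fun α => blockSum (forestBlock M b) (fun β => F (α + β)) (B \ D)) h2]
      simp only [Multiset.singleton_add]

/-- Both full sums agree, and so do their one-block terms by the definition of `forestBlock`;
cancelling them leaves the proper parts. Consequently `forestBlock` satisfies the recursion that it
is meant to solve. -/
theorem properForestSum_eq_properBlockSum_forestBlock (M : κ → Multiset κ → ℂ) (b : ι → κ)
    (F : Multiset κ → ℂ) {A : Finset ι} (h2 : 2 ≤ A.card) :
    properForestSum M b F A = properBlockSum (forestBlock M b) F A := by
  have hne : A.Nonempty := Finset.card_pos.1 (by omega)
  have h1 : A.card ≠ 1 := by omega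
  have h := forestSum_eq_blockSum_forestBlock M b F A
  rw [forestSum_eq_proper_add M b F h2, blockSum_eq_proper_add _ F hne] at h
  simp only [forestBlock, h1, if_false] at h
  exact add_right_cancel h

variable {M : κ → Multiset κ → ℂ} {b : ι → κ} {S : Finset ι → κ → ℂ} {A : Finset ι}

/-- Uniqueness of the solution of the recursion: `forestBlock` solves it too, and its right-hand
side involves strict subsets only. -/
theorem eq_forestBlock (h1 : ∀ j ∈ A, ∀ c, S {j} c = if c = b j then 1 else 0)
    (h2 : ∀ C ⊆ A, 2 ≤ C.card → ∀ c, S C c = -properBlockSum S (M c) C) {C : Finset ι}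
    (hCA : C ⊆ A) (hC : C.Nonempty) : S C = forestBlock M b C := by
  induction hn : C.card using Nat.strong_induction_on generalizing C with
  | _ N ih =>
    funext c
    by_cases hone : C.card = 1
    · obtain ⟨j, rfl⟩ := Finset.card_eq_one.1 hone
      rw [h1 j (Finset.singleton_subset_iff.1 hCA)]
      simp [forestBlock, topLabels_empty]
    · have htwo : 2 ≤ C.card := by
        have := Finset.card_pos.2 hC
        omega
      rw [h2 C hCA htwo c, forestBlock, if_neg hone,
        properForestSum_eq_properBlockSum_forestBlock M b _ htwo]
      congr 1
      exact properBlockSum_congr _ fun D hD hDne =>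
        ih _ (hn ▸ Finset.card_lt_card hD) (hD.1.trans hCA) hDne rfl

/-- The sum over hierarchies is a sum over set partitions, if the block weights solve the recursion
`S_C^c = -∑_{|π| ≥ 2} M^c(S_π)`. -/
theorem forestSum_eq_blockSum (h1 : ∀ j ∈ A, ∀ c, S {j} c = if c = b j then 1 else 0)
    (h2 : ∀ C ⊆ A, 2 ≤ C.card → ∀ c, S C c = -properBlockSum S (M c) C) (F : Multiset κ → ℂ) :
    forestSum M b F A = blockSum S F A := by
  rw [forestSum_eq_blockSum_forestBlock]
  exact blockSum_congr F fun C hC hne => (eq_forestBlock h1 h2 hC hne).symm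

theorem properForestSum_eq_properBlockSum (hA : 2 ≤ A.card)
    (h1 : ∀ j ∈ A, ∀ c, S {j} c = if c = b j then 1 else 0)
    (h2 : ∀ C ⊆ A, 2 ≤ C.card → ∀ c, S C c = -properBlockSum S (M c) C) (F : Multiset κ → ℂ) :
    properForestSum M b F A = properBlockSum S F A := by
  rw [properForestSum_eq_properBlockSum_forestBlock M b F hA]
  exact properBlockSum_congr F fun C hC hne => (eq_forestBlock h1 h2 hC.1 hne).symm

end ForestBlock

end KahlerTree

end

/-! ### Rooted forests and their clusters -/

noncomputable section

namespace KahlerTree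

set_option linter.unusedSectionVars false

open Relation

/-- A rooted forest with vertices `V` and leaves labelled by `ι`: each vertex and each leaf has a
parent vertex or is attached to the root, and each vertex has at least two children. -/
structure Forest (ι V : Type) [Fintype ι] [Fintype V] [DecidableEq V] where
  /-- the parent of a vertex, `none` being the root -/
  par : V → Option V
  /-- the parent of a leaf -/
  leaf : ι → Option V
  acyclic : ∀ v, ¬ TransGen (fun v w => par v = some w) v v
  two_le : ∀ v, 2 ≤ (Finset.univ.filter fun w => par w = some v).card +
    (Finset.univ.filter fun j => leaf j = some v).card

namespace Forest

variable {ι V : Type} [Fintype ι] [DecidableEq ι] [Fintype V] [DecidableEq V] (f : Forest ι V)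

/-- `v` lies below `w`. -/
def Le (v w : V) : Prop := ReflTransGen (fun v w => f.par v = some w) v w

variable {f}

theorem Le.antisymm {v w : V} (h : f.Le v w) (h' : f.Le w v) : v = w := by
  rcases reflTransGen_iff_eq_or_transGen.1 h with rfl | h
  · rfl
  · exact absurd (h.trans_left h') (f.acyclic v)

theorem Le.total {u v w : V} (h : f.Le u v) (h' : f.Le u w) : f.Le v w ∨ f.Le w v :=
  ReflTransGen.total_of_right_unique
    (fun _ _ _ h1 h2 => Option.some_injective _ (h1.symm.trans h2)) h h'

theorem not_le_of_par {v w : V} (h : f.par v = some w) : ¬ f.Le w v := fun h' =>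
  f.acyclic v (TransGen.head' h h')

theorem Le.par_le {v w u : V} (h : f.Le v w) (hne : v ≠ w) (hp : f.par v = some u) :
    f.Le u w := by
  rcases ReflTransGen.cases_head h with rfl | ⟨u', hu', h'⟩
  · exact absurd rfl hne
  · obtain rfl : u = u' := Option.some_injective _ (hp.symm.trans hu')
    exact h'

/-- Induction from the leaves towards the root. -/
theorem wellFounded_child : WellFounded (TransGen fun v w => f.par v = some w) := by
  have : IsTrans V (TransGen fun v w => f.par v = some w) := ⟨fun _ _ _ => TransGen.trans⟩
  have : Std.Irrefl (TransGen fun v w => f.par v = some w) := ⟨f.acyclic⟩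
  exact Finite.wellFounded_of_trans_of_irrefl _

/-- Induction from the root towards the leaves. -/
theorem wellFounded_parent : WellFounded (fun w v => f.par v = some w) := by
  have : IsTrans V (Function.swap (TransGen fun v w => f.par v = some w)) :=
    ⟨fun _ _ _ h h' => TransGen.trans h' h⟩
  have : Std.Irrefl (Function.swap (TransGen fun v w => f.par v = some w)) := ⟨f.acyclic⟩
  have h := Finite.wellFounded_of_trans_of_irrefl
    (Function.swap (TransGen fun v w => f.par v = some w))
  exact Subrelation.wf (r := Function.swap (TransGen fun v w => f.par v = some w))
    (fun {_ _} h => TransGen.single h) h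

variable (f)

open Classical in
/-- The set of leaves below a vertex. -/
def cluster (v : V) : Finset ι :=
  Finset.univ.filter fun j => ∃ u, f.leaf j = some u ∧ f.Le u v

variable {f}

theorem mem_cluster {v : V} {j : ι} : j ∈ f.cluster v ↔ ∃ u, f.leaf j = some u ∧ f.Le u v := by
  simp [cluster]

theorem mem_cluster_of_leaf {v : V} {j : ι} (h : f.leaf j = some v) : j ∈ f.cluster v :=
  mem_cluster.2 ⟨v, h, ReflTransGen.refl⟩

theorem Le.cluster_subset {v w : V} (h : f.Le v w) : f.cluster v ⊆ f.cluster w := fun j hj => by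
  obtain ⟨u, hu, huv⟩ := mem_cluster.1 hj
  exact mem_cluster.2 ⟨u, hu, huv.trans h⟩

theorem le_or_le {v w : V} {j : ι} (hv : j ∈ f.cluster v) (hw : j ∈ f.cluster w) :
    f.Le v w ∨ f.Le w v := by
  obtain ⟨u, hu, huv⟩ := mem_cluster.1 hv
  obtain ⟨u', hu', huw⟩ := mem_cluster.1 hw
  obtain rfl : u = u' := Option.some_injective _ (hu.symm.trans hu')
  exact huv.total huw

theorem cluster_nonempty (v : V) : (f.cluster v).Nonempty := by
  induction v using f.wellFounded_child.induction with
  | _ v ih =>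
    rcases (Finset.univ.filter fun w => f.par w = some v).eq_empty_or_nonempty with he | ⟨w, hw⟩
    · have h2 := f.two_le v
      rw [he, Finset.card_empty, zero_add] at h2
      obtain ⟨j, hj⟩ := Finset.card_pos.1 (lt_of_lt_of_le two_pos h2)
      exact ⟨j, mem_cluster_of_leaf (Finset.mem_filter.1 hj).2⟩
    · have hw := (Finset.mem_filter.1 hw).2
      exact (ih w (TransGen.single hw)).mono (Le.cluster_subset (ReflTransGen.single hw))

/-- Strictness is where `two_le` enters: `w` has a child besides `v`, and the leaves below that
child, or the child itself if it is a leaf, are not below `v`. -/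
theorem cluster_ssubset_of_par {v w : V} (h : f.par v = some w) : f.cluster v ⊂ f.cluster w := by
  have hsub : f.cluster v ⊆ f.cluster w := Le.cluster_subset (ReflTransGen.single h)
  rw [Finset.ssubset_iff_of_subset hsub]
  have h2 := f.two_le w
  rcases (Finset.univ.filter fun j => f.leaf j = some w).eq_empty_or_nonempty with he | ⟨j, hj⟩
  · rw [he, Finset.card_empty, add_zero] at h2
    obtain ⟨u, hu, huv⟩ := Finset.exists_mem_ne h2 v
    have hu := (Finset.mem_filter.1 hu).2
    obtain ⟨j, hj⟩ := f.cluster_nonempty u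
    refine ⟨j, Le.cluster_subset (ReflTransGen.single hu) hj, fun hjv => ?_⟩
    rcases le_or_le hj hjv with h1 | h1
    · exact not_le_of_par h (h1.par_le huv hu)
    · exact not_le_of_par hu (h1.par_le huv.symm h)
  · have hj := (Finset.mem_filter.1 hj).2
    refine ⟨j, mem_cluster_of_leaf hj, fun hjv => ?_⟩
    obtain ⟨u, hu, huv⟩ := mem_cluster.1 hjv
    obtain rfl : w = u := Option.some_injective _ (hj.symm.trans hu)
    exact not_le_of_par h huv

theorem two_le_card_cluster (v : V) : 2 ≤ (f.cluster v).card := by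
  rcases (Finset.univ.filter fun w => f.par w = some v).eq_empty_or_nonempty with he | ⟨w, hw⟩
  · have h2 := f.two_le v
    rw [he, Finset.card_empty, zero_add] at h2
    exact h2.trans (Finset.card_le_card fun j hj =>
      mem_cluster_of_leaf (Finset.mem_filter.1 hj).2)
  · have h1 := Finset.card_lt_card (cluster_ssubset_of_par (Finset.mem_filter.1 hw).2)
    have h2 := Finset.card_pos.2 (f.cluster_nonempty w)
    omega

theorem Le.cluster_ssubset {v w : V} (h : f.Le v w) (hne : v ≠ w) :
    f.cluster v ⊂ f.cluster w := by
  rcases ReflTransGen.cases_head h with rfl | ⟨u, hu, h'⟩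
  · exact absurd rfl hne
  · exact (cluster_ssubset_of_par hu).trans_subset (Le.cluster_subset h')

/-- The order of the forest is inclusion of clusters, so the clusters remember the whole forest. -/
theorem le_iff_cluster_subset {v w : V} : f.Le v w ↔ f.cluster v ⊆ f.cluster w := by
  refine ⟨Le.cluster_subset, fun h => ?_⟩
  obtain ⟨j, hj⟩ := f.cluster_nonempty v
  rcases le_or_le hj (h hj) with h1 | h1
  · exact h1
  · by_cases hne : w = v
    · exact hne ▸ ReflTransGen.refl
    · exact absurd h (h1.cluster_ssubset hne).2

theorem cluster_injective : Function.Injective f.cluster := fun _ _ h =>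
  (le_iff_cluster_subset.2 h.subset).antisymm (le_iff_cluster_subset.2 h.symm.subset)

theorem par_eq_some_iff {v w : V} : f.par v = some w ↔
    f.cluster v ⊂ f.cluster w ∧ ∀ u, f.cluster v ⊂ f.cluster u → f.cluster w ⊆ f.cluster u := by
  have key : ∀ {u}, f.cluster v ⊂ f.cluster u → f.Le v u ∧ v ≠ u := fun h =>
    ⟨le_iff_cluster_subset.2 h.1, fun h' => h.2 (h' ▸ subset_rfl)⟩
  constructor
  · intro h
    exact ⟨cluster_ssubset_of_par h, fun u hu =>
      ((key hu).1.par_le (key hu).2 h).cluster_subset⟩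
  · rintro ⟨h1, h2⟩
    rcases ReflTransGen.cases_head (key h1).1 with rfl | ⟨u, hu, h'⟩
    · exact absurd rfl (key h1).2
    · have h3 := le_iff_cluster_subset.2 (h2 u (cluster_ssubset_of_par hu))
      rw [hu, h3.antisymm h']

theorem singleton_ssubset_cluster {j : ι} {v : V} : {j} ⊂ f.cluster v ↔ j ∈ f.cluster v := by
  refine ⟨fun h => Finset.singleton_subset_iff.1 h.1, fun h =>
    (Finset.singleton_subset_iff.2 h).ssubset_of_ne fun h' => ?_⟩
  have := f.two_le_card_cluster v
  rw [← h', Finset.card_singleton] at this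
  omega

theorem leaf_eq_some_iff {j : ι} {w : V} : f.leaf j = some w ↔
    {j} ⊂ f.cluster w ∧ ∀ u, {j} ⊂ f.cluster u → f.cluster w ⊆ f.cluster u := by
  simp only [singleton_ssubset_cluster]
  constructor
  · intro h
    refine ⟨mem_cluster_of_leaf h, fun u hu => ?_⟩
    obtain ⟨u', hu', h'⟩ := mem_cluster.1 hu
    obtain rfl : w = u' := Option.some_injective _ (h.symm.trans hu')
    exact h'.cluster_subset
  · rintro ⟨h1, h2⟩
    obtain ⟨u, hu, h'⟩ := mem_cluster.1 h1
    have h3 := le_iff_cluster_subset.2 (h2 u (mem_cluster_of_leaf hu))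
    rw [hu, h3.antisymm h']

/-- The set of all clusters. -/
def clusters (f : Forest ι V) : Finset (Finset ι) := Finset.univ.image f.cluster

theorem mem_clusters {s : Finset ι} : s ∈ f.clusters ↔ ∃ v, f.cluster v = s := by
  simp [clusters]

/-- The number of children of the root. -/
def rootDeg (f : Forest ι V) : ℕ :=
  (Finset.univ.filter fun w => f.par w = none).card +
    (Finset.univ.filter fun j => f.leaf j = none).card

/-- Below the root there is something outside each given vertex. -/
theorem cluster_ne_univ (h : 2 ≤ f.rootDeg) (v : V) : f.cluster v ≠ Finset.univ := by
  induction v using f.wellFounded_parent.induction with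
  | _ v ih =>
    cases hp : f.par v with
    | some w =>
      intro he
      have := cluster_ssubset_of_par hp
      rw [he] at this
      exact this.2 (Finset.subset_univ _)
    | none =>
      have hmax : ∀ u, f.Le v u → v = u := fun u hu => by
        rcases ReflTransGen.cases_head hu with rfl | ⟨u', hu', -⟩
        · rfl
        · rw [hp] at hu'
          cases hu'
      intro he
      unfold rootDeg at h
      -- A leaf attached to the root lies in no cluster. If there is none, the root has a second
      -- child `u`, which would lie below `v` if the cluster of `v` were everything.
      rcases (Finset.univ.filter fun j => f.leaf j = none).eq_empty_or_nonempty with hl | ⟨j, hj⟩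
      · rw [hl, Finset.card_empty, add_zero] at h
        obtain ⟨u, hu, huv⟩ := Finset.exists_mem_ne h v
        have hu := (Finset.mem_filter.1 hu).2
        have hle : f.Le u v := le_iff_cluster_subset.2 (he ▸ Finset.subset_univ _)
        rcases ReflTransGen.cases_head hle with h1 | ⟨u', hu', -⟩
        · exact huv h1
        · rw [hu] at hu'
          cases hu'
      · have hj := (Finset.mem_filter.1 hj).2
        obtain ⟨u, hu, -⟩ := mem_cluster.1 (he ▸ Finset.mem_univ j : j ∈ f.cluster v)
        rw [hj] at hu
        cases hu

end Forest

/-! ### Laminar families -/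

section Laminar

variable {ι : Type} [Fintype ι] [DecidableEq ι]

/-- A family of sets with at least two elements each, any two of which are nested or disjoint. -/
structure IsLaminar (L : Finset (Finset ι)) : Prop where
  two_le : ∀ c ∈ L, 2 ≤ c.card
  laminar : ∀ c ∈ L, ∀ d ∈ L, c ⊆ d ∨ d ⊆ c ∨ Disjoint c d

theorem Forest.isLaminar_clusters {V : Type} [Fintype V] [DecidableEq V] (f : Forest ι V) :
    IsLaminar f.clusters where
  two_le c hc := by
    obtain ⟨v, rfl⟩ := Forest.mem_clusters.1 hc
    exact f.two_le_card_cluster v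
  laminar c hc d hd := by
    obtain ⟨v, rfl⟩ := Forest.mem_clusters.1 hc
    obtain ⟨w, rfl⟩ := Forest.mem_clusters.1 hd
    by_cases h : Disjoint (f.cluster v) (f.cluster w)
    · exact Or.inr (Or.inr h)
    · obtain ⟨j, hv, hw⟩ := Finset.not_disjoint_iff.1 h
      rcases Forest.le_or_le hv hw with h1 | h1
      · exact Or.inl h1.cluster_subset
      · exact Or.inr (Or.inl h1.cluster_subset)

variable {L : Finset (Finset ι)}

/-- `d` is the smallest member of `L` that strictly contains `s`. -/
def IsUp (L : Finset (Finset ι)) (s : Finset ι) (d : L) : Prop :=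
  s ⊂ d.1 ∧ ∀ e ∈ L, s ⊂ e → d.1 ⊆ e

theorem IsUp.unique {s : Finset ι} {d d' : L} (h : IsUp L s d) (h' : IsUp L s d') : d = d' :=
  Subtype.ext (Finset.Subset.antisymm (h.2 _ d'.2 h'.1) (h'.2 _ d.2 h.1))

open Classical in
/-- The smallest member of `L` that strictly contains `s`, if there is one. -/
def up (L : Finset (Finset ι)) (s : Finset ι) : Option L :=
  if h : ∃ d, IsUp L s d then some h.choose else none

theorem up_eq_some {s : Finset ι} {d : L} : up L s = some d ↔ IsUp L s d := by
  unfold up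
  split_ifs with h
  · rw [Option.some_inj]
    exact ⟨fun h' => h' ▸ h.choose_spec, fun h' => h.choose_spec.unique h'⟩
  · exact ⟨fun h' => (by cases h'), fun h' => absurd ⟨d, h'⟩ h⟩

theorem IsLaminar.exists_isUp (hL : IsLaminar L) {s c : Finset ι} (hs : s.Nonempty) (hc : c ∈ L)
    (hsc : s ⊂ c) : ∃ d, IsUp L s d := by
  obtain ⟨d, hd, hmin⟩ := Finset.exists_min_image (L.filter fun e => s ⊂ e) Finset.card
    ⟨c, Finset.mem_filter.2 ⟨hc, hsc⟩⟩
  obtain ⟨hdL, hsd⟩ := Finset.mem_filter.1 hd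
  refine ⟨⟨d, hdL⟩, hsd, fun e he hse => ?_⟩
  rcases hL.laminar d hdL e he with h | h | h
  · exact h
  · exact (Finset.eq_of_subset_of_card_le h (hmin e (Finset.mem_filter.2 ⟨he, hse⟩))).symm.subset
  · obtain ⟨x, hx⟩ := hs
    exact absurd (hse.1 hx) (Finset.disjoint_left.1 h (hsd.1 hx))

theorem IsLaminar.up_eq_none (hL : IsLaminar L) {s : Finset ι} (hs : s.Nonempty) :
    up L s = none ↔ ∀ c ∈ L, ¬ s ⊂ c := by
  rw [Option.eq_none_iff_forall_ne_some]
  constructor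
  · intro h c hc hsc
    obtain ⟨d, hd⟩ := hL.exists_isUp hs hc hsc
    exact h d (up_eq_some.2 hd)
  · intro h d hd
    exact h d.1 d.2 (up_eq_some.1 hd).1

theorem IsLaminar.nonempty (hL : IsLaminar L) {c : Finset ι} (hc : c ∈ L) : c.Nonempty :=
  Finset.card_pos.1 (lt_of_lt_of_le two_pos (hL.two_le c hc))

theorem IsLaminar.singleton_ssubset (hL : IsLaminar L) {c : Finset ι} (hc : c ∈ L) {j : ι} :
    {j} ⊂ c ↔ j ∈ c := by
  refine ⟨fun h => Finset.singleton_subset_iff.1 h.1, fun h =>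
    (Finset.singleton_subset_iff.2 h).ssubset_of_ne fun h' => ?_⟩
  have := hL.two_le c hc
  rw [← h', Finset.card_singleton] at this
  omega

/-- Here `X` and `Y` are the vertex and leaf children of `s`. If some `w` in `X` exists, it misses a
point of `s`, and that point provides a second child; if `X` is empty, all points of `s` are leaf
children. -/
theorem two_le_card_add_card {s : Finset ι} (hs : 2 ≤ s.card) {X : Finset L} {Y : Finset ι}
    (hX : ∀ w ∈ X, w.1 ⊂ s) (hY : ∀ j ∈ s, j ∉ Y → ∃ w ∈ X, j ∈ w.1) :
    2 ≤ X.card + Y.card := by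
  rcases X.eq_empty_or_nonempty with rfl | ⟨w, hw⟩
  · rw [Finset.card_empty, zero_add]
    refine hs.trans (Finset.card_le_card fun j hj => ?_)
    by_contra hjY
    obtain ⟨w, hw, -⟩ := hY j hj hjY
    exact Finset.notMem_empty w hw
  · obtain ⟨j, hj, hjw⟩ := (Finset.ssubset_iff_of_subset (hX w hw).1).1 (hX w hw)
    by_cases hjY : j ∈ Y
    · have h1 := Finset.card_pos.2 ⟨w, hw⟩
      have h2 := Finset.card_pos.2 ⟨j, hjY⟩
      omega
    · obtain ⟨w', hw', hj'⟩ := hY j hj hjY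
      have : 1 < X.card := Finset.one_lt_card.2 ⟨w, hw, w', hw', fun h => hjw (h ▸ hj')⟩
      omega

/-- A member of `L` that is maximal among those which contain `j` and lie strictly below `s`. -/
theorem exists_isMax {s : Finset ι} {j : ι}
    (h : ∃ e ∈ L, j ∈ e ∧ e ⊂ s) :
    ∃ e ∈ L, j ∈ e ∧ e ⊂ s ∧ ∀ d ∈ L, e ⊂ d → d ⊂ s → False := by
  obtain ⟨e, he, hmax⟩ := Finset.exists_max_image (L.filter fun e => j ∈ e ∧ e ⊂ s) Finset.card
    (by obtain ⟨e, he, h⟩ := h; exact ⟨e, Finset.mem_filter.2 ⟨he, h⟩⟩)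
  obtain ⟨heL, hje, hes⟩ := Finset.mem_filter.1 he
  refine ⟨e, heL, hje, hes, fun d hd hed hds => ?_⟩
  exact absurd (hmax d (Finset.mem_filter.2 ⟨hd, hed.1 hje, hds⟩))
    (not_le.2 (Finset.card_lt_card hed))

/-- The forest of a laminar family: its vertices are the members of the family. -/
def IsLaminar.forest (hL : IsLaminar L) : Forest ι L where
  par c := up L c.1
  leaf j := up L {j}
  acyclic c h := by
    have key : ∀ c d : L, TransGen (fun c d : L => up L c.1 = some d) c d → c.1 ⊂ d.1 := by
      intro c d h
      induction h with
      | single h => exact (up_eq_some.1 h).1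
      | tail _ h ih => exact ih.trans (up_eq_some.1 h).1
    exact (key c c h).2 subset_rfl
  two_le c := by
    refine two_le_card_add_card (hL.two_le c.1 c.2) (fun w hw => ?_) fun j hj hjY => ?_
    · exact (up_eq_some.1 (Finset.mem_filter.1 hw).2).1
    -- A point of `c` that is not attached directly to `c` lies in a member strictly below `c`, and
    -- a maximal such member is a child of `c`.
    · have h1 : ∃ e ∈ L, j ∈ e ∧ e ⊂ c.1 := by
        by_contra hno
        refine hjY (Finset.mem_filter.2 ⟨Finset.mem_univ _, up_eq_some.2
          ⟨(hL.singleton_ssubset c.2).2 hj, fun e he hje => ?_⟩⟩)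
        have hje := (hL.singleton_ssubset he).1 hje
        rcases hL.laminar c.1 c.2 e he with h | h | h
        · exact h
        · rcases eq_or_ne e c.1 with rfl | hne
          · exact subset_rfl
          · exact absurd ⟨e, he, hje, h.ssubset_of_ne hne⟩ hno
        · exact absurd hje (Finset.disjoint_left.1 h hj)
      obtain ⟨e, he, hje, hec, hmax⟩ := exists_isMax h1
      refine ⟨⟨e, he⟩, Finset.mem_filter.2 ⟨Finset.mem_univ _, up_eq_some.2
        ⟨hec, fun d hd hed => ?_⟩⟩, hje⟩
      rcases hL.laminar c.1 c.2 d hd with h | h | h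
      · exact h
      · rcases eq_or_ne d c.1 with rfl | hne
        · exact subset_rfl
        · exact (hmax d hd hed (h.ssubset_of_ne hne)).elim
      · exact absurd (hed.1 hje) (Finset.disjoint_left.1 h hj)

/-- Climb from `c` through smallest strictly larger members; none of them overshoots `d`. -/
theorem IsLaminar.forest_le (hL : IsLaminar L) {c d : L} (h : c.1 ⊆ d.1) : hL.forest.Le c d := by
  induction hn : d.1.card - c.1.card using Nat.strong_induction_on generalizing c with
  | _ N ih =>
    rcases eq_or_ne c d with rfl | hne
    · exact ReflTransGen.refl
    · have hcd : c.1 ⊂ d.1 := h.ssubset_of_ne fun h' => hne (Subtype.ext h')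
      obtain ⟨e, he⟩ := hL.exists_isUp (hL.nonempty c.2) d.2 hcd
      have hed := he.2 d.1 d.2 hcd
      refine ReflTransGen.head (b := e) (up_eq_some.2 he) (ih _ ?_ hed rfl)
      have h1 := Finset.card_lt_card he.1
      have h2 := Finset.card_le_card hed
      omega

theorem IsLaminar.forest_cluster (hL : IsLaminar L) (c : L) : hL.forest.cluster c = c.1 := by
  ext j
  rw [Forest.mem_cluster]
  constructor
  · rintro ⟨u, hu, hle⟩
    have hju : j ∈ u.1 := Finset.singleton_subset_iff.1 (up_eq_some.1 hu).1.1
    have : ∀ c d : L, hL.forest.Le c d → c.1 ⊆ d.1 := by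
      intro c d h
      induction h with
      | refl => exact subset_rfl
      | tail _ h ih => exact ih.trans (up_eq_some.1 h).1.1
    exact this _ _ hle hju
  · intro hj
    have hjc := (hL.singleton_ssubset c.2).2 hj
    obtain ⟨d, hd⟩ := hL.exists_isUp (Finset.singleton_nonempty j) c.2 hjc
    exact ⟨d, up_eq_some.2 hd, hL.forest_le (hd.2 c.1 c.2 hjc)⟩

/-- Together with `Forest.exists_equiv`, laminar families classify forests up to isomorphism. -/
theorem IsLaminar.forest_clusters (hL : IsLaminar L) : hL.forest.clusters = L := by
  ext c
  rw [Forest.mem_clusters]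
  constructor
  · rintro ⟨v, rfl⟩
    rw [hL.forest_cluster]
    exact v.2
  · intro hc
    exact ⟨⟨c, hc⟩, hL.forest_cluster _⟩

/-- The root behaves like a cluster `Finset.univ` placed on top of the family, provided that it does
not occur there already. -/
theorem IsLaminar.two_le_rootDeg (hL : IsLaminar L) (hu : Finset.univ ∉ L)
    (h2 : 2 ≤ Fintype.card ι) : 2 ≤ hL.forest.rootDeg := by
  have hlt : ∀ e ∈ L, e ⊂ Finset.univ := fun e he =>
    (Finset.subset_univ e).ssubset_of_ne fun h => hu (h ▸ he)
  refine two_le_card_add_card (s := Finset.univ) (by rwa [Finset.card_univ])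
    (fun w _ => hlt w.1 w.2) fun j _ hjY => ?_
  have h1 : ∃ e ∈ L, j ∈ e ∧ e ⊂ Finset.univ := by
    by_contra hno
    refine hjY (Finset.mem_filter.2 ⟨Finset.mem_univ _,
      (hL.up_eq_none (Finset.singleton_nonempty j)).2 fun e he hje => ?_⟩)
    exact hno ⟨e, he, (hL.singleton_ssubset he).1 hje, hlt e he⟩
  obtain ⟨e, he, hje, hec, hmax⟩ := exists_isMax h1
  exact ⟨⟨e, he⟩, Finset.mem_filter.2 ⟨Finset.mem_univ _,
    (hL.up_eq_none (hL.nonempty he)).2 fun d hd hed => hmax d hd hed (hlt d hd)⟩, hje⟩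

end Laminar

/-! ### A forest is determined by its clusters -/

namespace Forest

variable {ι V V' : Type} [Fintype ι] [DecidableEq ι] [Fintype V] [DecidableEq V]
  [Fintype V'] [DecidableEq V']

/-- Forests with the same clusters are isomorphic. -/
theorem exists_equiv (f : Forest ι V) (f' : Forest ι V') (h : f.clusters = f'.clusters) :
    ∃ e : V ≃ V', (∀ v, f'.par (e v) = (f.par v).map e) ∧ ∀ j, f'.leaf j = (f.leaf j).map e := by
  have h1 : ∀ v, ∃ v', f'.cluster v' = f.cluster v := fun v =>
    mem_clusters.1 (h ▸ mem_clusters.2 ⟨v, rfl⟩)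
  choose e he using h1
  have hinj : Function.Injective e := fun v w hvw =>
    f.cluster_injective (by rw [← he, ← he, hvw])
  have hsurj : Function.Surjective e := fun v' => by
    obtain ⟨v, hv⟩ := mem_clusters.1 (h ▸ mem_clusters.2 ⟨v', rfl⟩ : f'.cluster v' ∈ f.clusters)
    exact ⟨v, f'.cluster_injective (by rw [he, hv])⟩
  -- Parents are characterised by inclusions of clusters alone, and `e` preserves clusters.
  have hpar : ∀ v w, f'.par (e v) = some (e w) ↔ f.par v = some w := fun v w => by
    rw [par_eq_some_iff, par_eq_some_iff]
    simp only [hsurj.forall, he]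
  have hleaf : ∀ j w, f'.leaf j = some (e w) ↔ f.leaf j = some w := fun j w => by
    rw [leaf_eq_some_iff, leaf_eq_some_iff]
    simp only [hsurj.forall, he]
  refine ⟨Equiv.ofBijective e ⟨hinj, hsurj⟩, fun v => ?_, fun j => ?_⟩
  · ext w
    obtain ⟨w, rfl⟩ := hsurj w
    have h1 : f'.par (e v) = some (e w) ↔ (f.par v).map e = some (e w) := by
      rw [Option.map_eq_some_iff, hpar]
      exact ⟨fun h => ⟨w, h, rfl⟩, fun ⟨u, hu, hw⟩ => hinj hw ▸ hu⟩
    exact h1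
  · ext w
    obtain ⟨w, rfl⟩ := hsurj w
    have h1 : f'.leaf j = some (e w) ↔ (f.leaf j).map e = some (e w) := by
      rw [Option.map_eq_some_iff, hleaf]
      exact ⟨fun h => ⟨w, h, rfl⟩, fun ⟨u, hu, hw⟩ => hinj hw ▸ hu⟩
    exact h1

end Forest

end KahlerTree

end

noncomputable section

namespace KahlerTree

set_option linter.unusedSectionVars false

open Relation

/-! ### Gluing two forests at their roots -/

/-- A graph in which the neighbours are the pairs of a vertex and its parent is a tree. -/
theorem isTree_of_par {X : Type} [Finite X] (par : X → Option X)
    (hwf : WellFounded fun w v => par v = some w) (G : SimpleGraph (Option X))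
    (hG : ∀ u v, G.Adj u v ↔ (∃ x, u = some x ∧ v = par x) ∨ ∃ x, v = some x ∧ u = par x) :
    G.IsTree := by
  have hadj : ∀ x, G.Adj (some x) (par x) := fun x => (hG _ _).2 (Or.inl ⟨x, rfl, rfl⟩)
  -- Every vertex is joined to the root by its ancestors, and `x ↦ {x, par x}` matches the vertices
  -- other than the root with the edges.
  rw [SimpleGraph.isTree_iff_connected_and_card]
  constructor
  · have hroot : ∀ u : Option X, G.Reachable u none := by
      intro u
      cases u with
      | none => exact SimpleGraph.Reachable.refl _
      | some x =>
        induction x using hwf.induction with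
        | _ x ih =>
          cases hp : par x with
          | none => exact (hp ▸ hadj x).reachable
          | some y => exact (hp ▸ hadj x : G.Adj (some x) (some y)).reachable.trans (ih y hp)
    have : Nonempty (Option X) := ⟨none⟩
    exact SimpleGraph.Connected.mk fun u v => (hroot u).trans (hroot v).symm
  · have hbij : Function.Bijective
        (fun x => (⟨s(some x, par x), hadj x⟩ : G.edgeSet)) := by
      constructor
      · intro x y hxy
        have h1 : s(some x, par x) = s(some y, par y) := congrArg Subtype.val hxy
        rcases Sym2.eq_iff.1 h1 with ⟨h, -⟩ | ⟨h, h'⟩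
        · exact Option.some_injective _ h
        -- If the two edges coincide crosswise, `x` and `y` are parents of each other.
        · exfalso
          have hxy : TransGen (fun w v => par v = some w) x x :=
            TransGen.head (b := y) h.symm (TransGen.single h')
          exact (hwf.transGen.irrefl).irrefl x hxy
      · rintro ⟨e, he⟩
        induction e using Sym2.ind with
        | _ u v =>
          rcases (hG u v).1 he with ⟨x, rfl, rfl⟩ | ⟨x, rfl, rfl⟩
          · exact ⟨x, rfl⟩
          · exact ⟨x, Subtype.ext Sym2.eq_swap⟩
    rw [← Nat.card_congr (Equiv.ofBijective _ hbij), Finite.card_option]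

namespace Forest

variable {ι V : Type} [Fintype ι] [DecidableEq ι] [Fintype V] [DecidableEq V]

/-- The number of children of a vertex, or of the root. -/
def deg (f : Forest ι V) (w : Option V) : ℕ :=
  (Finset.univ.filter fun v => f.par v = w).card + (Finset.univ.filter fun j => f.leaf j = w).card

/-- Follow the ancestors of any leaf: the last one before the root is a child of the root. -/
theorem one_le_deg_none (f : Forest ι V) [Nonempty ι] : 1 ≤ f.deg none := by
  obtain ⟨j⟩ := ‹Nonempty ι›
  cases hj : f.leaf j with
  | none =>
    have : 0 < (Finset.univ.filter fun j => f.leaf j = none).card :=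
      Finset.card_pos.2 ⟨j, by simp [hj]⟩
    unfold deg
    omega
  | some v =>
    suffices 0 < (Finset.univ.filter fun v => f.par v = none).card by
      unfold deg
      omega
    clear hj
    induction v using f.wellFounded_parent.induction with
    | _ v ih =>
      cases hp : f.par v with
      | none => exact Finset.card_pos.2 ⟨v, by simp [hp]⟩
      | some w => exact ih w hp

end Forest

variable {k m : ℕ} {V V' W W' : Type} [Fintype V] [DecidableEq V] [Fintype V'] [DecidableEq V']
  [Fintype W] [DecidableEq W] [Fintype W'] [DecidableEq W']

/-- The directed edges of the tree obtained by gluing the forests `f` and `f'` at the root: those of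
`f` point to the root, and those of `f'` away from it. -/
def GlueEdge (f : Forest (Fin m) V) (f' : Forest (Fin k) V') (u v : Option (V ⊕ V')) : Prop :=
  (∃ p, u = some (.inl p) ∧ v = (f.par p).map .inl) ∨
    ∃ q, v = some (.inr q) ∧ u = (f'.par q).map .inr

section GlueEdge

variable (f : Forest (Fin m) V) (f' : Forest (Fin k) V')

theorem map_inr_ne_inl (w : Option V') (p : V) :
    w.map (Sum.inr : V' → V ⊕ V') ≠ some (.inl p) := by
  cases w <;> simp

theorem map_inl_ne_inr (w : Option V) (q : V') :
    w.map (Sum.inl : V → V ⊕ V') ≠ some (.inr q) := by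
  cases w <;> simp

theorem glueEdge_inl_left {p : V} {v : Option (V ⊕ V')} :
    GlueEdge f f' (some (.inl p)) v ↔ v = (f.par p).map .inl := by
  constructor
  · rintro (⟨p', hp, rfl⟩ | ⟨q, -, hq⟩)
    · obtain rfl : p = p' := by simpa using hp
      rfl
    · exact absurd hq.symm (map_inr_ne_inl _ _)
  · exact fun h => Or.inl ⟨p, rfl, h⟩

theorem glueEdge_inr_right {q : V'} {u : Option (V ⊕ V')} :
    GlueEdge f f' u (some (.inr q)) ↔ u = (f'.par q).map .inr := by
  constructor
  · rintro (⟨p, -, hp⟩ | ⟨q', hq, rfl⟩)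
    · exact absurd hp.symm (map_inl_ne_inr _ _)
    · obtain rfl : q = q' := by simpa using hq
      rfl
  · exact fun h => Or.inr ⟨q, rfl, h⟩

theorem glueEdge_map_inl_right {w : Option V} {u : Option (V ⊕ V')} :
    GlueEdge f f' u (w.map .inl) ↔ ∃ p, u = some (.inl p) ∧ f.par p = w := by
  constructor
  · rintro (⟨p, rfl, hp⟩ | ⟨q, hq, -⟩)
    · exact ⟨p, rfl, (Option.map_injective Sum.inl_injective hp).symm⟩
    · exact absurd hq (map_inl_ne_inr _ _)
  · rintro ⟨p, rfl, rfl⟩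
    exact Or.inl ⟨p, rfl, rfl⟩

theorem glueEdge_map_inr_left {w : Option V'} {v : Option (V ⊕ V')} :
    GlueEdge f f' (w.map .inr) v ↔ ∃ q, v = some (.inr q) ∧ f'.par q = w := by
  constructor
  · rintro (⟨p, hp, -⟩ | ⟨q, rfl, hq⟩)
    · exact absurd hp (map_inr_ne_inl _ _)
    · exact ⟨q, rfl, (Option.map_injective Sum.inr_injective hq).symm⟩
  · rintro ⟨q, rfl, rfl⟩
    exact Or.inr ⟨q, rfl, rfl⟩

/-- The parents in the glued tree. -/
def gluePar (f : Forest (Fin m) V) (f' : Forest (Fin k) V') : V ⊕ V' → Option (V ⊕ V') :=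
  Sum.elim (fun p => (f.par p).map .inl) fun q => (f'.par q).map .inr

/-- Without directions the glued graph is the parent graph of `gluePar`, to which `isTree_of_par`
applies. -/
theorem glueEdge_or_iff {u v : Option (V ⊕ V')} : GlueEdge f f' u v ∨ GlueEdge f f' v u ↔
    (∃ x, u = some x ∧ v = gluePar f f' x) ∨ ∃ x, v = some x ∧ u = gluePar f f' x := by
  simp only [GlueEdge, gluePar, Sum.exists, Sum.elim_inl, Sum.elim_inr]
  constructor <;> rintro ((h | h) | h | h)
  exacts [Or.inl (Or.inl h), Or.inr (Or.inr h), Or.inr (Or.inl h), Or.inl (Or.inr h),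
    Or.inl (Or.inl h), Or.inr (Or.inr h), Or.inr (Or.inl h), Or.inl (Or.inr h)]

theorem wellFounded_gluePar : WellFounded fun w v => gluePar f f' v = some w := by
  have h1 : ∀ p, Acc (fun w v => gluePar f f' v = some w) (.inl p) := fun p => by
    induction p using f.wellFounded_parent.induction with
    | _ p ih =>
      refine ⟨_, fun w hw => ?_⟩
      obtain ⟨p', hp', rfl⟩ := Option.map_eq_some_iff.1
        (show (f.par p).map Sum.inl = some w from hw)
      exact ih p' hp'
  have h2 : ∀ q, Acc (fun w v => gluePar f f' v = some w) (.inr q) := fun q => by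
    induction q using f'.wellFounded_parent.induction with
    | _ q ih =>
      refine ⟨_, fun w hw => ?_⟩
      obtain ⟨q', hq', rfl⟩ := Option.map_eq_some_iff.1
        (show (f'.par q).map Sum.inr = some w from hw)
      exact ih q' hq'
  exact ⟨fun x => by cases x; exacts [h1 _, h2 _]⟩

theorem GlueEdge.asymm {u v : Option (V ⊕ V')} (h : GlueEdge f f' u v) : ¬ GlueEdge f f' v u := by
  rintro h'
  rcases h with ⟨p, rfl, rfl⟩ | ⟨q, rfl, rfl⟩
  · rw [show (some (Sum.inl p) : Option (V ⊕ V')) = (some p).map .inl from rfl,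
      glueEdge_map_inl_right] at h'
    obtain ⟨p', hp', hpp⟩ := h'
    obtain ⟨p'', hp'', h2⟩ := Option.map_eq_some_iff.1 hp'
    obtain rfl := Sum.inl_injective h2
    exact f.acyclic _ (TransGen.head hp'' (TransGen.single hpp))
  · rw [show (some (Sum.inr q) : Option (V ⊕ V')) = (some q).map .inr from rfl,
      glueEdge_map_inr_left] at h'
    obtain ⟨q', hq', hqq⟩ := h'
    obtain ⟨q'', hq'', h2⟩ := Option.map_eq_some_iff.1 hq'
    obtain rfl := Sum.inr_injective h2
    exact f'.acyclic _ (TransGen.head hq'' (TransGen.single hqq))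

end GlueEdge

/-- An identification of a decorated tree with the gluing of two forests. -/
structure Presents (T : DecoratedTree k m) (f : Forest (Fin m) V) (f' : Forest (Fin k) V') where
  /-- the identification of the vertices -/
  equiv : Option (V ⊕ V') ≃ Fin T.numV
  edge : ∀ u v, (equiv u, equiv v) ∈ T.edges ↔ GlueEdge f f' u v
  inLeg : ∀ j, T.inLeg j = equiv ((f.leaf j).map .inl)
  outLeg : ∀ i, T.outLeg i = equiv ((f'.leaf i).map .inr)

open Classical in
theorem exists_presents (f : Forest (Fin m) V) (f' : Forest (Fin k) V') :
    ∃ T : DecoratedTree k m, Nonempty (Presents T f f') := by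
  let e := Fintype.equivFin (Option (V ⊕ V'))
  let E : Finset (Fin _ × Fin _) :=
    Finset.univ.filter fun x => GlueEdge f f' (e.symm x.1) (e.symm x.2)
  have hE : ∀ u v, (u, v) ∈ E ↔ GlueEdge f f' (e.symm u) (e.symm v) := fun u v => by simp [E]
  have hasymm : ∀ u v, (u, v) ∈ E → (v, u) ∉ E := fun u v h h' =>
    ((hE _ _).1 h).asymm f f' ((hE _ _).1 h')
  have htree : (SimpleGraph.fromRel fun u v => (u, v) ∈ E).IsTree := by
    let G : SimpleGraph (Option (V ⊕ V')) :=
      (SimpleGraph.fromRel fun u v => (u, v) ∈ E).comap e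
    have hG : G.IsTree := by
      refine isTree_of_par _ (wellFounded_gluePar f f') G fun u v => ?_
      rw [← glueEdge_or_iff]
      simp only [G, SimpleGraph.comap_adj, SimpleGraph.fromRel_adj, hE, Equiv.symm_apply_apply]
      refine ⟨fun h => h.2, fun h => ⟨fun huv => ?_, h⟩⟩
      obtain rfl := e.injective huv
      rcases h with h | h <;> exact h.asymm f f' h
    exact (SimpleGraph.Iso.comap e _).isTree_iff.1 hG
  refine ⟨⟨_, E, fun i => e ((f'.leaf i).map .inr), fun j => e ((f.leaf j).map .inl), hasymm,
    htree⟩, ⟨⟨e, fun u v => ?_, fun _ => rfl, fun _ => rfl⟩⟩⟩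
  rw [hE, e.symm_apply_apply, e.symm_apply_apply]

/-! ### Degrees, reachability and clusters in a glued tree -/

namespace Presents

variable {T T' : DecoratedTree k m} {f : Forest (Fin m) V} {f' : Forest (Fin k) V'}
  {g : Forest (Fin m) W} {g' : Forest (Fin k) W'}

theorem outEdges_card (h : Presents T f f') (u : Option (V ⊕ V')) {s : Finset (Option (V ⊕ V'))}
    (hs : ∀ v, v ∈ s ↔ GlueEdge f f' u v) :
    (T.edges.filter fun e => e.1 = h.equiv u).card = s.card := by
  symm
  refine Finset.card_bij (fun v _ => (h.equiv u, h.equiv v)) (fun v hv => ?_)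
    (fun v _ v' _ hvv => h.equiv.injective (Prod.ext_iff.1 hvv).2) fun e he => ?_
  · exact Finset.mem_filter.2 ⟨(h.edge _ _).2 ((hs v).1 hv), rfl⟩
  · obtain ⟨he, h1⟩ := Finset.mem_filter.1 he
    obtain ⟨x, y⟩ := e
    obtain rfl : x = h.equiv u := h1
    obtain ⟨v, rfl⟩ := h.equiv.surjective y
    exact ⟨v, (hs v).2 ((h.edge _ _).1 he), rfl⟩

theorem inEdges_card (h : Presents T f f') (u : Option (V ⊕ V')) {s : Finset (Option (V ⊕ V'))}
    (hs : ∀ v, v ∈ s ↔ GlueEdge f f' v u) :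
    (T.edges.filter fun e => e.2 = h.equiv u).card = s.card := by
  symm
  refine Finset.card_bij (fun v _ => (h.equiv v, h.equiv u)) (fun v hv => ?_)
    (fun v _ v' _ hvv => h.equiv.injective (Prod.ext_iff.1 hvv).1) fun e he => ?_
  · exact Finset.mem_filter.2 ⟨(h.edge _ _).2 ((hs v).1 hv), rfl⟩
  · obtain ⟨he, h1⟩ := Finset.mem_filter.1 he
    obtain ⟨x, y⟩ := e
    obtain rfl : y = h.equiv u := h1
    obtain ⟨v, rfl⟩ := h.equiv.surjective x
    exact ⟨v, (hs v).2 ((h.edge _ _).1 he), rfl⟩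

theorem degOut_inl (h : Presents T f f') (p : V) : T.degOut (h.equiv (some (.inl p))) = 1 := by
  unfold DecoratedTree.degOut
  rw [h.outEdges_card _ (s := {(f.par p).map .inl}) (by simp [glueEdge_inl_left]),
    Finset.card_singleton, Finset.filter_false_of_mem, Finset.card_empty]
  intro i _ hi
  rw [h.outLeg] at hi
  exact map_inr_ne_inl _ _ (h.equiv.injective hi)

theorem degIn_inr (h : Presents T f f') (q : V') : T.degIn (h.equiv (some (.inr q))) = 1 := by
  unfold DecoratedTree.degIn
  rw [h.inEdges_card _ (s := {(f'.par q).map .inr}) (by simp [glueEdge_inr_right]),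
    Finset.card_singleton, Finset.filter_false_of_mem, Finset.card_empty]
  intro i _ hi
  rw [h.inLeg] at hi
  exact map_inl_ne_inr _ _ (h.equiv.injective hi)

theorem degIn_map_inl (h : Presents T f f') (w : Option V) :
    T.degIn (h.equiv (w.map .inl)) = f.deg w := by
  unfold DecoratedTree.degIn Forest.deg
  rw [h.inEdges_card _ (s := (Finset.univ.filter fun p => f.par p = w).map
    ⟨fun p => some (.inl p), fun _ _ h => Sum.inl_injective (Option.some_injective _ h)⟩),
    Finset.card_map]
  · congr 2
    ext j
    simp only [h.inLeg, Finset.mem_filter, Finset.mem_univ, true_and, h.equiv.injective.eq_iff]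
    exact (Option.map_injective Sum.inl_injective).eq_iff
  · intro v
    rw [glueEdge_map_inl_right]
    simp only [Finset.mem_map, Finset.mem_filter, Finset.mem_univ, true_and]
    exact ⟨fun ⟨p, h1, h2⟩ => ⟨p, h2.symm, h1⟩, fun ⟨p, h1, h2⟩ => ⟨p, h2, h1.symm⟩⟩

theorem degOut_map_inr (h : Presents T f f') (w : Option V') :
    T.degOut (h.equiv (w.map .inr)) = f'.deg w := by
  unfold DecoratedTree.degOut Forest.deg
  rw [h.outEdges_card _ (s := (Finset.univ.filter fun p => f'.par p = w).map
    ⟨fun p => some (.inr p), fun _ _ h => Sum.inr_injective (Option.some_injective _ h)⟩),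
    Finset.card_map]
  · congr 2
    ext j
    simp only [h.outLeg, Finset.mem_filter, Finset.mem_univ, true_and, h.equiv.injective.eq_iff]
    exact (Option.map_injective Sum.inr_injective).eq_iff
  · intro v
    rw [glueEdge_map_inr_left]
    simp only [Finset.mem_map, Finset.mem_filter, Finset.mem_univ, true_and]
    exact ⟨fun ⟨p, h1, h2⟩ => ⟨p, h2.symm, h1⟩, fun ⟨p, h1, h2⟩ => ⟨p, h2, h1.symm⟩⟩

/-- A gluing of two forests is semistable and contractible. -/
theorem isSemistable (h : Presents T f f') [NeZero m] (hr : 2 ≤ f'.deg none) :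
    T.IsSemistable := by
  intro v
  obtain ⟨u, rfl⟩ := h.equiv.surjective v
  rcases u with _ | p | q
  · have h1 := h.degIn_map_inl none
    have h2 := h.degOut_map_inr none
    have h3 := f.one_le_deg_none
    simp only [Option.map_none] at h1 h2
    omega
  · have h1 := h.degIn_map_inl (some p)
    have h2 := h.degOut_inl p
    have h3 : 2 ≤ f.deg (some p) := f.two_le p
    simp only [Option.map_some] at h1
    omega
  · have h1 := h.degOut_map_inr (some q)
    have h2 := h.degIn_inr q
    have h3 : 2 ≤ f'.deg (some q) := f'.two_le q
    simp only [Option.map_some] at h1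
    omega

theorem isContractible (h : Presents T f f') : T.IsContractible := by
  rintro ⟨x, y⟩ he
  obtain ⟨u, rfl⟩ := h.equiv.surjective x
  obtain ⟨v, rfl⟩ := h.equiv.surjective y
  rcases (h.edge u v).1 he with ⟨p, rfl, -⟩ | ⟨q, rfl, -⟩
  · exact Or.inl (h.degOut_inl p)
  · exact Or.inr (h.degIn_inr q)

theorem two_le_degOut_map_inr (h : Presents T f f') (hr : 2 ≤ f'.deg none) (w : Option V') :
    2 ≤ T.degOut (h.equiv (w.map .inr)) := by
  rw [h.degOut_map_inr]
  cases w with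
  | none => exact hr
  | some q => exact f'.two_le q

/-- The tree alone tells which vertices belong to the first forest. The condition on the root degree
makes this possible: otherwise the root could be confused with a vertex of that forest. -/
theorem degOut_eq_one_iff (h : Presents T f f') (hr : 2 ≤ f'.deg none) (u : Option (V ⊕ V')) :
    T.degOut (h.equiv u) = 1 ↔ ∃ p, u = some (.inl p) := by
  constructor
  · intro h1
    rcases u with _ | p | q
    · have := h.two_le_degOut_map_inr hr none
      simp only [Option.map_none] at this
      omega
    · exact ⟨p, rfl⟩
    · have := h.two_le_degOut_map_inr hr (some q)
      simp only [Option.map_some] at this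
      omega
  · rintro ⟨p, rfl⟩
    exact h.degOut_inl p

theorem reach_iff (h : Presents T f f') {u v : Option (V ⊕ V')} :
    ReflTransGen (fun x y => (x, y) ∈ T.edges) (h.equiv u) (h.equiv v) ↔
      ReflTransGen (GlueEdge f f') u v := by
  constructor
  · intro h1
    generalize hx : h.equiv u = x at h1
    generalize hy : h.equiv v = y at h1
    induction h1 generalizing v with
    | refl => rw [h.equiv.injective (hx.trans hy.symm)]
    | @tail b c _ h2 ih =>
      obtain ⟨w, rfl⟩ := h.equiv.surjective b
      subst hy
      exact (ih rfl).tail ((h.edge _ _).1 h2)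
  · intro h1
    induction h1 with
    | refl => exact ReflTransGen.refl
    | tail _ h2 ih => exact ih.tail ((h.edge _ _).2 h2)

/-- Edges never lead back from the root or from the second forest into the first one, so a directed
path ending there is an ascending chain of parents. -/
theorem reach_inl_iff {u : Option (V ⊕ V')} {p : V} :
    ReflTransGen (GlueEdge f f') u (some (.inl p)) ↔ ∃ p', u = some (.inl p') ∧ f.Le p' p := by
  constructor
  · intro h
    induction h using ReflTransGen.head_induction_on with
    | refl => exact ⟨p, rfl, ReflTransGen.refl⟩
    | head h1 _ ih =>
      obtain ⟨p', rfl, hp'⟩ := ih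
      obtain ⟨p'', rfl, hp''⟩ := (glueEdge_map_inl_right f f' (w := some p')).1 h1
      exact ⟨p'', rfl, ReflTransGen.head hp'' hp'⟩
  · rintro ⟨p', rfl, h⟩
    induction h with
    | refl => exact ReflTransGen.refl
    | tail _ h2 ih => exact ih.tail ((glueEdge_inl_left f f').2 (by rw [h2]; rfl))

theorem reach_inr_iff {u : Option (V ⊕ V')} {q : V'} :
    ReflTransGen (GlueEdge f f') (some (.inr q)) u ↔ ∃ q', u = some (.inr q') ∧ f'.Le q' q := by
  constructor
  · intro h
    induction h with
    | refl => exact ⟨q, rfl, ReflTransGen.refl⟩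
    | tail _ h1 ih =>
      obtain ⟨q', rfl, hq'⟩ := ih
      obtain ⟨q'', rfl, hq''⟩ := (glueEdge_map_inr_left f f' (w := some q')).1 h1
      exact ⟨q'', rfl, ReflTransGen.head hq'' hq'⟩
  · rintro ⟨q', rfl, h⟩
    induction h using ReflTransGen.head_induction_on with
    | refl => exact ReflTransGen.refl
    | head h2 _ ih => exact ih.tail ((glueEdge_inr_right f f').2 (by rw [h2]; rfl))

theorem reach_none (u : V') : ReflTransGen (GlueEdge f f') none (some (.inr u)) := by
  induction u using f'.wellFounded_parent.induction with
  | _ u ih =>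
    cases hp : f'.par u with
    | none => exact ReflTransGen.single ((glueEdge_inr_right f f').2 (by rw [hp]; rfl))
    | some w => exact (ih w hp).tail ((glueEdge_inr_right f f').2 (by rw [hp]; rfl))

theorem mem_cluster_inl (h : Presents T f f') (p : V) (j : Fin m) :
    j ∈ f.cluster p ↔
      ReflTransGen (fun x y => (x, y) ∈ T.edges) (T.inLeg j) (h.equiv (some (.inl p))) := by
  rw [h.inLeg, h.reach_iff, reach_inl_iff, Forest.mem_cluster]
  refine exists_congr fun u => and_congr_left fun _ => ?_
  exact (Option.map_injective Sum.inl_injective).eq_iff (b := some u) |>.symm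

theorem mem_cluster_inr (h : Presents T f f') (q : V') (i : Fin k) :
    i ∈ f'.cluster q ↔
      ReflTransGen (fun x y => (x, y) ∈ T.edges) (h.equiv (some (.inr q))) (T.outLeg i) := by
  rw [h.outLeg, h.reach_iff, reach_inr_iff, Forest.mem_cluster]
  refine exists_congr fun u => and_congr_left fun _ => ?_
  exact (Option.map_injective Sum.inr_injective).eq_iff (b := some u) |>.symm

theorem reach_root (h : Presents T f f') (i : Fin k) :
    ReflTransGen (fun x y => (x, y) ∈ T.edges) (h.equiv none) (T.outLeg i) := by
  rw [h.outLeg, h.reach_iff]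
  cases f'.leaf i with
  | none => exact ReflTransGen.refl
  | some q => exact reach_none q

open Classical in
/-- The clusters of the first forest in terms of the tree. -/
theorem mem_clusters_inl (h : Presents T f f') (hr : 2 ≤ f'.deg none) (s : Finset (Fin m)) :
    s ∈ f.clusters ↔ ∃ v, T.degOut v = 1 ∧ s = Finset.univ.filter fun j =>
      ReflTransGen (fun x y => (x, y) ∈ T.edges) (T.inLeg j) v := by
  rw [Forest.mem_clusters, h.equiv.symm.exists_congr_left]
  constructor
  · rintro ⟨p, rfl⟩
    refine ⟨some (.inl p), h.degOut_inl p, ?_⟩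
    ext j
    rw [h.mem_cluster_inl]
    simp
  · rintro ⟨u, h1, rfl⟩
    obtain ⟨p, rfl⟩ := (h.degOut_eq_one_iff hr u).1 h1
    refine ⟨p, ?_⟩
    ext j
    rw [h.mem_cluster_inl]
    simp

open Classical in
/-- The clusters of the second forest in terms of the tree. -/
theorem mem_clusters_inr (h : Presents T f f') (hr : 2 ≤ f'.deg none) (s : Finset (Fin k)) :
    s ∈ f'.clusters ↔ s ≠ Finset.univ ∧ ∃ v, T.degOut v ≠ 1 ∧ s = Finset.univ.filter fun i =>
      ReflTransGen (fun x y => (x, y) ∈ T.edges) v (T.outLeg i) := by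
  rw [Forest.mem_clusters, h.equiv.symm.exists_congr_left]
  constructor
  · rintro ⟨q, rfl⟩
    refine ⟨Forest.cluster_ne_univ hr q, some (.inr q), ?_, ?_⟩
    · rw [Ne, Equiv.symm_symm, h.degOut_eq_one_iff hr]
      simp
    · ext j
      rw [h.mem_cluster_inr]
      simp
  · rintro ⟨hs, u, h1, rfl⟩
    rw [Ne, Equiv.symm_symm, h.degOut_eq_one_iff hr] at h1
    rcases u with _ | p | q
    -- The root also has outward degree different from `1`, but it reaches every outward leg; the
    -- condition `s ≠ Finset.univ` excludes it.
    · refine absurd (Finset.filter_true_of_mem fun i _ => ?_) hs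
      exact h.reach_root i
    · exact absurd ⟨p, rfl⟩ h1
    · refine ⟨q, ?_⟩
      ext j
      rw [h.mem_cluster_inr]
      simp

/-- The clusters are determined by the tree. -/
theorem clusters_eq (h : Presents T f f') (h' : Presents T g g') (hr : 2 ≤ f'.deg none)
    (hr' : 2 ≤ g'.deg none) : f.clusters = g.clusters ∧ f'.clusters = g'.clusters := by
  classical
  constructor
  · ext s
    rw [h.mem_clusters_inl hr, h'.mem_clusters_inl hr']
  · ext s
    rw [h.mem_clusters_inr hr, h'.mem_clusters_inr hr']

theorem nonempty_of_iso (h : Presents T f f') (hT : T.Iso T') : Nonempty (Presents T' f f') := by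
  obtain ⟨σ, h1, h2, h3⟩ := hT
  refine ⟨⟨h.equiv.trans σ, fun u v => ?_, fun j => ?_, fun i => ?_⟩⟩
  · rw [Equiv.trans_apply, Equiv.trans_apply, ← h1, h.edge]
  · rw [← h3, h.inLeg, Equiv.trans_apply]
  · rw [← h2, h.outLeg, Equiv.trans_apply]

/-- Gluings of forests with the same clusters are isomorphic. -/
theorem iso (h : Presents T f f') (h' : Presents T' g g') (hc : f.clusters = g.clusters)
    (hc' : f'.clusters = g'.clusters) : T.Iso T' := by
  obtain ⟨e, he, hl⟩ := f.exists_equiv g hc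
  obtain ⟨e', he', hl'⟩ := f'.exists_equiv g' hc'
  let E : Option (V ⊕ V') ≃ Option (W ⊕ W') := Equiv.optionCongr (e.sumCongr e')
  have hE1 : ∀ w : Option V, E (w.map .inl) = (w.map e).map .inl := fun w => by
    cases w <;> rfl
  have hE2 : ∀ w : Option V', E (w.map .inr) = (w.map e').map .inr := fun w => by
    cases w <;> rfl
  have hE : ∀ u v, GlueEdge f f' u v ↔ GlueEdge g g' (E u) (E v) := by
    intro u v
    unfold GlueEdge
    refine or_congr ?_ ?_
    · rw [← e.exists_congr_right]
      refine exists_congr fun p => and_congr ?_ ?_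
      · rw [show some (Sum.inl (e p)) = E (some (.inl p)) from rfl, E.injective.eq_iff]
      · rw [he, ← hE1, E.injective.eq_iff]
    · rw [← e'.exists_congr_right]
      refine exists_congr fun p => and_congr ?_ ?_
      · rw [show some (Sum.inr (e' p)) = E (some (.inr p)) from rfl, E.injective.eq_iff]
      · rw [he', ← hE2, E.injective.eq_iff]
  refine ⟨(h.equiv.symm.trans E).trans h'.equiv, fun u v => ?_, fun i => ?_, fun j => ?_⟩
  · obtain ⟨u, rfl⟩ := h.equiv.surjective u
    obtain ⟨v, rfl⟩ := h.equiv.surjective v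
    simp only [Equiv.trans_apply, Equiv.symm_apply_apply]
    rw [h.edge, h'.edge, hE]
  · rw [h.outLeg, h'.outLeg, hl', ← hE2]
    simp
  · rw [h.inLeg, h'.inLeg, hl, ← hE1]
    simp

end Presents

end KahlerTree

end

noncomputable section

namespace KahlerTree

set_option linter.unusedSectionVars false

open Relation

/-! ### Decomposition of contractible trees -/

namespace DecoratedTree

variable {k m : ℕ} {T : DecoratedTree k m}

/-- Connectedness in the form used below: a property that passes along edges in both directions
holds everywhere once it holds somewhere. -/
theorem eq_of_closed (Z : Fin T.numV → Prop) (hZ : ∀ u v, (u, v) ∈ T.edges → (Z u ↔ Z v))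
    {v : Fin T.numV} (hv : Z v) (w : Fin T.numV) : Z w := by
  have h := T.isTree.connected.preconnected v w
  rw [SimpleGraph.reachable_iff_reflTransGen] at h
  induction h with
  | refl => exact hv
  | tail _ h ih =>
    rcases ((SimpleGraph.fromRel_adj _ _ _).1 h).2 with h | h
    · exact (hZ _ _ h).1 ih
    · exact (hZ _ _ h).2 ih

theorem eq_of_degOut_eq_one {u v w : Fin T.numV} (h : T.degOut u = 1) (hv : (u, v) ∈ T.edges)
    (hw : (u, w) ∈ T.edges) : v = w := by
  unfold degOut at h
  have h1 : (T.edges.filter fun e => e.1 = u).card ≤ 1 := by omega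
  exact congrArg Prod.snd (Finset.card_le_one.1 h1 (u, v) (Finset.mem_filter.2 ⟨hv, rfl⟩) (u, w)
    (Finset.mem_filter.2 ⟨hw, rfl⟩))

theorem eq_of_degIn_eq_one {u v w : Fin T.numV} (h : T.degIn w = 1) (hu : (u, w) ∈ T.edges)
    (hv : (v, w) ∈ T.edges) : u = v := by
  unfold degIn at h
  have h1 : (T.edges.filter fun e => e.2 = w).card ≤ 1 := by omega
  exact congrArg Prod.fst (Finset.card_le_one.1 h1 (u, w) (Finset.mem_filter.2 ⟨hu, rfl⟩) (v, w)
    (Finset.mem_filter.2 ⟨hv, rfl⟩))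

theorem outLeg_ne_of_edge {u v : Fin T.numV} (h : T.degOut u = 1) (hv : (u, v) ∈ T.edges)
    (i : Fin k) : T.outLeg i ≠ u := by
  intro hi
  unfold degOut at h
  have h1 : 0 < (T.edges.filter fun e => e.1 = u).card :=
    Finset.card_pos.2 ⟨(u, v), Finset.mem_filter.2 ⟨hv, rfl⟩⟩
  have h2 : 0 < (Finset.univ.filter fun i => T.outLeg i = u).card :=
    Finset.card_pos.2 ⟨i, Finset.mem_filter.2 ⟨Finset.mem_univ _, hi⟩⟩
  omega

theorem inLeg_ne_of_edge {u v : Fin T.numV} (h : T.degIn v = 1) (hv : (u, v) ∈ T.edges)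
    (j : Fin m) : T.inLeg j ≠ v := by
  intro hi
  unfold degIn at h
  have h1 : 0 < (T.edges.filter fun e => e.2 = v).card :=
    Finset.card_pos.2 ⟨(u, v), Finset.mem_filter.2 ⟨hv, rfl⟩⟩
  have h2 : 0 < (Finset.univ.filter fun i => T.inLeg i = v).card :=
    Finset.card_pos.2 ⟨j, Finset.mem_filter.2 ⟨Finset.mem_univ _, hi⟩⟩
  omega

variable (hs : T.IsSemistable) (hc : T.IsContractible)
include hs hc

theorem degIn_of_edge {u v : Fin T.numV} (h : (u, v) ∈ T.edges) (hu : T.degOut u ≠ 1) :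
    T.degIn v = 1 :=
  (hc _ h).resolve_left hu

/-- Contractibility forces `deg⁻(v) = 1`, and then semistability forces `deg⁺(v) ≥ 2`. Outward
branching therefore persists along directed paths, which gives the tree its two regimes. -/
theorem degOut_ne_of_edge {u v : Fin T.numV} (h : (u, v) ∈ T.edges) (hu : T.degOut u ≠ 1) :
    T.degOut v ≠ 1 := by
  have h1 := degIn_of_edge hs hc h hu
  have h2 := (hs v).2.2
  omega

variable (hk : 2 ≤ k)
include hk

/-- The leg would be the only outward half-edge of `v`, so `v` has no outgoing edge. The vertices of
outward degree `1` that lead to `v` are then closed under adjacency and exhaust the tree, and no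
vertex is left for a second outward leg. -/
theorem outLeg_ne_of_degOut {v : Fin T.numV} (hv : T.degOut v = 1) (i : Fin k) :
    T.outLeg i ≠ v := by
  intro hi
  have hno : ∀ w, (v, w) ∉ T.edges := fun w hw => outLeg_ne_of_edge hv hw i hi
  have hall := eq_of_closed (T := T)
    (fun w => T.degOut w = 1 ∧ ReflTransGen (fun x y => (x, y) ∈ T.edges) w v)
    (fun x y hxy => by
      constructor
      · rintro ⟨hx, hxv⟩
        rcases ReflTransGen.cases_head hxv with rfl | ⟨z, hz, hzv⟩
        · exact absurd hxy (hno y)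
        · obtain rfl := eq_of_degOut_eq_one hx hxy hz
          refine ⟨?_, hzv⟩
          rcases ReflTransGen.cases_tail hzv with rfl | ⟨t, _, ht⟩
          · exact hv
          · by_contra hy
            have : ∀ z, ReflTransGen (fun x y => (x, y) ∈ T.edges) y z → T.degOut z ≠ 1 := by
              intro z hz
              induction hz with
              | refl => exact hy
              | tail _ h ih => exact degOut_ne_of_edge hs hc h ih
            exact this v hzv hv
      · rintro ⟨hy, hyv⟩
        refine ⟨?_, ReflTransGen.head hxy hyv⟩
        by_contra hx
        exact degOut_ne_of_edge hs hc hxy hx hy) (v := v) ⟨hv, ReflTransGen.refl⟩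
  -- The second leg would sit at `v` or at a vertex with an edge towards `v`; either way that vertex
  -- would have two outward half-edges.
  obtain ⟨i', hi'⟩ : ∃ i', i' ≠ i := by
    have : Nontrivial (Fin k) := Fin.nontrivial_iff_two_le.2 hk
    exact exists_ne i
  obtain ⟨h1, h2⟩ := hall (T.outLeg i')
  rcases ReflTransGen.cases_head h2 with h3 | ⟨z, hz, -⟩
  · unfold degOut at hv
    have : 1 < (Finset.univ.filter fun i => T.outLeg i = v).card :=
      Finset.one_lt_card.2 ⟨i', by simp [h3], i, by simp [hi], hi'⟩
    omega
  · exact outLeg_ne_of_edge h1 hz i' rfl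

theorem exists_edge_of_degOut {v : Fin T.numV} (hv : T.degOut v = 1) : ∃ w, (v, w) ∈ T.edges := by
  have h : (Finset.univ.filter fun i => T.outLeg i = v) = ∅ :=
    Finset.filter_false_of_mem fun i _ => outLeg_ne_of_degOut hs hc hk hv i
  have hv' := hv
  unfold degOut at hv'
  rw [h, Finset.card_empty, add_zero] at hv'
  obtain ⟨⟨x, w⟩, he⟩ := Finset.card_pos.1 (by omega : 0 < (T.edges.filter fun e => e.1 = v).card)
  obtain ⟨hx, rfl⟩ := Finset.mem_filter.1 he
  exact ⟨w, hx⟩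

/-- There is a vertex with several outward half-edges, all of whose incoming edges start at vertices
with a single outward half-edge. -/
theorem exists_root : ∃ v, T.degOut v ≠ 1 ∧ ∀ u, (u, v) ∈ T.edges → T.degOut u = 1 := by
  by_contra hno
  push Not at hno
  -- Without a root every vertex selects an edge at itself: its outgoing edge if its outward degree
  -- is `1`, otherwise an incoming edge from a vertex of outward degree different from `1`. The tail
  -- of the edge tells which case occurred, so the choice is injective, and there would be at least
  -- as many edges as vertices.
  have h1 : ∀ v, ∃ e ∈ T.edges, (T.degOut v = 1 ∧ T.degOut e.1 = 1 ∧ e.1 = v) ∨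
      (T.degOut v ≠ 1 ∧ T.degOut e.1 ≠ 1 ∧ e.2 = v) := by
    intro v
    by_cases hv : T.degOut v = 1
    · obtain ⟨w, hw⟩ := exists_edge_of_degOut hs hc hk hv
      exact ⟨_, hw, Or.inl ⟨hv, hv, rfl⟩⟩
    · obtain ⟨u, hu, hu1⟩ := hno v hv
      exact ⟨_, hu, Or.inr ⟨hv, hu1, rfl⟩⟩
  choose e he h2 using h1
  have hinj : Function.Injective e := by
    intro v w hvw
    rcases h2 v with ⟨_, a, b⟩ | ⟨_, a, b⟩ <;> rcases h2 w with ⟨_, a', b'⟩ | ⟨_, a', b'⟩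
    · rw [← b, ← b', hvw]
    · rw [hvw] at a
      exact absurd a a'
    · rw [hvw] at a
      exact absurd a' a
    · rw [← b, ← b', hvw]
  have h3 : Fintype.card (Fin T.numV) ≤ T.edges.card := by
    rw [← Finset.card_univ]
    exact Finset.card_le_card_of_injOn e (fun v _ => he v) hinj.injOn
  have := T.card_edges_lt
  rw [Fintype.card_fin] at h3
  omega

/-- The structure of the tree relative to its root. -/
theorem reach_root {ρ : Fin T.numV} (hρ : T.degOut ρ ≠ 1)
    (hin : ∀ u, (u, ρ) ∈ T.edges → T.degOut u = 1) (v : Fin T.numV) :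
    (T.degOut v = 1 ∧ ReflTransGen (fun x y => (x, y) ∈ T.edges ∧ T.degOut x = 1) v ρ) ∨
      (T.degOut v ≠ 1 ∧ ReflTransGen (fun x y => (x, y) ∈ T.edges ∧ T.degOut x ≠ 1) ρ v) := by
  -- The alternative passes along edges: a vertex of outward degree `1` has only one successor, and
  -- a vertex reached from `ρ` along the second kind of edge has only one predecessor, so the
  -- neighbour in question lies on the given path, except at `ρ` itself.
  refine eq_of_closed (T := T) (fun v => (T.degOut v = 1 ∧
    ReflTransGen (fun x y => (x, y) ∈ T.edges ∧ T.degOut x = 1) v ρ) ∨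
      (T.degOut v ≠ 1 ∧ ReflTransGen (fun x y => (x, y) ∈ T.edges ∧ T.degOut x ≠ 1) ρ v))
    (fun x y hxy => ⟨?_, ?_⟩) (v := ρ) (Or.inr ⟨hρ, ReflTransGen.refl⟩) v
  · rintro (⟨hx, h⟩ | ⟨hx, h⟩)
    · rcases ReflTransGen.cases_head h with rfl | ⟨z, ⟨hz, -⟩, hzv⟩
      · exact absurd hx hρ
      · obtain rfl := eq_of_degOut_eq_one hx hxy hz
        by_cases hy : T.degOut y = 1
        · exact Or.inl ⟨hy, hzv⟩
        · rcases ReflTransGen.cases_head hzv with rfl | ⟨t, ⟨_, ht⟩, _⟩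
          · exact Or.inr ⟨hρ, ReflTransGen.refl⟩
          · exact absurd ht hy
    · exact Or.inr ⟨degOut_ne_of_edge hs hc hxy hx, h.tail ⟨hxy, hx⟩⟩
  · rintro (⟨hy, h⟩ | ⟨hy, h⟩)
    · have hx : T.degOut x = 1 := by
        by_contra hx
        exact degOut_ne_of_edge hs hc hxy hx hy
      exact Or.inl ⟨hx, ReflTransGen.head ⟨hxy, hx⟩ h⟩
    · rcases ReflTransGen.cases_tail h with rfl | ⟨z, hz', hz, hz1⟩
      · exact Or.inl ⟨hin x hxy, ReflTransGen.single ⟨hxy, hin x hxy⟩⟩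
      · obtain rfl := eq_of_degIn_eq_one (degIn_of_edge hs hc hz hz1) hxy hz
        exact Or.inr ⟨hz1, hz'⟩

open Classical in
/-- Every contractible semistable tree is a gluing of two forests. -/
theorem exists_forests : ∃ (V V' : Type) (_ : Fintype V) (_ : DecidableEq V) (_ : Fintype V')
    (_ : DecidableEq V') (f : Forest (Fin m) V) (f' : Forest (Fin k) V'),
    2 ≤ f'.deg none ∧ Nonempty (Presents T f f') := by
  obtain ⟨ρ, hρ, hin⟩ := exists_root hs hc hk
  have hreach := reach_root hs hc hk hρ hin
  have hout := fun v (hv : T.degOut v = 1) => exists_edge_of_degOut hs hc hk hv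
  choose nxt hnxt using hout
  have hprev : ∀ v, T.degOut v ≠ 1 ∧ v ≠ ρ → ∃ u, (u, v) ∈ T.edges ∧ T.degOut u ≠ 1 := by
    rintro v ⟨hv, hvρ⟩
    rcases hreach v with ⟨h, -⟩ | ⟨-, h⟩
    · exact absurd h hv
    · rcases ReflTransGen.cases_tail h with rfl | ⟨z, -, hz⟩
      · exact absurd rfl hvρ
      · exact ⟨z, hz⟩
  choose prv hprv hprv1 using hprev
  have hnxt_eq : ∀ {v w} (hv : T.degOut v = 1), (v, w) ∈ T.edges → nxt v hv = w :=
    fun hv hw => eq_of_degOut_eq_one hv (hnxt _ hv) hw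
  have hprv_eq : ∀ {v u} (hv : T.degOut v ≠ 1 ∧ v ≠ ρ), (u, v) ∈ T.edges → prv v hv = u :=
    fun hv hu => eq_of_degIn_eq_one (degIn_of_edge hs hc (hprv _ hv) (hprv1 _ hv)) (hprv _ hv) hu
  -- On the path to `ρ` all vertices before `ρ` have outward degree `1`, so the successor of `v`
  -- either has this degree or is `ρ`.
  have hnxtρ : ∀ v (hv : T.degOut v = 1), T.degOut (nxt v hv) ≠ 1 → nxt v hv = ρ := by
    intro v hv h
    rcases hreach v with ⟨-, h1⟩ | ⟨h1, -⟩
    · rcases ReflTransGen.cases_head h1 with rfl | ⟨z, ⟨hz, -⟩, hzρ⟩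
      · exact absurd hv hρ
      · obtain rfl := hnxt_eq hv hz
        rcases ReflTransGen.cases_head hzρ with h2 | ⟨t, ⟨-, ht⟩, -⟩
        · exact h2
        · exact absurd ht h
    · exact absurd hv h1
  -- Beyond `ρ` the only inward half-edge of a vertex is the edge from its predecessor, which leaves
  -- no room for an inward leg.
  have hinLeg : ∀ j, T.degOut (T.inLeg j) ≠ 1 → T.inLeg j = ρ := by
    intro j hj
    by_contra hne
    exact inLeg_ne_of_edge (degIn_of_edge hs hc (hprv _ ⟨hj, hne⟩) (hprv1 _ ⟨hj, hne⟩))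
      (hprv _ ⟨hj, hne⟩) j rfl
  have houtLeg : ∀ i, T.degOut (T.outLeg i) ≠ 1 := fun i hi =>
    outLeg_ne_of_degOut hs hc hk hi i rfl
  let V := {v : Fin T.numV // T.degOut v = 1}
  let V' := {v : Fin T.numV // T.degOut v ≠ 1 ∧ v ≠ ρ}
  let par : V → Option V := fun v =>
    if h : T.degOut (nxt v.1 v.2) = 1 then some ⟨_, h⟩ else none
  let par' : V' → Option V' := fun v =>
    if h : prv v.1 v.2 = ρ then none else some ⟨prv v.1 v.2, hprv1 v.1 v.2, h⟩
  let leaf : Fin m → Option V := fun j =>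
    if h : T.degOut (T.inLeg j) = 1 then some ⟨_, h⟩ else none
  let leaf' : Fin k → Option V' := fun i =>
    if h : T.outLeg i = ρ then none else some ⟨T.outLeg i, houtLeg i, h⟩
  let pos : Option V → Fin T.numV := fun w => w.elim ρ Subtype.val
  let pos' : Option V' → Fin T.numV := fun w => w.elim ρ Subtype.val
  have hpos : Function.Injective pos := by
    rintro (_ | v) (_ | w) h
    · rfl
    · exact absurd ((show ρ = w.1 from h) ▸ w.2) hρ
    · exact absurd ((show v.1 = ρ from h) ▸ v.2) hρ
    · exact congrArg some (Subtype.ext h)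
  have hpos' : Function.Injective pos' := by
    rintro (_ | v) (_ | w) h
    · rfl
    · exact absurd (show ρ = w.1 from h).symm w.2.2
    · exact absurd (show v.1 = ρ from h) v.2.2
    · exact congrArg some (Subtype.ext h)
  have hpar : ∀ v, pos (par v) = nxt v.1 v.2 := by
    intro v
    by_cases h : T.degOut (nxt v.1 v.2) = 1
    · simp only [par, dif_pos h]; rfl
    · simp only [par, dif_neg h]; exact (hnxtρ _ _ h).symm
  have hpar' : ∀ v, pos' (par' v) = prv v.1 v.2 := by
    intro v
    by_cases h : prv v.1 v.2 = ρ
    · simp only [par', dif_pos h]; exact h.symm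
    · simp only [par', dif_neg h]; rfl
  have hleaf : ∀ j, pos (leaf j) = T.inLeg j := by
    intro j
    by_cases h : T.degOut (T.inLeg j) = 1
    · simp only [leaf, dif_pos h]; rfl
    · simp only [leaf, dif_neg h]; exact (hinLeg j h).symm
  have hleaf' : ∀ i, pos' (leaf' i) = T.outLeg i := by
    intro i
    by_cases h : T.outLeg i = ρ
    · simp only [leaf', dif_pos h]; exact h.symm
    · simp only [leaf', dif_neg h]; rfl
  -- Children in the forest correspond to inward half-edges in the tree, so the bound on the number
  -- of children follows from semistability.
  have hdeg : ∀ w : Option V, (Finset.univ.filter fun v => par v = w).card +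
      (Finset.univ.filter fun j => leaf j = w).card = T.degIn (pos w) := by
    intro w
    unfold degIn
    congr 1
    · refine Finset.card_bij (fun v _ => (v.1, pos w)) (fun v hv => ?_)
        (fun v _ v' _ h => Subtype.ext (Prod.ext_iff.1 h).1) fun e he => ?_
      · refine Finset.mem_filter.2 ⟨?_, rfl⟩
        rw [← (Finset.mem_filter.1 hv).2, hpar]
        exact hnxt _ _
      · obtain ⟨x, y⟩ := e
        obtain ⟨he, rfl⟩ := Finset.mem_filter.1 he
        have hx : T.degOut x = 1 := by
          cases w with
          | none => exact hin x he
          | some w =>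
            by_contra hx
            exact degOut_ne_of_edge hs hc he hx w.2
        refine ⟨⟨x, hx⟩, Finset.mem_filter.2 ⟨Finset.mem_univ _, hpos ?_⟩, rfl⟩
        rw [hpar]
        exact hnxt_eq hx he
    · congr 1
      ext j
      simp only [Finset.mem_filter, Finset.mem_univ, true_and]
      rw [← hleaf, hpos.eq_iff]
  have hdeg' : ∀ w : Option V', (Finset.univ.filter fun v => par' v = w).card +
      (Finset.univ.filter fun j => leaf' j = w).card = T.degOut (pos' w) := by
    intro w
    have hw : T.degOut (pos' w) ≠ 1 := by
      cases w with
      | none => exact hρ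
      | some w => exact w.2.1
    unfold degOut
    congr 1
    · refine Finset.card_bij (fun v _ => (pos' w, v.1)) (fun v hv => ?_)
        (fun v _ v' _ h => Subtype.ext (Prod.ext_iff.1 h).2) fun e he => ?_
      · refine Finset.mem_filter.2 ⟨?_, rfl⟩
        rw [← (Finset.mem_filter.1 hv).2, hpar']
        exact hprv _ _
      · obtain ⟨x, y⟩ := e
        obtain ⟨he, rfl⟩ := Finset.mem_filter.1 he
        have hy : T.degOut y ≠ 1 ∧ y ≠ ρ :=
          ⟨degOut_ne_of_edge hs hc he hw, fun h => hw (hin _ (h ▸ he))⟩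
        refine ⟨⟨y, hy⟩, Finset.mem_filter.2 ⟨Finset.mem_univ _, hpos' ?_⟩, rfl⟩
        rw [hpar']
        exact hprv_eq hy he
    · congr 1
      ext j
      simp only [Finset.mem_filter, Finset.mem_univ, true_and]
      rw [← hleaf', hpos'.eq_iff]
  have hpar_some : ∀ {v w : V}, par v = some w → nxt v.1 v.2 = w.1 := fun {v w} h => by
    rw [← hpar, h]; rfl
  have hpar_some' : ∀ {v w : V'}, par' v = some w → prv v.1 v.2 = w.1 := fun {v w} h => by
    rw [← hpar', h]; rfl
  -- The path to `ρ` is the chain of ancestors; induction along it proves accessibility.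
  have hwf : WellFounded fun w v => par v = some w := by
    have key : ∀ x, ReflTransGen (fun x y => (x, y) ∈ T.edges ∧ T.degOut x = 1) x ρ →
        ∀ hx, Acc (fun w v => par v = some w) (⟨x, hx⟩ : V) := by
      intro x hxρ
      induction hxρ using ReflTransGen.head_induction_on with
      | refl => exact fun hx => absurd hx hρ
      | @head a c h1 _ ih =>
        intro hx
        refine ⟨_, fun w hw => ?_⟩
        have h2 : c = w.1 := by
          rw [← hpar_some hw]
          exact (hnxt_eq hx h1.1).symm
        subst h2
        exact ih w.2
    refine ⟨fun v => key v.1 ?_ v.2⟩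
    rcases hreach v.1 with ⟨-, h⟩ | ⟨h, -⟩
    · exact h
    · exact absurd v.2 h
  have hwf' : WellFounded fun w v => par' v = some w := by
    have key : ∀ x, ReflTransGen (fun x y => (x, y) ∈ T.edges ∧ T.degOut x ≠ 1) ρ x →
        ∀ hx, Acc (fun w v => par' v = some w) (⟨x, hx⟩ : V') := by
      intro x hxρ
      induction hxρ with
      | refl => exact fun hx => absurd rfl hx.2
      | @tail b c _ h1 ih =>
        intro hx
        refine ⟨_, fun w hw => ?_⟩
        have h2 : b = w.1 := by
          rw [← hpar_some' hw]
          exact (hprv_eq hx h1.1).symm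
        subst h2
        exact ih w.2
    refine ⟨fun v => key v.1 ?_ v.2⟩
    rcases hreach v.1 with ⟨h, -⟩ | ⟨-, h⟩
    · exact absurd h v.2.1
    · exact h
  have hacyc : ∀ {X : Type} (p : X → Option X), (WellFounded fun w v => p v = some w) →
      ∀ v, ¬ TransGen (fun v w => p v = some w) v v := fun p hp v hv =>
    hp.transGen.irrefl.irrefl v (transGen_swap.1 hv)
  let f : Forest (Fin m) V := ⟨par, leaf, hacyc _ hwf, fun v => by
    rw [hdeg (some v)]
    have h1 := (hs v.1).2.2
    have h2 : T.degOut v.1 = 1 := v.2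
    change 2 ≤ T.degIn v.1
    omega⟩
  let f' : Forest (Fin k) V' := ⟨par', leaf', hacyc _ hwf', fun v => by
    rw [hdeg' (some v)]
    have h1 := (hs v.1).2.1
    have h2 : T.degOut v.1 ≠ 1 := v.2.1
    change 2 ≤ T.degOut v.1
    omega⟩
  let P : Option (V ⊕ V') → Fin T.numV := fun u => u.elim ρ (Sum.elim Subtype.val Subtype.val)
  have hP1 : ∀ w : Option V, P (w.map .inl) = pos w := fun w => by cases w <;> rfl
  have hP2 : ∀ w : Option V', P (w.map .inr) = pos' w := fun w => by cases w <;> rfl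
  have hPinj : Function.Injective P := by
    rintro (_ | v | v) (_ | w | w) h
    · rfl
    · exact absurd ((show ρ = w.1 from h) ▸ w.2) hρ
    · exact absurd (show ρ = w.1 from h).symm w.2.2
    · exact absurd ((show v.1 = ρ from h) ▸ v.2) hρ
    · rw [Subtype.ext (show v.1 = w.1 from h)]
    · exact absurd ((show v.1 = w.1 from h) ▸ v.2) w.2.1
    · exact absurd (show v.1 = ρ from h) v.2.2
    · exact absurd ((show v.1 = w.1 from h) ▸ w.2) v.2.1
    · rw [Subtype.ext (show v.1 = w.1 from h)]
  have hPsurj : Function.Surjective P := by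
    intro v
    by_cases h : T.degOut v = 1
    · exact ⟨some (.inl ⟨v, h⟩), rfl⟩
    · by_cases hv : v = ρ
      · exact ⟨none, hv.symm⟩
      · exact ⟨some (.inr ⟨v, h, hv⟩), rfl⟩
  refine ⟨V, V', inferInstance, inferInstance, inferInstance, inferInstance, f, f', ?_,
    ⟨⟨Equiv.ofBijective P ⟨hPinj, hPsurj⟩, fun u v => ?_, fun j => ?_, fun i => ?_⟩⟩⟩
  · have h1 : f'.deg none = T.degOut ρ := hdeg' none
    have h2 := (hs ρ).2.1
    omega
  · change (P u, P v) ∈ T.edges ↔ _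
    constructor
    · intro h
      by_cases hu : T.degOut (P u) = 1
      · left
        rcases u with _ | p | q
        · exact absurd hu hρ
        · refine ⟨p, rfl, hPinj ?_⟩
          rw [hP1]
          exact (hnxt_eq hu h).symm.trans (hpar p).symm
        · exact absurd hu q.2.1
      · right
        have hv := degOut_ne_of_edge hs hc h hu
        rcases v with _ | p | q
        · exact absurd (hin _ h) hu
        · exact absurd p.2 hv
        · refine ⟨q, rfl, hPinj ?_⟩
          rw [hP2]
          exact (hprv_eq q.2 h).symm.trans (hpar' q).symm
    · rintro (⟨p, rfl, rfl⟩ | ⟨q, rfl, rfl⟩)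
      · rw [hP1]
        exact (hpar p).symm ▸ hnxt p.1 p.2
      · rw [hP2]
        exact (hpar' q).symm ▸ hprv q.1 q.2
  · exact (hleaf j).symm.trans (hP1 _).symm
  · exact (hleaf' i).symm.trans (hP2 _).symm

end DecoratedTree

end KahlerTree

end

noncomputable section

namespace KahlerTree

set_option linter.unusedSectionVars false

open Relation

/-! ### The value of a forest -/

namespace Forest

variable {ι V κ : Type} [Fintype ι] [DecidableEq ι] [Fintype V] [DecidableEq V]

/-- The labels of the children of a vertex, or of the root. -/
def labels (f : Forest ι V) (x : V → κ) (b : ι → κ) (w : Option V) : Multiset κ :=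
  (∑ v with f.par v = w, {x v}) + ∑ j with f.leaf j = w, {b j}

/-- The value of a forest: the sum over all labellings of the vertices. -/
def val (f : Forest ι V) [Fintype κ] (M : κ → Multiset κ → ℂ) (b : ι → κ)
    (F : Multiset κ → ℂ) : ℂ :=
  ∑ x : V → κ, (∏ v, -M (x v) (f.labels x b (some v))) * F (f.labels x b none)

end Forest

/-- The laminar families with the property `Q`. -/
structure LaminarFamily (ι : Type) [Fintype ι] [DecidableEq ι]
    (Q : Finset (Finset ι) → Prop) where
  /-- the members of the family -/
  sets : Finset (Finset ι)
  isLaminar : IsLaminar sets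
  prop : Q sets

section LaminarSum

variable {ι κ : Type} [Fintype ι] [DecidableEq ι] {L : Finset (Finset ι)}

theorem LaminarFamily.ext {Q : Finset (Finset ι) → Prop} {L L' : LaminarFamily ι Q}
    (h : L.sets = L'.sets) : L = L' := by
  cases L
  cases L'
  cases h
  rfl

instance LaminarFamily.fintype (Q : Finset (Finset ι) → Prop) : Fintype (LaminarFamily ι Q) :=
  have : Finite (LaminarFamily ι Q) := Finite.of_injective sets fun _ _ => LaminarFamily.ext
  Fintype.ofFinite _

/-- The graph of a labelling of a family of sets. -/
def graph [DecidableEq κ] (x : L → κ) : Finset (Finset ι × κ) :=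
  Finset.univ.image fun c => (c.1, x c)

variable [DecidableEq κ]

theorem mem_graph {x : L → κ} {p : Finset ι × κ} : p ∈ graph x ↔ ∃ c : L, (c.1, x c) = p := by
  simp [graph]

theorem graph_injective_aux (x : L → κ) :
    Function.Injective fun c : L => (c.1, x c) := fun _ _ h => Subtype.ext (Prod.ext_iff.1 h).1

theorem forall_mem_graph {x : L → κ} {P : Finset ι × κ → Prop} :
    (∀ e ∈ graph x, P e) ↔ ∀ c : L, P (c.1, x c) := by
  simp only [mem_graph, forall_exists_index, forall_apply_eq_imp_iff]

theorem isHierarchy_graph (hL : IsLaminar L) (x : L → κ) :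
    IsHierarchy Finset.univ (graph x) := by
  refine ⟨fun p _ => Finset.subset_univ _, ?_, ?_, ?_⟩
  · exact forall_mem_graph.2 fun c => hL.two_le c.1 c.2
  · refine forall_mem_graph.2 fun c => forall_mem_graph.2 fun d h => ?_
    rw [Subtype.ext h]
  · exact forall_mem_graph.2 fun c => forall_mem_graph.2 fun d => hL.laminar _ c.2 _ d.2

theorem isPar_graph {x : L → κ} {s : Finset ι} {d : L} :
    IsPar (graph x) s d.1 ↔ up L s = some d := by
  rw [up_eq_some, IsPar, IsUp, forall_mem_graph]
  exact and_congr_right fun _ => Subtype.forall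

theorem top_graph (hL : IsLaminar L) {x : L → κ} {s : Finset ι} (hs : s.Nonempty) :
    (∀ e ∈ graph x, ¬ s ⊂ e.1) ↔ up L s = none := by
  rw [hL.up_eq_none hs, forall_mem_graph]
  exact Subtype.forall

theorem sum_filter_graph (x : L → κ) (P : Finset ι × κ → Prop) [DecidablePred P]
    {Q : L → Prop} [DecidablePred Q] (h : ∀ c, P (c.1, x c) ↔ Q c) :
    (∑ q ∈ graph x with P q, {q.2} : Multiset κ) = ∑ c with Q c, {x c} := by
  rw [graph, Finset.filter_image, Finset.sum_image (graph_injective_aux x).injOn]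
  exact Finset.sum_congr (Finset.filter_congr fun c _ => h c) fun _ _ => rfl

theorem childLabels_graph (hL : IsLaminar L) (b : ι → κ) (x : L → κ) (d : L) :
    childLabels b (graph x) d.1 = hL.forest.labels x b (some d) := by
  classical
  unfold childLabels Forest.labels
  congr 1
  · rw [sum_filter_graph x _ fun c => isPar_graph]
    exact Finset.sum_congr (Finset.filter_congr fun _ _ => Iff.rfl) fun _ _ => rfl
  · refine Finset.sum_congr ?_ fun _ _ => rfl
    ext j
    simp only [Finset.mem_filter, Finset.mem_univ, true_and, isPar_graph]
    exact ⟨fun h => h.2, fun h => ⟨Finset.singleton_subset_iff.1 (up_eq_some.1 h).1.1, h⟩⟩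

theorem topLabels_graph (hL : IsLaminar L) (b : ι → κ) (x : L → κ) :
    topLabels b (graph x) Finset.univ = hL.forest.labels x b none := by
  classical
  unfold topLabels Forest.labels
  congr 1
  · rw [sum_filter_graph x _ fun c => top_graph hL (hL.nonempty c.2)]
    exact Finset.sum_congr (Finset.filter_congr fun _ _ => Iff.rfl) fun _ _ => rfl
  · refine Finset.sum_congr ?_ fun _ _ => rfl
    ext j
    simp only [Finset.mem_filter, Finset.mem_univ, true_and,
      top_graph hL (Finset.singleton_nonempty j)]
    exact Iff.rfl

theorem weight_graph (hL : IsLaminar L) (M : κ → Multiset κ → ℂ) (b : ι → κ) (x : L → κ) :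
    weight M b (graph x) = ∏ c, -M (x c) (hL.forest.labels x b (some c)) := by
  rw [weight, graph, Finset.prod_image (graph_injective_aux x).injOn]
  exact Finset.prod_congr rfl fun c _ => by rw [← childLabels_graph]; rfl

variable [Fintype κ]

/-- Summation over labelled hierarchies is summation over laminar families and labellings. -/
theorem sum_hierarchies (Q : Finset (Finset ι) → Prop) (φ : Finset (Finset ι × κ) → ℂ)
    {P : Finset (Finset ι × κ) → Prop} [DecidablePred P] (hP : ∀ H, P H ↔ Q (H.image Prod.fst)) :
    ∑ H ∈ hierarchies κ (Finset.univ : Finset ι) with P H, φ H =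
      ∑ L : LaminarFamily ι Q, ∑ x : L.sets → κ, φ (graph x) := by
  rw [← Fintype.sum_sigma']
  have himg : ∀ {L : Finset (Finset ι)} (x : L → κ), (graph x).image Prod.fst = L := by
    intro L x
    ext c
    simp [graph]
  symm
  refine Finset.sum_bij (fun z _ => graph z.2) ?_ ?_ ?_ fun _ _ => rfl
  · rintro ⟨L, x⟩ _
    refine Finset.mem_filter.2 ⟨mem_hierarchies.2 (isHierarchy_graph L.isLaminar x), ?_⟩
    rw [hP, himg]
    exact L.prop
  · rintro ⟨⟨L, hL, hQ⟩, x⟩ _ ⟨⟨L', hL', hQ'⟩, x'⟩ _ h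
    have h1 : graph x = graph x' := h
    obtain rfl : L = L' := (himg x).symm.trans ((congrArg _ h1).trans (himg x'))
    have h2 : x = x' := by
      funext c
      have : (c.1, x c) ∈ graph x' := h1 ▸ mem_graph.2 ⟨c, rfl⟩
      obtain ⟨d, hd⟩ := mem_graph.1 this
      obtain rfl : d = c := Subtype.ext (Prod.ext_iff.1 hd).1
      exact (Prod.ext_iff.1 hd).2.symm
    rw [h2]
  · intro H hH
    obtain ⟨hH, hQ⟩ := Finset.mem_filter.1 hH
    rw [hP] at hQ
    have h := mem_hierarchies.1 hH
    have h1 : ∀ c : H.image Prod.fst, ∃ y, (c.1, y) ∈ H := fun c => by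
      obtain ⟨p, hp, hpc⟩ := Finset.mem_image.1 c.2
      exact ⟨p.2, hpc ▸ hp⟩
    choose x hx using h1
    have hlam : IsLaminar (H.image Prod.fst) := by
      refine ⟨?_, ?_⟩
      · simp only [Finset.forall_mem_image]
        exact fun p hp => h.two_le p hp
      · simp only [Finset.forall_mem_image]
        exact fun p hp q hq => h.laminar p hp q hq
    refine ⟨⟨⟨_, hlam, hQ⟩, x⟩, Finset.mem_univ _, ?_⟩
    ext p
    rw [mem_graph]
    constructor
    · rintro ⟨c, rfl⟩
      exact hx c
    · intro hp
      refine ⟨⟨p.1, Finset.mem_image_of_mem _ hp⟩, ?_⟩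
      exact h.inj _ (hx _) _ hp rfl

theorem forestSum_eq_sum_val (M : κ → Multiset κ → ℂ) (b : ι → κ) (F : Multiset κ → ℂ) :
    forestSum M b F Finset.univ =
      ∑ L : LaminarFamily ι fun _ => True, L.isLaminar.forest.val M b F := by
  have h := sum_hierarchies (ι := ι) (κ := κ) (fun _ => True)
    (fun H => weight M b H * F (topLabels b H Finset.univ)) (P := fun _ => True) fun _ => Iff.rfl
  rw [Finset.filter_true] at h
  rw [forestSum, h]
  refine Finset.sum_congr rfl fun L _ => Finset.sum_congr rfl fun x _ => ?_
  rw [weight_graph L.isLaminar, topLabels_graph L.isLaminar]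

theorem properForestSum_eq_sum_val (M : κ → Multiset κ → ℂ) (b : ι → κ) (F : Multiset κ → ℂ) :
    properForestSum M b F Finset.univ =
      ∑ L : LaminarFamily ι fun L => Finset.univ ∉ L, L.isLaminar.forest.val M b F := by
  rw [properForestSum, sum_hierarchies fun L => Finset.univ ∉ L]
  · refine Finset.sum_congr rfl fun L _ => Finset.sum_congr rfl fun x _ => ?_
    rw [weight_graph L.isLaminar, topLabels_graph L.isLaminar]
  · intro H
    simp only [Finset.mem_image, not_exists, not_and]

end LaminarSum

/-! ### The polynomial of a tree -/

section Poly

variable {n k m : ℕ}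

/-- The value of a vertex with one outward half-edge, together with its outgoing edge. -/
def outVertex (val : MetricVar n → ℂ) (s : Fin n) (β : Multiset (Fin n)) : ℂ :=
  ∑ r, val (.inv r s) * val (.deriv {r} β)

/-- The value of a vertex with one inward half-edge, together with its incoming edge. -/
def inVertex (val : MetricVar n → ℂ) (r : Fin n) (α : Multiset (Fin n)) : ℂ :=
  ∑ s, val (.inv r s) * val (.deriv α {s})

namespace Presents

variable {V V' : Type} [Fintype V] [DecidableEq V] [Fintype V'] [DecidableEq V']
  {T : DecoratedTree k m} {f : Forest (Fin m) V} {f' : Forest (Fin k) V'} (h : Presents T f f')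

/-- The edges correspond to the vertices other than the root. -/
def edgeEquiv : V ⊕ V' ≃ T.edges :=
  Equiv.ofBijective
    (Sum.elim
      (fun p => ⟨(h.equiv (some (.inl p)), h.equiv ((f.par p).map .inl)),
        (h.edge _ _).2 (Or.inl ⟨p, rfl, rfl⟩)⟩)
      fun q => ⟨(h.equiv ((f'.par q).map .inr), h.equiv (some (.inr q))),
        (h.edge _ _).2 (Or.inr ⟨q, rfl, rfl⟩)⟩) (by
    constructor
    · rintro (p | q) (p' | q') hpq
      · have h1 := h.equiv.injective (Prod.ext_iff.1 (congrArg Subtype.val hpq)).1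
        exact Option.some_injective _ h1
      · have h1 := h.equiv.injective (Prod.ext_iff.1 (congrArg Subtype.val hpq)).1
        exact absurd h1.symm (map_inr_ne_inl _ _)
      · have h1 := h.equiv.injective (Prod.ext_iff.1 (congrArg Subtype.val hpq)).1
        exact absurd h1 (map_inr_ne_inl _ _)
      · have h1 := h.equiv.injective (Prod.ext_iff.1 (congrArg Subtype.val hpq)).2
        exact Option.some_injective _ h1
    · rintro ⟨⟨x, y⟩, he⟩
      obtain ⟨u, rfl⟩ := h.equiv.surjective x
      obtain ⟨v, rfl⟩ := h.equiv.surjective y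
      rcases (h.edge _ _).1 he with ⟨p, rfl, rfl⟩ | ⟨q, rfl, rfl⟩
      · exact ⟨.inl p, rfl⟩
      · exact ⟨.inr q, rfl⟩)

theorem outIndices_inl (r : T.edges → Fin n) (a : Fin k → Fin n) (p : V) :
    T.outIndices r a (h.equiv (some (.inl p))) = {r (h.edgeEquiv (.inl p))} := by
  unfold DecoratedTree.outIndices
  rw [Finset.filter_false_of_mem (s := (Finset.univ : Finset (Fin k))), Finset.sum_empty, add_zero, Finset.sum_filter,
    ← h.edgeEquiv.sum_comp, Fintype.sum_sum_type]
  · have h1 : ∀ p', (h.edgeEquiv (.inl p')).1.1 = h.equiv (some (.inl p)) ↔ p' = p := fun p' => by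
      change h.equiv (some (.inl p')) = _ ↔ _
      rw [h.equiv.injective.eq_iff, Option.some_inj, Sum.inl.injEq]
    have h2 : ∀ q, (h.edgeEquiv (.inr q)).1.1 = h.equiv (some (.inl p)) ↔ False := fun q => by
      change h.equiv ((f'.par q).map .inr) = _ ↔ _
      rw [h.equiv.injective.eq_iff, iff_false]
      exact map_inr_ne_inl _ _
    simp only [h1, h2, if_false, Finset.sum_const_zero, add_zero, Finset.sum_ite_eq',
      Finset.mem_univ, if_true]
  · intro i _ hi
    rw [h.outLeg] at hi
    exact map_inr_ne_inl _ _ (h.equiv.injective hi)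

theorem inIndices_inr (s : T.edges → Fin n) (b : Fin m → Fin n) (q : V') :
    T.inIndices s b (h.equiv (some (.inr q))) = {s (h.edgeEquiv (.inr q))} := by
  unfold DecoratedTree.inIndices
  rw [Finset.filter_false_of_mem (s := (Finset.univ : Finset (Fin m))), Finset.sum_empty, add_zero, Finset.sum_filter,
    ← h.edgeEquiv.sum_comp, Fintype.sum_sum_type]
  · have h1 : ∀ q', (h.edgeEquiv (.inr q')).1.2 = h.equiv (some (.inr q)) ↔ q' = q := fun q' => by
      change h.equiv (some (.inr q')) = _ ↔ _
      rw [h.equiv.injective.eq_iff, Option.some_inj, Sum.inr.injEq]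
    have h2 : ∀ p, (h.edgeEquiv (.inl p)).1.2 = h.equiv (some (.inr q)) ↔ False := fun p => by
      change h.equiv ((f.par p).map .inl) = _ ↔ _
      rw [h.equiv.injective.eq_iff, iff_false]
      exact map_inl_ne_inr _ _
    simp only [h1, h2, if_false, Finset.sum_const_zero, zero_add, Finset.sum_ite_eq',
      Finset.mem_univ, if_true]
  · intro i _ hi
    rw [h.inLeg] at hi
    exact map_inl_ne_inr _ _ (h.equiv.injective hi)

theorem outIndices_map_inr (r : T.edges → Fin n) (a : Fin k → Fin n) (w : Option V') :
    T.outIndices r a (h.equiv (w.map .inr)) =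
      f'.labels (fun q => r (h.edgeEquiv (.inr q))) a w := by
  unfold DecoratedTree.outIndices Forest.labels
  congr 1
  · rw [Finset.sum_filter, Finset.sum_filter, ← h.edgeEquiv.sum_comp, Fintype.sum_sum_type]
    have h1 : ∀ p, (h.edgeEquiv (.inl p)).1.1 = h.equiv (w.map .inr) ↔ False := fun p => by
      change h.equiv (some (.inl p)) = _ ↔ _
      rw [h.equiv.injective.eq_iff, iff_false]
      exact fun h => map_inr_ne_inl _ _ h.symm
    have h2 : ∀ q, (h.edgeEquiv (.inr q)).1.1 = h.equiv (w.map .inr) ↔ f'.par q = w := fun q => by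
      change h.equiv ((f'.par q).map .inr) = _ ↔ _
      rw [h.equiv.injective.eq_iff]
      exact (Option.map_injective Sum.inr_injective).eq_iff
    simp only [h1, h2, if_false, Finset.sum_const_zero, zero_add]
  · refine Finset.sum_congr (Finset.filter_congr fun i _ => ?_) fun _ _ => rfl
    rw [h.outLeg, h.equiv.injective.eq_iff]
    exact (Option.map_injective Sum.inr_injective).eq_iff

theorem inIndices_map_inl (s : T.edges → Fin n) (b : Fin m → Fin n) (w : Option V) :
    T.inIndices s b (h.equiv (w.map .inl)) =
      f.labels (fun p => s (h.edgeEquiv (.inl p))) b w := by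
  unfold DecoratedTree.inIndices Forest.labels
  congr 1
  · rw [Finset.sum_filter, Finset.sum_filter, ← h.edgeEquiv.sum_comp, Fintype.sum_sum_type]
    have h1 : ∀ q, (h.edgeEquiv (.inr q)).1.2 = h.equiv (w.map .inl) ↔ False := fun q => by
      change h.equiv (some (.inr q)) = _ ↔ _
      rw [h.equiv.injective.eq_iff, iff_false]
      exact fun h => map_inl_ne_inr _ _ h.symm
    have h2 : ∀ p, (h.edgeEquiv (.inl p)).1.2 = h.equiv (w.map .inl) ↔ f.par p = w := fun p => by
      change h.equiv ((f.par p).map .inl) = _ ↔ _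
      rw [h.equiv.injective.eq_iff]
      exact (Option.map_injective Sum.inl_injective).eq_iff
    simp only [h1, h2, if_false, Finset.sum_const_zero, add_zero]
  · refine Finset.sum_congr (Finset.filter_congr fun i _ => ?_) fun _ _ => rfl
    rw [h.inLeg, h.equiv.injective.eq_iff]
    exact (Option.map_injective Sum.inl_injective).eq_iff

include h

theorem numV_eq : T.numV = Fintype.card V + Fintype.card V' + 1 := by
  have := Fintype.card_congr h.equiv
  rw [Fintype.card_option, Fintype.card_sum, Fintype.card_fin] at this
  exact this.symm

/-- Each edge is charged to its endpoint farther from the root. The index at that endpoint is summed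
within `outVertex` or `inVertex`; the index at the other end becomes the label that the vertex shows
to its parent. -/
theorem eval_poly (val : MetricVar n → ℂ) (a : Fin k → Fin n) (b : Fin m → Fin n) :
    MvPolynomial.eval val (T.poly a b) =
      ∑ y : V' → Fin n, ∑ x : V → Fin n, (∏ q, inVertex val (y q) (f'.labels y a (some q))) *
        ((∏ p, outVertex val (x p) (f.labels x b (some p))) *
          val (.deriv (f'.labels y a none) (f.labels x b none))) := by
  have hI : ∀ y : V' → Fin n, (∏ q, inVertex val (y q) (f'.labels y a (some q))) =
      ∑ s : V' → Fin n, ∏ q, val (.inv (y q) (s q)) * val (.deriv (f'.labels y a (some q)) {s q}) :=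
    fun y => by simp only [inVertex, Fintype.prod_sum]
  have hO : ∀ x : V → Fin n, (∏ p, outVertex val (x p) (f.labels x b (some p))) =
      ∑ r : V → Fin n, ∏ p, val (.inv (r p) (x p)) * val (.deriv {r p} (f.labels x b (some p))) :=
    fun x => by simp only [outVertex, Fintype.prod_sum]
  let e : (T.edges → Fin n) ≃ (V → Fin n) × (V' → Fin n) :=
    (h.edgeEquiv.arrowCongr (Equiv.refl (Fin n))).symm.trans
      (Equiv.sumArrowEquivProdArrow V V' (Fin n))
  have hsum : ∀ φ : (V → Fin n) → (V' → Fin n) → ℂ,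
      ∑ r : T.edges → Fin n, φ (fun p => r (h.edgeEquiv (.inl p)))
        (fun q => r (h.edgeEquiv (.inr q))) = ∑ r₁, ∑ r₂, φ r₁ r₂ := fun φ => by
    rw [← Fintype.sum_prod_type']
    exact Fintype.sum_equiv e _ _ fun r => rfl
  unfold DecoratedTree.poly
  simp only [map_sum, map_mul, map_prod, MvPolynomial.eval_X]
  let Φ : (V → Fin n) → (V' → Fin n) → (V → Fin n) → (V' → Fin n) → ℂ := fun r₁ r₂ s₁ s₂ =>
    (∏ q, val (.inv (r₂ q) (s₂ q)) * val (.deriv (f'.labels r₂ a (some q)) {s₂ q})) *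
      ((∏ p, val (.inv (r₁ p) (s₁ p)) * val (.deriv {r₁ p} (f.labels s₁ b (some p)))) *
        val (.deriv (f'.labels r₂ a none) (f.labels s₁ b none)))
  have hterm : ∀ r s : T.edges → Fin n,
      (∏ e, val (.inv (r e) (s e))) *
        ∏ v, val (.deriv (T.outIndices r a v) (T.inIndices s b v)) =
      Φ (fun p => r (h.edgeEquiv (.inl p))) (fun q => r (h.edgeEquiv (.inr q)))
        (fun p => s (h.edgeEquiv (.inl p))) (fun q => s (h.edgeEquiv (.inr q))) := by
    intro r s
    rw [← h.edgeEquiv.prod_comp, ← h.equiv.prod_comp, Fintype.prod_option, Fintype.prod_sum_type,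
      Fintype.prod_sum_type]
    have h1 := h.outIndices_map_inr r a
    have h2 := h.inIndices_map_inl s b
    have h3 := h1 none
    have h4 := h2 none
    simp only [Option.map_none] at h3 h4
    have h5 := fun q => h1 (some q)
    have h6 := fun p => h2 (some p)
    simp only [Option.map_some] at h5 h6
    simp only [Φ, h3, h4, h5, h6, h.outIndices_inl, h.inIndices_inr, Finset.prod_mul_distrib]
    ring
  simp only [hterm]
  rw [Finset.sum_congr rfl fun r _ => hsum (Φ _ _),
    hsum fun r₁ r₂ => ∑ s₁, ∑ s₂, Φ r₁ r₂ s₁ s₂]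
  simp only [hI, hO, Finset.sum_mul, Finset.mul_sum]
  rw [Finset.sum_comm]
  refine Finset.sum_congr rfl fun r₂ _ => ?_
  rw [Finset.sum_comm]

/-- The sign `(-1)^(|V(T)| + 1)` is one factor `-1` for each vertex other than the root, which is
the sign convention of `Forest.val`. -/
theorem eval_signed (val : MetricVar n → ℂ) (a : Fin k → Fin n) (b : Fin m → Fin n) :
    (-1) ^ (T.numV + 1) * MvPolynomial.eval val (T.poly a b) =
      f'.val (inVertex val) a fun α => f.val (outVertex val) b fun β => val (.deriv α β) := by
  rw [h.eval_poly, h.numV_eq]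
  simp only [Forest.val, Finset.mul_sum]
  refine Finset.sum_congr rfl fun y _ => Finset.sum_congr rfl fun x _ => ?_
  simp only [Finset.prod_neg, Finset.card_univ]
  ring

end Presents

theorem eval_signedPoly (val : MetricVar n → ℂ) (T : ContractibleTree k m) (a : Fin k → Fin n)
    (b : Fin m → Fin n) :
    MvPolynomial.eval val (TreeClass.signedPoly (⟦T⟧ : TreeClass k m) a b) =
      (-1) ^ (T.1.numV + 1) * MvPolynomial.eval val (T.1.poly a b) := by
  change MvPolynomial.eval val ((-1) ^ (T.1.numV + 1) * T.1.poly a b) = _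
  simp

open Classical in
/-- The tree sum as a sum over pairs of hierarchies. -/
theorem eval_treeSum (hk : 2 ≤ k) [NeZero m] (val : MetricVar n → ℂ) (a : Fin k → Fin n)
    (b : Fin m → Fin n) :
    MvPolynomial.eval val (treeSum n k m a b) =
      properForestSum (inVertex val) a (fun α =>
        forestSum (outVertex val) b (fun β => val (.deriv α β)) Finset.univ) Finset.univ := by
  rw [properForestSum_eq_sum_val]
  simp only [forestSum_eq_sum_val]
  have hval : ∀ L' : (LaminarFamily (Fin k) fun L => Finset.univ ∉ L),
      (L'.isLaminar.forest.val (inVertex val) a fun α =>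
        ∑ L : (LaminarFamily (Fin m) fun _ => True),
          L.isLaminar.forest.val (outVertex val) b fun β => val (.deriv α β)) =
      ∑ L : (LaminarFamily (Fin m) fun _ => True),
        L'.isLaminar.forest.val (inVertex val) a fun α =>
          L.isLaminar.forest.val (outVertex val) b fun β => val (.deriv α β) := fun L' => by
    rw [Forest.val]
    simp only [Finset.mul_sum]
    rw [Finset.sum_comm]
    rfl
  simp only [hval]
  rw [← Fintype.sum_prod_type', treeSum, map_sum]
  -- A family without the full set of unbarred legs has a root with at least two children, as
  -- required for the gluing to determine its forests.
  have hdeg : ∀ L' : (LaminarFamily (Fin k) fun L => Finset.univ ∉ L),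
      2 ≤ L'.isLaminar.forest.deg none := fun L' =>
    L'.isLaminar.two_le_rootDeg L'.prop (by rwa [Fintype.card_fin])
  have hex : ∀ z : (LaminarFamily (Fin k) fun L => Finset.univ ∉ L) ×
      (LaminarFamily (Fin m) fun _ => True), ∃ T : ContractibleTree k m,
      Nonempty (Presents T.1 z.2.isLaminar.forest z.1.isLaminar.forest) := fun z => by
    obtain ⟨T, ⟨h⟩⟩ := exists_presents z.2.isLaminar.forest z.1.isLaminar.forest
    exact ⟨⟨T, h.isSemistable (hdeg z.1), h.isContractible⟩, ⟨h⟩⟩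
  choose tree htree using hex
  symm
  refine Fintype.sum_bijective (fun z => (⟦tree z⟧ : TreeClass k m)) ⟨?_, ?_⟩ _ _ fun z => ?_
  -- Isomorphic gluings have the same clusters, and these are the laminar families themselves.
  · rintro ⟨L₁, L₂⟩ ⟨L₁', L₂'⟩ heq
    have hiso : (tree (L₁, L₂)).1.Iso (tree (L₁', L₂')).1 := Quotient.exact heq
    obtain ⟨h1⟩ := htree (L₁, L₂)
    obtain ⟨h2⟩ := htree (L₁', L₂')
    obtain ⟨h1⟩ := h1.nonempty_of_iso hiso
    have h3 := h1.clusters_eq h2 (hdeg L₁) (hdeg L₁')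
    simp only [IsLaminar.forest_clusters] at h3
    exact Prod.ext (LaminarFamily.ext h3.2) (LaminarFamily.ext h3.1)
  · intro c
    induction c using Quotient.inductionOn with
    | _ T =>
      obtain ⟨V, V', _, _, _, _, f, f', hr, ⟨h⟩⟩ :=
        DecoratedTree.exists_forests T.2.1 T.2.2 hk
      -- The preimage of a tree consists of the cluster families of the two forests into which it
      -- decomposes.
      let z : (LaminarFamily (Fin k) fun L => Finset.univ ∉ L) ×
          (LaminarFamily (Fin m) fun _ => True) :=
        (⟨f'.clusters, f'.isLaminar_clusters, fun h1 => by
          obtain ⟨v, hv⟩ := Forest.mem_clusters.1 h1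
          exact Forest.cluster_ne_univ hr v hv⟩, ⟨f.clusters, f.isLaminar_clusters, trivial⟩)
      refine ⟨z, Quotient.sound ?_⟩
      obtain ⟨h'⟩ := htree z
      exact h'.iso h (IsLaminar.forest_clusters _) (IsLaminar.forest_clusters _)
  · obtain ⟨h⟩ := htree z
    rw [eval_signedPoly, h.eval_signed]

end Poly

end KahlerTree

end

noncomputable section

namespace KahlerTree

/-! ### Holomorphic functions of several variables are smooth -/

section Holomorphic

open MeasureTheory Metric

variable {E : Type*} [NormedAddCommGroup E] [NormedSpace ℂ E]

/-- By continuity `f` stays within distance `1` of `f z` on a ball, so it varies by less than `2`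
there, and the Cauchy estimate bounds the derivative uniformly on the ball of half the radius. -/
theorem exists_norm_fderiv_le {f : E → ℂ} {U : Set E} (hU : IsOpen U)
    (hf : DifferentiableOn ℂ f U) {z : E} (hz : z ∈ U) :
    ∃ R > 0, ball z R ⊆ U ∧ ∃ C, ∀ x ∈ ball z R, ‖fderiv ℂ f x‖ ≤ C := by
  have hc : ContinuousAt f z := (hf.continuousOn).continuousAt (hU.mem_nhds hz)
  have h1 : f ⁻¹' ball (f z) 1 ∩ U ∈ nhds z :=
    Filter.inter_mem (hc (ball_mem_nhds _ one_pos)) (hU.mem_nhds hz)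
  obtain ⟨R, hR, hRU⟩ := Metric.mem_nhds_iff.1 h1
  refine ⟨R / 2, half_pos hR, (ball_subset_ball (by linarith)).trans
    (hRU.trans Set.inter_subset_right), 2 / (R / 2), fun x hx => ?_⟩
  have hsub : ball x (R / 2) ⊆ ball z R := ball_subset_ball' (by
    rw [mem_ball] at hx; linarith)
  refine Complex.norm_fderiv_le_div_of_mapsTo_ball
    (hf.mono (hsub.trans (hRU.trans Set.inter_subset_right))) (fun y hy => ?_) (half_pos hR)
  have h2 : dist (f y) (f z) < 1 := (hRU (hsub hy)).1
  have h3 : dist (f x) (f z) < 1 := (hRU (ball_subset_ball (by linarith) hx)).1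
  rw [mem_closedBall]
  linarith [dist_triangle_right (f y) (f x) (f z)]

variable [FiniteDimensional ℂ E]

/-- Cauchy's formula on the complex line through `x` in the direction `v` writes the directional
derivative as an integral of values of `f` over a circle. The integral can be differentiated in `x`,
with `exists_norm_fderiv_le` providing the dominating bound. -/
theorem differentiableOn_fderiv_apply {f : E → ℂ} {U : Set E} (hU : IsOpen U)
    (hf : DifferentiableOn ℂ f U) (v : E) :
    DifferentiableOn ℂ (fun z => fderiv ℂ f z v) U := by
  intro z hz
  obtain ⟨R, hR, hRU, C, hC⟩ := exists_norm_fderiv_le hU hf hz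
  -- The circle `x + ζ v`, `|ζ| = r`, must stay in the ball of radius `R` for `x` in the ball of
  -- radius `R / 2`; the summand `1` covers `v = 0`.
  set r : ℝ := R / (2 * (‖v‖ + 1)) with hr
  have hv : 0 < ‖v‖ + 1 := by positivity
  have hr0 : 0 < r := by positivity
  have hrv : r * ‖v‖ < R / 2 := by
    have : r * (‖v‖ + 1) = R / 2 := by rw [hr]; field_simp
    nlinarith
  have hmem : ∀ x ∈ ball z (R / 2), ∀ ζ : ℂ, ‖ζ‖ ≤ r → x + ζ • v ∈ ball z R := by
    intro x hx ζ hζ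
    rw [mem_ball, dist_eq_norm] at hx ⊢
    have h1 : ‖ζ • v‖ ≤ r * ‖v‖ := by
      rw [norm_smul]; exact mul_le_mul_of_nonneg_right hζ (norm_nonneg _)
    calc ‖x + ζ • v - z‖ = ‖(x - z) + ζ • v‖ := by congr 1; abel
      _ ≤ ‖x - z‖ + ‖ζ • v‖ := norm_add_le _ _
      _ < R := by linarith
  have hdf : ∀ y ∈ ball z R, HasFDerivAt f (fderiv ℂ f y) y := fun y hy =>
    (hf.differentiableAt (hU.mem_nhds (hRU hy))).hasFDerivAt
  set w : ℝ → ℂ := fun θ => deriv (circleMap 0 r) θ * ((circleMap 0 r θ - 0) ^ 2)⁻¹ with hw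
  have hcm : ∀ θ, circleMap 0 r θ ≠ 0 := fun θ => circleMap_ne_center hr0.ne'
  have hnm : ∀ θ, ‖circleMap 0 r θ‖ ≤ r := fun θ => by simp [abs_of_pos hr0]
  have hwc : Continuous w := by
    simp only [hw, deriv_circleMap]
    refine Continuous.mul (by fun_prop) (Continuous.inv₀ (by fun_prop) fun θ => ?_)
    simpa using hcm θ
  have hwn : ∀ θ, ‖w θ‖ = r⁻¹ := fun θ => by
    simp [hw, abs_of_pos hr0]
    field_simp
  have hint : ∀ x ∈ ball z (R / 2), fderiv ℂ f x v = (2 * Real.pi * Complex.I : ℂ)⁻¹ *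
      ∫ θ in (0)..2 * Real.pi, w θ * f (x + circleMap 0 r θ • v) := by
    intro x hx
    have hg : ∀ ζ : ℂ, ‖ζ‖ ≤ r → HasDerivAt (fun ζ : ℂ => f (x + ζ • v))
        (fderiv ℂ f (x + ζ • v) v) ζ := fun ζ hζ => by
      have h1 : HasDerivAt (fun ζ : ℂ => x + ζ • v) v ζ := by
        simpa using ((hasDerivAt_id ζ).smul_const v).const_add x
      exact (hdf _ (hmem x hx ζ hζ)).comp_hasDerivAt ζ h1
    have h0 := (hg 0 (by simpa using hr0.le)).deriv
    rw [zero_smul, add_zero] at h0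
    rw [← h0]
    have hd : DifferentiableOn ℂ (fun ζ : ℂ => f (x + ζ • v)) (closedBall 0 r) := fun ζ hζ =>
      (hg ζ (by simpa using hζ)).differentiableAt.differentiableWithinAt
    have hpi : (2 * Real.pi * Complex.I : ℂ) ≠ 0 := Complex.two_pi_I_ne_zero
    rw [eq_inv_mul_iff_mul_eq₀ hpi, ← smul_eq_mul, ← hd.deriv_eq_smul_circleIntegral hr0,
      circleIntegral]
    refine intervalIntegral.integral_congr fun θ _ => ?_
    simp only [hw, smul_eq_mul, one_div]
    ring
  have hcont : ∀ x ∈ ball z (R / 2), Continuous fun θ => w θ * f (x + circleMap 0 r θ • v) := by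
    intro x hx
    refine hwc.mul (continuous_iff_continuousAt.2 fun θ => ?_)
    exact ContinuousAt.comp (f := fun θ => x + circleMap 0 r θ • v)
      (hdf _ (hmem x hx _ (hnm θ))).continuousAt (by fun_prop)
  borelize E
  have : ProperSpace E := FiniteDimensional.proper ℂ E
  have : CompleteSpace E := FiniteDimensional.complete ℂ E
  have : SecondCountableTopology E := secondCountable_of_proper
  borelize (E →L[ℂ] ℂ)
  have : FiniteDimensional ℂ (E →L[ℂ] ℂ) := inferInstance
  have : ProperSpace (E →L[ℂ] ℂ) := FiniteDimensional.proper ℂ _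
  have : SecondCountableTopology (E →L[ℂ] ℂ) := secondCountable_of_proper
  -- Continuity of `fderiv ℂ f` is not available at this stage, but measurability suffices for the
  -- dominated differentiation.
  have hmeas : Measurable fun θ => w θ • fderiv ℂ f (z + circleMap 0 r θ • v) := by
    refine hwc.measurable.smul ((measurable_fderiv ℂ f).comp ?_)
    exact Continuous.measurable (by fun_prop)
  have key := intervalIntegral.hasFDerivAt_integral_of_dominated_of_fderiv_le (𝕜 := ℂ)
    (μ := volume) (a := 0) (b := 2 * Real.pi) (x₀ := z) (s := ball z (R / 2))
    (F := fun x θ => w θ * f (x + circleMap 0 r θ • v))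
    (F' := fun x θ => w θ • fderiv ℂ f (x + circleMap 0 r θ • v))
    (bound := fun _ => r⁻¹ * C) (ball_mem_nhds z (half_pos hR))
    (by
      filter_upwards [ball_mem_nhds z (half_pos hR)] with x hx
      exact (hcont x hx).aestronglyMeasurable)
    ((hcont z (mem_ball_self (half_pos hR))).intervalIntegrable _ _)
    hmeas.aestronglyMeasurable
    (by
      refine Filter.Eventually.of_forall fun θ _ x hx => ?_
      rw [norm_smul, hwn]
      exact mul_le_mul_of_nonneg_left (hC _ (hmem x hx _ (hnm θ))) (by positivity))
    (by simp)
    (by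
      refine Filter.Eventually.of_forall fun θ _ x hx => ?_
      have h1 : HasFDerivAt (fun x => x + circleMap 0 r θ • v) (ContinuousLinearMap.id ℂ E) x :=
        (hasFDerivAt_id x).add_const _
      have h2 := (hdf _ (hmem x hx _ (hnm θ))).comp x h1
      exact h2.const_mul (w θ))
  have key2 := (key.const_mul ((2 * Real.pi * Complex.I : ℂ)⁻¹)).differentiableAt
  refine (key2.congr_of_eventuallyEq ?_).differentiableWithinAt
  filter_upwards [ball_mem_nhds z (half_pos hR)] with x hx
  exact hint x hx

theorem contDiffOn_of_differentiableOn {f : E → ℂ} {U : Set E} (hU : IsOpen U)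
    (hf : DifferentiableOn ℂ f U) : ContDiffOn ℂ ∞ f U := by
  rw [contDiffOn_infty]
  intro n
  induction n generalizing f with
  | zero => exact contDiffOn_zero.2 hf.continuousOn
  | succ n ih =>
    rw [Nat.cast_succ, contDiffOn_succ_iff_fderiv_of_isOpen hU]
    refine ⟨hf, fun h => by simp at h, contDiffOn_clm_apply.2 fun v => ?_⟩
    exact ih (differentiableOn_fderiv_apply hU hf v)

end Holomorphic

end KahlerTree

end

noncomputable section

namespace KahlerTree

/-! ### Wirtinger calculus -/

section Wirtinger

variable {n : ℕ} {U : Set (Fin n → ℂ)} {f g : (Fin n → ℂ) → ℂ}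

/-- Both Wirtinger derivatives at once: `dz` for `σ = -1` and `dzbar` for `σ = 1`. -/
def wirtinger (σ : ℂ) (i : Fin n) (f : (Fin n → ℂ) → ℂ) (p : Fin n → ℂ) : ℂ :=
  (fderiv ℝ f p (Pi.single i 1) + σ * Complex.I * fderiv ℝ f p (Pi.single i Complex.I)) / 2

theorem dz_eq_wirtinger (i : Fin n) : dz i = wirtinger (-1) i := by
  funext f p
  simp only [dz, wirtinger]
  ring

theorem dzbar_eq_wirtinger (i : Fin n) : dzbar i = wirtinger 1 i := by
  funext f p
  simp only [dzbar, wirtinger]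
  ring

/-- The properties of a Wirtinger derivative that the product rule for iterated derivatives uses. -/
structure IsDerivationOn (U : Set (Fin n → ℂ))
    (δ : ((Fin n → ℂ) → ℂ) → (Fin n → ℂ) → ℂ) : Prop where
  smooth : ∀ f, ContDiffOn ℝ ∞ f U → ContDiffOn ℝ ∞ (δ f) U
  congr : ∀ f g, Set.EqOn f g U → Set.EqOn (δ f) (δ g) U
  const : ∀ c, ∀ z ∈ U, δ (fun _ => c) z = 0
  add : ∀ f g, ContDiffOn ℝ ∞ f U → ContDiffOn ℝ ∞ g U → ∀ z ∈ U,
    δ (fun w => f w + g w) z = δ f z + δ g z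
  mul : ∀ f g, ContDiffOn ℝ ∞ f U → ContDiffOn ℝ ∞ g U → ∀ z ∈ U,
    δ (fun w => f w * g w) z = δ f z * g z + f z * δ g z

theorem IsDerivationOn.sum {δ : ((Fin n → ℂ) → ℂ) → (Fin n → ℂ) → ℂ} (h : IsDerivationOn U δ)
    {τ : Type*} (s : Finset τ) (F : τ → (Fin n → ℂ) → ℂ) (hF : ∀ t ∈ s, ContDiffOn ℝ ∞ (F t) U)
    {z : Fin n → ℂ} (hz : z ∈ U) :
    δ (fun w => ∑ t ∈ s, F t w) z = ∑ t ∈ s, δ (F t) z := by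
  classical
  induction s using Finset.induction_on with
  | empty => simpa using h.const 0 z hz
  | insert t s ht ih =>
    simp only [Finset.sum_insert ht]
    rw [h.add _ _ (hF t (Finset.mem_insert_self t s))
      (ContDiffOn.sum fun x hx => hF x (Finset.mem_insert_of_mem hx)) z hz,
      ih fun x hx => hF x (Finset.mem_insert_of_mem hx)]

theorem smooth_differentiableAt (hU : IsOpen U) (hf : ContDiffOn ℝ ∞ f U) {z : Fin n → ℂ}
    (hz : z ∈ U) : DifferentiableAt ℝ f z :=
  (hf.contDiffAt (hU.mem_nhds hz)).differentiableAt (by simp)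

theorem smooth_fderiv_apply (hU : IsOpen U) (hf : ContDiffOn ℝ ∞ f U) (v : Fin n → ℂ) :
    ContDiffOn ℝ ∞ (fun z => fderiv ℝ f z v) U :=
  (hf.fderiv_of_isOpen hU (by simp)).clm_apply contDiffOn_const

theorem isDerivationOn_wirtinger (hU : IsOpen U) (σ : ℂ) (i : Fin n) :
    IsDerivationOn U (wirtinger σ i) where
  smooth f hf := ((smooth_fderiv_apply hU hf _).add
    (contDiffOn_const.mul (smooth_fderiv_apply hU hf _))).div_const 2
  congr f g hfg z hz := by
    have h : f =ᶠ[nhds z] g := Filter.eventuallyEq_of_mem (hU.mem_nhds hz) hfg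
    simp only [wirtinger, h.fderiv_eq]
  const c z _ := by simp [wirtinger]
  add f g hf hg z hz := by
    have h := fderiv_fun_add (smooth_differentiableAt hU hf hz) (smooth_differentiableAt hU hg hz)
    simp only [wirtinger, h, add_apply]
    ring
  mul f g hf hg z hz := by
    have h := fderiv_fun_mul (smooth_differentiableAt hU hf hz) (smooth_differentiableAt hU hg hz)
    simp only [wirtinger, h, add_apply, smul_apply,
      smul_eq_mul]
    ring

theorem isDerivationOn_dz (hU : IsOpen U) (i : Fin n) : IsDerivationOn U (dz i) :=
  dz_eq_wirtinger i ▸ isDerivationOn_wirtinger hU _ i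

theorem isDerivationOn_dzbar (hU : IsOpen U) (i : Fin n) : IsDerivationOn U (dzbar i) :=
  dzbar_eq_wirtinger i ▸ isDerivationOn_wirtinger hU _ i

theorem fderiv_wirtinger (hU : IsOpen U) (hf : ContDiffOn ℝ ∞ f U) {z : Fin n → ℂ} (hz : z ∈ U)
    (σ : ℂ) (i : Fin n) (v : Fin n → ℂ) :
    fderiv ℝ (wirtinger σ i f) z v = (fderiv ℝ (fderiv ℝ f) z v (Pi.single i 1) +
      σ * Complex.I * fderiv ℝ (fderiv ℝ f) z v (Pi.single i Complex.I)) / 2 := by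
  have hd : DifferentiableAt ℝ (fderiv ℝ f) z :=
    ((hf.fderiv_of_isOpen hU (m := ∞) (by simp)).contDiffAt (hU.mem_nhds hz)).differentiableAt
      (by simp)
  have h1 : ∀ w : Fin n → ℂ, HasFDerivAt (fun z => fderiv ℝ f z w)
      ((fderiv ℝ (fderiv ℝ f) z).flip w) z := fun w => by
    simpa using hd.hasFDerivAt.clm_apply (hasFDerivAt_const w z)
  have h2 := (((h1 (Pi.single i 1)).add
    ((h1 (Pi.single i Complex.I)).const_mul (σ * Complex.I))).mul_const (2 : ℂ)⁻¹).fderiv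
  have h3 : wirtinger σ i f = fun z => (fderiv ℝ f z (Pi.single i 1) +
      σ * Complex.I * fderiv ℝ f z (Pi.single i Complex.I)) * (2 : ℂ)⁻¹ := by
    funext z
    simp only [wirtinger, div_eq_mul_inv]
  rw [h3]
  have h4 := congrArg (fun L => L v) h2
  refine h4.trans ?_
  simp [div_eq_mul_inv, mul_comm, mul_add]

theorem wirtinger_comm (hU : IsOpen U) (hf : ContDiffOn ℝ ∞ f U) (σ τ : ℂ) (i j : Fin n) :
    Set.EqOn (wirtinger σ i (wirtinger τ j f)) (wirtinger τ j (wirtinger σ i f)) U := by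
  intro z hz
  have hs : IsSymmSndFDerivAt ℝ f z :=
    (hf.contDiffAt (hU.mem_nhds hz)).isSymmSndFDerivAt (by
      simp only [minSmoothness_of_isRCLikeNormedField]; exact WithTop.coe_le_coe.2 le_top)
  rw [wirtinger, wirtinger, fderiv_wirtinger hU hf hz, fderiv_wirtinger hU hf hz,
    fderiv_wirtinger hU hf hz, fderiv_wirtinger hU hf hz,
    hs (Pi.single i 1) (Pi.single j 1), hs (Pi.single i 1) (Pi.single j Complex.I),
    hs (Pi.single i Complex.I) (Pi.single j 1), hs (Pi.single i Complex.I) (Pi.single j Complex.I)]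
  ring

/-- An iterated Wirtinger derivative. -/
def iterWirtinger (σ : ℂ) (α : List (Fin n)) (f : (Fin n → ℂ) → ℂ) : (Fin n → ℂ) → ℂ :=
  α.foldr (wirtinger σ) f

theorem iterDz_eq_iterWirtinger (α : List (Fin n)) : iterDz α = iterWirtinger (-1) α := by
  funext f
  rw [iterDz, iterWirtinger]
  congr 1
  funext i
  exact dz_eq_wirtinger i

theorem iterDzbar_eq_iterWirtinger (α : List (Fin n)) : iterDzbar α = iterWirtinger 1 α := by
  funext f
  rw [iterDzbar, iterWirtinger]
  congr 1
  funext i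
  exact dzbar_eq_wirtinger i

theorem iterWirtinger_cons (σ : ℂ) (i : Fin n) (α : List (Fin n)) (f : (Fin n → ℂ) → ℂ) :
    iterWirtinger σ (i :: α) f = wirtinger σ i (iterWirtinger σ α f) := rfl

theorem smooth_iterWirtinger (hU : IsOpen U) (hf : ContDiffOn ℝ ∞ f U) (σ : ℂ)
    (α : List (Fin n)) : ContDiffOn ℝ ∞ (iterWirtinger σ α f) U := by
  induction α with
  | nil => exact hf
  | cons i α ih => exact (isDerivationOn_wirtinger hU σ i).smooth _ ih

theorem iterWirtinger_congr (hU : IsOpen U) (hfg : Set.EqOn f g U) (σ : ℂ) (α : List (Fin n)) :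
    Set.EqOn (iterWirtinger σ α f) (iterWirtinger σ α g) U := by
  induction α with
  | nil => exact hfg
  | cons i α ih => exact (isDerivationOn_wirtinger hU σ i).congr _ _ ih

theorem wirtinger_iterWirtinger (hU : IsOpen U) (hf : ContDiffOn ℝ ∞ f U) (σ τ : ℂ) (i : Fin n)
    (α : List (Fin n)) :
    Set.EqOn (wirtinger σ i (iterWirtinger τ α f)) (iterWirtinger τ α (wirtinger σ i f)) U := by
  induction α with
  | nil => exact fun _ _ => rfl
  | cons j α ih =>
    refine (wirtinger_comm hU (smooth_iterWirtinger hU hf τ α) σ τ i j).trans ?_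
    exact (isDerivationOn_wirtinger hU τ j).congr _ _ ih

theorem iterWirtinger_perm (hU : IsOpen U) (hf : ContDiffOn ℝ ∞ f U) (σ : ℂ)
    {α β : List (Fin n)} (h : α.Perm β) :
    Set.EqOn (iterWirtinger σ α f) (iterWirtinger σ β f) U := by
  induction h with
  | nil => exact fun _ _ => rfl
  | cons x _ ih => exact (isDerivationOn_wirtinger hU σ x).congr _ _ ih
  | swap x y l => exact wirtinger_comm hU (smooth_iterWirtinger hU hf σ l) σ σ y x
  | trans _ _ ih1 ih2 => exact ih1.trans ih2

theorem dzbar_star (i : Fin n) (f : (Fin n → ℂ) → ℂ) (z : Fin n → ℂ) :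
    dzbar i (fun w => star (f w)) z = star (dz i f z) := by
  have h : fderiv ℝ (fun w => star (f w)) z =
      (Complex.conjCLE : ℂ →L[ℝ] ℂ).comp (fderiv ℝ f z) :=
    Complex.conjCLE.comp_fderiv
  simp only [dzbar, dz, h]
  simp

theorem dz_star (i : Fin n) (f : (Fin n → ℂ) → ℂ) (z : Fin n → ℂ) :
    dz i (fun w => star (f w)) z = star (dzbar i f z) := by
  have h := dzbar_star i (fun w => star (f w)) z
  simp only [star_star] at h
  rw [h, star_star]

theorem iterDzbar_star (α : List (Fin n)) (f : (Fin n → ℂ) → ℂ) :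
    iterDzbar α (fun w => star (f w)) = fun w => star (iterDz α f w) := by
  induction α with
  | nil => rfl
  | cons i α ih =>
    change dzbar i (iterDzbar α fun w => star (f w)) = _
    rw [ih]
    funext z
    exact dzbar_star i _ z

theorem smooth_star (hf : ContDiffOn ℝ ∞ f U) : ContDiffOn ℝ ∞ (fun w => star (f w)) U :=
  Complex.conjCLE.contDiff.comp_contDiffOn hf

/-- The real differential in terms of the Wirtinger derivatives. -/
theorem fderiv_eq_sum_dz (f : (Fin n → ℂ) → ℂ) (p v : Fin n → ℂ) :
    fderiv ℝ f p v = ∑ c, (v c * dz c f p + star (v c) * dzbar c f p) := by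
  have h1 : v = ∑ c, ((v c).re • (Pi.single c 1 : Fin n → ℂ) +
      (v c).im • (Pi.single c Complex.I : Fin n → ℂ)) := by
    funext d
    simp only [Finset.sum_apply, Pi.add_apply, Pi.smul_apply, Complex.real_smul]
    rw [Finset.sum_eq_single d]
    · simp [Complex.re_add_im]
    · intro c _ hc
      simp [Pi.single_eq_of_ne hc.symm]
    · simp
  conv_lhs => rw [h1]
  rw [map_sum]
  refine Finset.sum_congr rfl fun c _ => ?_
  rw [map_add, map_smul, map_smul, Complex.real_smul, Complex.real_smul, dz, dzbar]
  generalize fderiv ℝ f p (Pi.single c 1) = A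
  generalize fderiv ℝ f p (Pi.single c Complex.I) = B
  have h2 : star (v c) = (v c).re - (v c).im * Complex.I := by
    apply Complex.ext <;> simp
  rw [h2]
  conv_rhs => rw [← Complex.re_add_im (v c)]
  simp only [Complex.add_re, Complex.add_im, Complex.ofReal_re, Complex.ofReal_im, Complex.mul_re,
    Complex.mul_im, Complex.I_re, Complex.I_im]
  push_cast
  ring_nf
  simp only [Complex.I_sq]
  ring

end Wirtinger

/-! ### Wirtinger derivatives of holomorphic functions and the chain rule -/

section Holomorphic

variable {n : ℕ} {U V : Set (Fin n → ℂ)} {f : (Fin n → ℂ) → ℂ} {φ : (Fin n → ℂ) → (Fin n → ℂ)}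

theorem smooth_of_holomorphic (hU : IsOpen U) (hf : DifferentiableOn ℂ f U) :
    ContDiffOn ℝ ∞ f U :=
  (contDiffOn_of_differentiableOn hU hf).restrict_scalars ℝ

theorem dz_of_holomorphic (hU : IsOpen U) (hf : DifferentiableOn ℂ f U) (i : Fin n) :
    Set.EqOn (dz i f) (fun z => fderiv ℂ f z (Pi.single i 1)) U := by
  intro z hz
  have h1 := (hf.differentiableAt (hU.mem_nhds hz)).fderiv_restrictScalars ℝ
  have h2 : (Pi.single i Complex.I : Fin n → ℂ) = Complex.I • Pi.single i 1 := by
    rw [← Pi.single_smul]; simp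
  simp only [dz, h1, ContinuousLinearMap.coe_restrictScalars', h2, map_smul, smul_eq_mul]
  linear_combination (-(1 / 2 : ℂ)) * (fderiv ℂ f z (Pi.single i 1)) * Complex.I_sq

theorem dzbar_of_holomorphic (hU : IsOpen U) (hf : DifferentiableOn ℂ f U) (i : Fin n)
    {z : Fin n → ℂ} (hz : z ∈ U) : dzbar i f z = 0 := by
  have h1 := (hf.differentiableAt (hU.mem_nhds hz)).fderiv_restrictScalars ℝ
  have h2 : (Pi.single i Complex.I : Fin n → ℂ) = Complex.I • Pi.single i 1 := by
    rw [← Pi.single_smul]; simp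
  simp only [dzbar, h1, ContinuousLinearMap.coe_restrictScalars', h2, map_smul, smul_eq_mul]
  linear_combination (1 / 2 : ℂ) * (fderiv ℂ f z (Pi.single i 1)) * Complex.I_sq

theorem holomorphic_dz (hU : IsOpen U) (hf : DifferentiableOn ℂ f U) (i : Fin n) :
    DifferentiableOn ℂ (dz i f) U :=
  (differentiableOn_fderiv_apply hU hf (Pi.single i 1)).congr (dz_of_holomorphic hU hf i)

theorem holomorphic_iterDz (hU : IsOpen U) (hf : DifferentiableOn ℂ f U) (α : List (Fin n)) :
    DifferentiableOn ℂ (iterDz α f) U := by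
  induction α with
  | nil => exact hf
  | cons i α ih => exact holomorphic_dz hU ih i

theorem holomorphic_apply (hφ : DifferentiableOn ℂ φ U) (c : Fin n) :
    DifferentiableOn ℂ (fun z => φ z c) U :=
  differentiableOn_pi.1 hφ c

theorem jacobian_eq_dz (hU : IsOpen U) (hφ : DifferentiableOn ℂ φ U) (c i : Fin n) :
    Set.EqOn (fun z => jacobian φ z c i) (dz i fun z => φ z c) U := by
  intro z hz
  rw [dz_of_holomorphic hU (holomorphic_apply hφ c) i hz]
  have h := (hφ.differentiableAt (hU.mem_nhds hz))
  have h2 := fderiv_pi (𝕜 := ℂ) (φ := fun c z => φ z c) (x := z) fun c =>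
    (holomorphic_apply hφ c).differentiableAt (hU.mem_nhds hz)
  have h3 : fderiv ℂ φ z = ContinuousLinearMap.pi fun c => fderiv ℂ (fun z => φ z c) z := h2
  simp only [jacobian, h3, ContinuousLinearMap.pi_apply]

theorem smooth_comp (hU : IsOpen U) (hφ : DifferentiableOn ℂ φ U) (hUV : Set.MapsTo φ U V)
    (hf : ContDiffOn ℝ ∞ f V) : ContDiffOn ℝ ∞ (fun z => f (φ z)) U :=
  hf.comp (contDiffOn_pi.2 fun c => smooth_of_holomorphic hU (holomorphic_apply hφ c)) hUV

theorem fderiv_comp_holomorphic (hU : IsOpen U) (hV : IsOpen V) (hφ : DifferentiableOn ℂ φ U)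
    (hUV : Set.MapsTo φ U V) (hf : ContDiffOn ℝ ∞ f V) {z : Fin n → ℂ} (hz : z ∈ U)
    (v : Fin n → ℂ) :
    fderiv ℝ (fun z => f (φ z)) z v = ∑ c, (fderiv ℂ φ z v c * dz c f (φ z) +
      star (fderiv ℂ φ z v c) * dzbar c f (φ z)) := by
  have h1 := hφ.differentiableAt (hU.mem_nhds hz)
  have h2 : fderiv ℝ (f ∘ φ) z = _ :=
    fderiv_comp z (smooth_differentiableAt hV hf (hUV hz)) (h1.restrictScalars ℝ)
  have h3 : (fun z => f (φ z)) = f ∘ φ := rfl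
  rw [h3, h2, ContinuousLinearMap.comp_apply, fderiv_eq_sum_dz, h1.fderiv_restrictScalars ℝ]
  rfl

theorem dz_comp (hU : IsOpen U) (hV : IsOpen V) (hφ : DifferentiableOn ℂ φ U)
    (hUV : Set.MapsTo φ U V) (hf : ContDiffOn ℝ ∞ f V) {z : Fin n → ℂ} (hz : z ∈ U) (i : Fin n) :
    dz i (fun z => f (φ z)) z = ∑ c, jacobian φ z c i * dz c f (φ z) := by
  have h2 : (Pi.single i Complex.I : Fin n → ℂ) = Complex.I • Pi.single i 1 := by
    rw [← Pi.single_smul]; simp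
  rw [dz, fderiv_comp_holomorphic hU hV hφ hUV hf hz, fderiv_comp_holomorphic hU hV hφ hUV hf hz,
    h2, Finset.mul_sum, ← Finset.sum_sub_distrib, Finset.sum_div]
  refine Finset.sum_congr rfl fun c _ => ?_
  simp only [map_smul, Pi.smul_apply, smul_eq_mul, jacobian, star_mul', Complex.star_def,
    Complex.conj_I]
  ring_nf
  simp only [Complex.I_sq]
  ring

theorem dzbar_comp (hU : IsOpen U) (hV : IsOpen V) (hφ : DifferentiableOn ℂ φ U)
    (hUV : Set.MapsTo φ U V) (hf : ContDiffOn ℝ ∞ f V) {z : Fin n → ℂ} (hz : z ∈ U) (i : Fin n) :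
    dzbar i (fun z => f (φ z)) z = ∑ c, star (jacobian φ z c i) * dzbar c f (φ z) := by
  have h2 : (Pi.single i Complex.I : Fin n → ℂ) = Complex.I • Pi.single i 1 := by
    rw [← Pi.single_smul]; simp
  rw [dzbar, fderiv_comp_holomorphic hU hV hφ hUV hf hz,
    fderiv_comp_holomorphic hU hV hφ hUV hf hz,
    h2, Finset.mul_sum, ← Finset.sum_add_distrib, Finset.sum_div]
  refine Finset.sum_congr rfl fun c _ => ?_
  simp only [map_smul, Pi.smul_apply, smul_eq_mul, jacobian, star_mul', Complex.star_def,
    Complex.conj_I]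
  ring_nf
  simp only [Complex.I_sq]
  ring

end Holomorphic

end KahlerTree

end

noncomputable section

namespace KahlerTree

/-! ### Derivatives of sums over set partitions -/

section FaaDiBruno

variable {n : ℕ} {U : Set (Fin n → ℂ)} {ι κ : Type} [LinearOrder ι] [Fintype κ]
  {S : (Fin n → ℂ) → Finset ι → κ → ℂ}

/-- The empty multiset of labels occurs only for `A = ∅`. The hypothesis on `F` leaves it out
otherwise, because derivatives of the metric have a meaning for nonempty index lists only. -/
theorem smooth_blockSum {A : Finset ι} {F : (Fin n → ℂ) → Multiset κ → ℂ}
    (hS : ∀ C ⊆ A, C.Nonempty → ∀ c, ContDiffOn ℝ ∞ (fun z => S z C c) U)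
    (hF : ∀ α, α ≠ 0 ∨ A = ∅ → ContDiffOn ℝ ∞ (fun z => F z α) U) :
    ContDiffOn ℝ ∞ (fun z => blockSum (S z) (F z) A) U := by
  induction hn : A.card using Nat.strong_induction_on generalizing A F with
  | _ N ih =>
    rcases A.eq_empty_or_nonempty with rfl | hne
    · simp only [blockSum_empty]
      exact hF 0 (Or.inr rfl)
    obtain ⟨m, B, hB, rfl, hmB⟩ := exists_insert_lt hne
    simp only [blockSum_insert _ _ hB]
    refine ContDiffOn.sum fun D hD => ContDiffOn.sum fun c _ => ?_
    have hDB := Finset.mem_powerset.1 hD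
    refine (hS _ (Finset.insert_subset_insert m hDB) (Finset.insert_nonempty _ _) c).mul ?_
    refine ih _ ?_ (F := fun z α => F z (c ::ₘ α)) (fun C hC => hS C
      (hC.trans (Finset.sdiff_subset.trans (Finset.subset_insert _ _))))
      (fun α _ => hF _ (Or.inl (Multiset.cons_ne_zero))) rfl
    rw [← hn, Finset.card_insert_of_notMem hmB]
    exact Nat.lt_succ_of_le (Finset.card_le_card Finset.sdiff_subset)

variable {δ : ((Fin n → ℂ) → ℂ) → (Fin n → ℂ) → ℂ}

/-- The derivative of a sum over the set partitions of `A`: the new element `a` is either added to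
one of the blocks or forms a block of its own. -/
theorem IsDerivationOn.blockSum_insert (h : IsDerivationOn U δ) {A : Finset ι} {a : ι}
    {F : (Fin n → ℂ) → Multiset κ → ℂ} (ha : ∀ x ∈ A, a < x)
    (hS : ∀ C ⊆ A, C.Nonempty → ∀ c, ContDiffOn ℝ ∞ (fun z => S z C c) U)
    (hF : ∀ α, α ≠ 0 ∨ A = ∅ → ContDiffOn ℝ ∞ (fun z => F z α) U)
    (hδS : ∀ C ⊆ A, C.Nonempty → ∀ c, ∀ z ∈ U, δ (fun z => S z C c) z = S z (insert a C) c)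
    (hδF : ∀ α, α ≠ 0 ∨ A = ∅ → ∀ z ∈ U,
      δ (fun z => F z α) z = ∑ c, S z {a} c * F z (c ::ₘ α)) {z : Fin n → ℂ} (hz : z ∈ U) :
    δ (fun z => blockSum (S z) (F z) A) z = blockSum (S z) (F z) (insert a A) := by
  induction hn : A.card using Nat.strong_induction_on generalizing A F with
  | _ N ih =>
    rcases A.eq_empty_or_nonempty with rfl | hne
    · rw [KahlerTree.blockSum_insert _ _ (by simp)]
      simp only [blockSum_empty]
      rw [hδF 0 (Or.inr rfl) z hz]
      simp [blockSum_empty]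
    obtain ⟨m, B, hB, rfl, hmB⟩ := exists_insert_lt hne
    have ham : a < m := ha m (Finset.mem_insert_self _ _)
    have haB : a ∉ B := fun h => lt_irrefl a (ha a (Finset.mem_insert_of_mem h))
    have hB' : ∀ x ∈ insert a B, x < m := by
      simp only [Finset.forall_mem_insert]
      exact ⟨ham, hB⟩
    have hlt : ∀ D, (B \ D).card < N := fun D => by
      rw [← hn, Finset.card_insert_of_notMem hmB]
      exact Nat.lt_succ_of_le (Finset.card_le_card Finset.sdiff_subset)
    have hsub : ∀ D, B \ D ⊆ insert m B := fun D =>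
      Finset.sdiff_subset.trans (Finset.subset_insert _ _)
    have hsm : ∀ D c, ContDiffOn ℝ ∞
        (fun z => blockSum (S z) (fun α => F z (c ::ₘ α)) (B \ D)) U := fun D c =>
      smooth_blockSum (F := fun z α => F z (c ::ₘ α)) (fun C hC => hS C (hC.trans (hsub D)))
        fun α _ => hF _ (Or.inl Multiset.cons_ne_zero)
    have hSm : ∀ D ∈ B.powerset, ∀ c, ContDiffOn ℝ ∞ (fun z => S z (insert m D) c) U :=
      fun D hD => hS _ (Finset.insert_subset_insert m (Finset.mem_powerset.1 hD))
        (Finset.insert_nonempty _ _)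
    -- As `a` is smaller than all other elements, `m` remains the largest one. The subsets of
    -- `insert a B` with and without `a` correspond to the two terms of the product rule: `a` joins
    -- the block of `m`, or it is placed among the remaining elements.
    rw [Finset.insert_comm, KahlerTree.blockSum_insert _ _ hB', Finset.sum_powerset_insert haB,
      ← Finset.sum_add_distrib]
    simp only [KahlerTree.blockSum_insert _ _ hB]
    rw [h.sum _ _ (fun D hD => ContDiffOn.sum fun c _ => (hSm D hD c).mul (hsm D c)) hz]
    refine Finset.sum_congr rfl fun D hD => ?_
    have hDB := Finset.mem_powerset.1 hD
    rw [h.sum _ _ (fun c _ => (hSm D hD c).mul (hsm D c)) hz, ← Finset.sum_add_distrib]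
    refine Finset.sum_congr rfl fun c _ => ?_
    have e1 : insert a B \ D = insert a (B \ D) :=
      Finset.insert_sdiff_of_notMem _ fun h => haB (hDB h)
    have e2 : insert a B \ insert a D = B \ D := by
      ext x
      simp only [Finset.mem_sdiff, Finset.mem_insert, not_or]
      constructor
      · rintro ⟨rfl | h1, h2, h3⟩
        · exact absurd rfl h2
        · exact ⟨h1, h3⟩
      · rintro ⟨h1, h2⟩
        exact ⟨Or.inr h1, fun h => haB (h ▸ h1), h2⟩
    rw [h.mul _ _ (hSm D hD c) (hsm D c) z hz, e1, e2,
      hδS _ (Finset.insert_subset_insert m hDB) (Finset.insert_nonempty _ _) c z hz,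
      ih _ (hlt D) (F := fun z α => F z (c ::ₘ α)) (fun x hx => ha x (hsub D hx))
        (fun C hC => hS C (hC.trans (hsub D))) (fun α _ => hF _ (Or.inl Multiset.cons_ne_zero))
        (fun C hC => hδS C (hC.trans (hsub D)))
        (fun α _ z hz => hδF (c ::ₘ α) (Or.inl Multiset.cons_ne_zero) z hz |>.trans
          (Finset.sum_congr rfl fun d _ => by rw [Multiset.cons_swap])) rfl,
      Finset.insert_comm, add_comm]

/-- A derivation that annihilates the block weights acts on the values only. -/
theorem IsDerivationOn.blockSum_const (h : IsDerivationOn U δ) {A : Finset ι}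
    {F F' : (Fin n → ℂ) → Multiset κ → ℂ}
    (hS : ∀ C ⊆ A, C.Nonempty → ∀ c, ContDiffOn ℝ ∞ (fun z => S z C c) U)
    (hF : ∀ α, α ≠ 0 ∨ A = ∅ → ContDiffOn ℝ ∞ (fun z => F z α) U)
    (hδS : ∀ C ⊆ A, C.Nonempty → ∀ c, ∀ z ∈ U, δ (fun z => S z C c) z = 0)
    (hδF : ∀ α, α ≠ 0 ∨ A = ∅ → ∀ z ∈ U, δ (fun z => F z α) z = F' z α)
    {z : Fin n → ℂ} (hz : z ∈ U) :
    δ (fun z => blockSum (S z) (F z) A) z = blockSum (S z) (F' z) A := by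
  induction hn : A.card using Nat.strong_induction_on generalizing A F F' with
  | _ N ih =>
    rcases A.eq_empty_or_nonempty with rfl | hne
    · simp only [blockSum_empty]
      exact hδF 0 (Or.inr rfl) z hz
    obtain ⟨m, B, hB, rfl, hmB⟩ := exists_insert_lt hne
    have hlt : ∀ D, (B \ D).card < N := fun D => by
      rw [← hn, Finset.card_insert_of_notMem hmB]
      exact Nat.lt_succ_of_le (Finset.card_le_card Finset.sdiff_subset)
    have hsub : ∀ D, B \ D ⊆ insert m B := fun D =>
      Finset.sdiff_subset.trans (Finset.subset_insert _ _)
    have hsm : ∀ D c, ContDiffOn ℝ ∞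
        (fun z => blockSum (S z) (fun α => F z (c ::ₘ α)) (B \ D)) U := fun D c =>
      smooth_blockSum (F := fun z α => F z (c ::ₘ α)) (fun C hC => hS C (hC.trans (hsub D)))
        fun α _ => hF _ (Or.inl Multiset.cons_ne_zero)
    have hSm : ∀ D ∈ B.powerset, ∀ c, ContDiffOn ℝ ∞ (fun z => S z (insert m D) c) U :=
      fun D hD => hS _ (Finset.insert_subset_insert m (Finset.mem_powerset.1 hD))
        (Finset.insert_nonempty _ _)
    simp only [KahlerTree.blockSum_insert _ _ hB]
    rw [h.sum _ _ (fun D hD => ContDiffOn.sum fun c _ => (hSm D hD c).mul (hsm D c)) hz]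
    refine Finset.sum_congr rfl fun D hD => ?_
    have hDB := Finset.mem_powerset.1 hD
    rw [h.sum _ _ (fun c _ => (hSm D hD c).mul (hsm D c)) hz]
    refine Finset.sum_congr rfl fun c _ => ?_
    rw [h.mul _ _ (hSm D hD c) (hsm D c) z hz,
      hδS _ (Finset.insert_subset_insert m hDB) (Finset.insert_nonempty _ _) c z hz,
      ih _ (hlt D) (F := fun z α => F z (c ::ₘ α)) (F' := fun z α => F' z (c ::ₘ α))
        (fun C hC => hS C (hC.trans (hsub D))) (fun α _ => hF _ (Or.inl Multiset.cons_ne_zero))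
        (fun C hC => hδS C (hC.trans (hsub D)))
        (fun α _ => hδF (c ::ₘ α) (Or.inl Multiset.cons_ne_zero)) rfl, zero_mul, zero_add]

end FaaDiBruno

/-! ### Symmetry of the derivatives of a Kähler metric -/

section Kahler

variable {n : ℕ} {U : Set (Fin n → ℂ)} {g : (Fin n → ℂ) → Matrix (Fin n) (Fin n) ℂ}

/-- The derivative of the metric with the multisets `α`, `β` of unbarred and barred indices. -/
def kahlerDeriv (g : (Fin n → ℂ) → Matrix (Fin n) (Fin n) ℂ) (α β : Multiset (Fin n))
    (p : Fin n → ℂ) : ℂ :=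
  metricDeriv g (α.sort (· ≤ ·)) (β.sort (· ≤ ·)) p

theorem metricDeriv_cons (i j : Fin n) (α β : List (Fin n)) :
    metricDeriv g (i :: α) (j :: β) =
      iterWirtinger (-1) α (iterWirtinger 1 β fun z => g z i j) := by
  funext p
  rw [metricDeriv, iterDz_eq_iterWirtinger, iterDzbar_eq_iterWirtinger]

theorem IsKahlerOn.star_apply (hg : IsKahlerOn g U) {z : Fin n → ℂ} (hz : z ∈ U) (i j : Fin n) :
    g z i j = star (g z j i) :=
  ((hg.posDef z hz).isHermitian.apply i j).symm

theorem IsKahlerOn.closed_bar (hg : IsKahlerOn g U) (i j l : Fin n) :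
    Set.EqOn (dzbar l fun w => g w i j) (dzbar j fun w => g w i l) U := fun z hz => by
  have h := (isDerivationOn_dzbar hg.isOpen)
  rw [(h l).congr _ _ (fun w hw => hg.star_apply hw i j) hz,
    (h j).congr _ _ (fun w hw => hg.star_apply hw i l) hz, dzbar_star, dzbar_star,
    hg.closed z hz]

/-- Interchanging the first two unbarred indices is the Kähler condition, because one belongs to the
metric and the other to a derivative; all other interchanges only commute derivatives. -/
theorem IsKahlerOn.metricDeriv_perm_left (hg : IsKahlerOn g U) {α α' : List (Fin n)}
    (h : α.Perm α') (β : List (Fin n)) :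
    Set.EqOn (metricDeriv g α β) (metricDeriv g α' β) U := by
  rcases β with _ | ⟨j, β⟩
  · intro z _
    rcases α with _ | ⟨i, α⟩ <;> rcases α' with _ | ⟨i', α'⟩ <;> rfl
  have hs : ∀ i, ContDiffOn ℝ ∞ (iterWirtinger 1 β fun z => g z i j) U := fun i =>
    smooth_iterWirtinger hg.isOpen (hg.smooth i j) 1 β
  induction h with
  | nil => exact fun _ _ => rfl
  | cons x h _ =>
    simp only [metricDeriv_cons]
    exact iterWirtinger_perm hg.isOpen (hs x) _ h
  | swap x y l =>
    simp only [metricDeriv_cons, iterWirtinger_cons]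
    refine (wirtinger_iterWirtinger hg.isOpen (hs y) _ _ x l).trans
      (Set.EqOn.trans ?_ (wirtinger_iterWirtinger hg.isOpen (hs x) _ _ y l).symm)
    refine iterWirtinger_congr hg.isOpen ?_ _ _
    refine (wirtinger_iterWirtinger hg.isOpen (hg.smooth y j) _ _ x β).trans
      (Set.EqOn.trans ?_ (wirtinger_iterWirtinger hg.isOpen (hg.smooth x j) _ _ y β).symm)
    refine iterWirtinger_congr hg.isOpen ?_ _ _
    rw [← dz_eq_wirtinger, ← dz_eq_wirtinger]
    exact fun z hz => hg.closed z hz y j x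
  | trans _ _ ih1 ih2 => exact ih1.trans ih2

theorem IsKahlerOn.metricDeriv_perm_right (hg : IsKahlerOn g U) (α : List (Fin n))
    {β β' : List (Fin n)} (h : β.Perm β') :
    Set.EqOn (metricDeriv g α β) (metricDeriv g α β') U := by
  rcases α with _ | ⟨i, α⟩
  · exact fun z _ => rfl
  induction h with
  | nil => exact fun _ _ => rfl
  | cons x h _ =>
    simp only [metricDeriv_cons]
    exact iterWirtinger_congr hg.isOpen
      (iterWirtinger_perm hg.isOpen (hg.smooth i x) _ h) _ _
  | swap x y l =>
    simp only [metricDeriv_cons, iterWirtinger_cons]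
    refine iterWirtinger_congr hg.isOpen ?_ _ _
    refine (wirtinger_iterWirtinger hg.isOpen (hg.smooth i y) _ _ x l).trans
      (Set.EqOn.trans ?_ (wirtinger_iterWirtinger hg.isOpen (hg.smooth i x) _ _ y l).symm)
    refine iterWirtinger_congr hg.isOpen ?_ _ _
    rw [← dzbar_eq_wirtinger, ← dzbar_eq_wirtinger]
    exact hg.closed_bar i y x
  | trans _ _ ih1 ih2 => exact ih1.trans ih2

theorem IsKahlerOn.kahlerDeriv_coe (hg : IsKahlerOn g U) (α β : List (Fin n)) :
    Set.EqOn (kahlerDeriv g α β) (metricDeriv g α β) U := by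
  have h1 : ((α : Multiset (Fin n)).sort (· ≤ ·)).Perm α :=
    Multiset.coe_eq_coe.1 (Multiset.sort_eq _ _)
  have h2 : ((β : Multiset (Fin n)).sort (· ≤ ·)).Perm β :=
    Multiset.coe_eq_coe.1 (Multiset.sort_eq _ _)
  exact (hg.metricDeriv_perm_left h1 _).trans (hg.metricDeriv_perm_right _ h2)

theorem IsKahlerOn.kahlerDeriv_singleton (hg : IsKahlerOn g U) (i j : Fin n) :
    Set.EqOn (kahlerDeriv g {i} {j}) (fun z => g z i j) U :=
  hg.kahlerDeriv_coe [i] [j]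

theorem exists_list_cons {α : Multiset (Fin n)} (hα : α ≠ 0) :
    ∃ (i : Fin n) (l : List (Fin n)), α = (i :: l : List (Fin n)) := by
  obtain ⟨i, hi⟩ := Multiset.exists_mem_of_ne_zero hα
  obtain ⟨t, rfl⟩ := Multiset.exists_cons_of_mem hi
  induction t using Quotient.inductionOn with
  | _ l => exact ⟨i, l, rfl⟩

theorem IsKahlerOn.smooth_kahlerDeriv (hg : IsKahlerOn g U) {α β : Multiset (Fin n)} (hα : α ≠ 0)
    (hβ : β ≠ 0) : ContDiffOn ℝ ∞ (kahlerDeriv g α β) U := by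
  obtain ⟨i, α, rfl⟩ := exists_list_cons hα
  obtain ⟨j, β, rfl⟩ := exists_list_cons hβ
  refine ContDiffOn.congr ?_ (hg.kahlerDeriv_coe _ _)
  rw [metricDeriv_cons]
  exact smooth_iterWirtinger hg.isOpen (smooth_iterWirtinger hg.isOpen (hg.smooth i j) _ _) _ _

theorem IsKahlerOn.dz_kahlerDeriv (hg : IsKahlerOn g U) {α β : Multiset (Fin n)} (hα : α ≠ 0)
    (hβ : β ≠ 0) (l : Fin n) :
    Set.EqOn (dz l (kahlerDeriv g α β)) (kahlerDeriv g (l ::ₘ α) β) U := by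
  obtain ⟨i, α, rfl⟩ := exists_list_cons hα
  obtain ⟨j, β, rfl⟩ := exists_list_cons hβ
  refine Set.EqOn.trans ((isDerivationOn_dz hg.isOpen l).congr _ _ (hg.kahlerDeriv_coe _ _)) ?_
  rw [Multiset.cons_coe]
  refine Set.EqOn.trans ?_ ((hg.kahlerDeriv_coe _ _).trans
    (hg.metricDeriv_perm_left (List.Perm.swap i l α) (j :: β))).symm
  rw [metricDeriv_cons, metricDeriv_cons, iterWirtinger_cons, dz_eq_wirtinger]
  exact fun _ _ => rfl

theorem IsKahlerOn.dzbar_kahlerDeriv (hg : IsKahlerOn g U) {α β : Multiset (Fin n)} (hα : α ≠ 0)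
    (hβ : β ≠ 0) (l : Fin n) :
    Set.EqOn (dzbar l (kahlerDeriv g α β)) (kahlerDeriv g α (l ::ₘ β)) U := by
  obtain ⟨i, α, rfl⟩ := exists_list_cons hα
  obtain ⟨j, β, rfl⟩ := exists_list_cons hβ
  refine Set.EqOn.trans ((isDerivationOn_dzbar hg.isOpen l).congr _ _ (hg.kahlerDeriv_coe _ _)) ?_
  rw [Multiset.cons_coe]
  refine Set.EqOn.trans ?_ ((hg.kahlerDeriv_coe _ _).trans
    (hg.metricDeriv_perm_right (i :: α) (List.Perm.swap j l β))).symm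
  rw [metricDeriv_cons, metricDeriv_cons, iterWirtinger_cons, dzbar_eq_wirtinger]
  exact wirtinger_iterWirtinger hg.isOpen
    (smooth_iterWirtinger hg.isOpen (hg.smooth i j) _ _) _ _ _ _

end Kahler

end KahlerTree

end

noncomputable section

namespace KahlerTree

set_option linter.unusedSectionVars false

/-! ### The derivatives of a metric in new coordinates -/

section Pullback

variable {n : ℕ} {U V : Set (Fin n → ℂ)} {φ : (Fin n → ℂ) → (Fin n → ℂ)}
  {g : (Fin n → ℂ) → Matrix (Fin n) (Fin n) ℂ}

theorem smooth_jacobian (hU : IsOpen U) (hφ : DifferentiableOn ℂ φ U) (c i : Fin n) :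
    ContDiffOn ℝ ∞ (fun z => jacobian φ z c i) U :=
  (smooth_of_holomorphic hU (holomorphic_dz hU (holomorphic_apply hφ c) i)).congr
    (jacobian_eq_dz hU hφ c i)

theorem dzbar_jacobian (hU : IsOpen U) (hφ : DifferentiableOn ℂ φ U) (c i l : Fin n)
    {z : Fin n → ℂ} (hz : z ∈ U) : dzbar l (fun z => jacobian φ z c i) z = 0 := by
  rw [(isDerivationOn_dzbar hU l).congr _ _ (jacobian_eq_dz hU hφ c i) hz]
  exact dzbar_of_holomorphic hU (holomorphic_dz hU (holomorphic_apply hφ c) i) l hz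

theorem dz_jacobian_comm (hU : IsOpen U) (hφ : DifferentiableOn ℂ φ U) (c i l : Fin n)
    {z : Fin n → ℂ} (hz : z ∈ U) :
    dz l (fun z => jacobian φ z c i) z = dz i (fun z => jacobian φ z c l) z := by
  rw [(isDerivationOn_dz hU l).congr _ _ (jacobian_eq_dz hU hφ c i) hz,
    (isDerivationOn_dz hU i).congr _ _ (jacobian_eq_dz hU hφ c l) hz]
  simp only [dz_eq_wirtinger]
  exact wirtinger_comm hU (smooth_of_holomorphic hU (holomorphic_apply hφ c)) _ _ l i hz

theorem pullback_eq_mul (φ : (Fin n → ℂ) → (Fin n → ℂ))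
    (g : (Fin n → ℂ) → Matrix (Fin n) (Fin n) ℂ) (z : Fin n → ℂ) :
    pullback φ g z = (jacobian φ z).transpose * g (φ z) * star (jacobian φ z).transpose := by
  ext i j
  simp only [pullback, Matrix.mul_apply, Matrix.transpose_apply, Matrix.star_apply,
    Finset.sum_mul]
  rw [Finset.sum_comm]
  exact Finset.sum_congr rfl fun q _ => Finset.sum_congr rfl fun p _ => by ring

/-- For closedness, `∂_l` of the pullback has two parts: one with `∂g`, symmetric by the Kähler
condition for `g`, and one with second derivatives of `φ`, symmetric because derivatives commute.
The conjugate Jacobian factor is annihilated by `∂_l`. -/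
theorem isKahlerOn_pullback (hU : IsOpen U) (hφ : DifferentiableOn ℂ φ U)
    (hUV : Set.MapsTo φ U V) (hg : IsKahlerOn g V) (hJ : ∀ z ∈ U, IsUnit (jacobian φ z)) :
    IsKahlerOn (pullback φ g) U where
  isOpen := hU
  smooth i j := ContDiffOn.sum fun p _ => ContDiffOn.sum fun q _ =>
    ((smooth_comp hU hφ hUV (hg.smooth p q)).mul (smooth_jacobian hU hφ p i)).mul
      (smooth_star (smooth_jacobian hU hφ q j))
  posDef z hz := by
    rw [pullback_eq_mul]
    have h : IsUnit (jacobian φ z).transpose := (Matrix.isUnit_transpose _).2 (hJ z hz)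
    exact (Matrix.IsUnit.posDef_star_right_conjugate_iff h).2 (hg.posDef _ (hUV hz))
  closed z hz i j l := by
    have hd := isDerivationOn_dz hU
    have hs1 : ∀ p q, ContDiffOn ℝ ∞ (fun z => g (φ z) p q) U := fun p q =>
      smooth_comp hU hφ hUV (hg.smooth p q)
    have hs2 := smooth_jacobian hU hφ
    have hs3 : ∀ q j, ContDiffOn ℝ ∞ (fun z => star (jacobian φ z q j)) U := fun q j =>
      smooth_star (hs2 q j)
    have key : ∀ i l, dz l (fun w => pullback φ g w i j) z =
        ∑ q, (∑ p, ∑ c, jacobian φ z c l * jacobian φ z p i * dz c (fun w => g w p q) (φ z)) *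
          star (jacobian φ z q j) + ∑ q, ∑ p, g (φ z) p q *
            dz l (fun w => jacobian φ w p i) z * star (jacobian φ z q j) := fun i l => by
      simp only [pullback]
      rw [(hd l).sum _ _ (fun p _ => ContDiffOn.sum fun q _ =>
        ((hs1 p q).mul (hs2 p i)).mul (hs3 q j)) hz]
      rw [← Finset.sum_add_distrib]
      simp only [Finset.sum_mul, ← Finset.sum_add_distrib]
      rw [Finset.sum_comm]
      refine Finset.sum_congr rfl fun p _ => ?_
      rw [(hd l).sum _ _ (fun q _ => ((hs1 p q).mul (hs2 p i)).mul (hs3 q j)) hz]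
      refine Finset.sum_congr rfl fun q _ => ?_
      rw [(hd l).mul _ _ ((hs1 p q).mul (hs2 p i)) (hs3 q j) z hz,
        (hd l).mul _ _ (hs1 p q) (hs2 p i) z hz,
        dz_comp hU hg.isOpen hφ hUV (hg.smooth p q) hz, dz_star, dzbar_jacobian hU hφ _ _ _ hz]
      simp only [star_zero, mul_zero, add_zero, add_mul, Finset.sum_mul]
      congr 1
      exact Finset.sum_congr rfl fun c _ => by ring
    rw [key, key]
    congr 1
    · refine Finset.sum_congr rfl fun q _ => ?_
      congr 1
      rw [Finset.sum_comm]
      refine Finset.sum_congr rfl fun p _ => Finset.sum_congr rfl fun c _ => ?_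
      rw [hg.closed _ (hUV hz) c q p]
      ring
    · refine Finset.sum_congr rfl fun q _ => Finset.sum_congr rfl fun p _ => ?_
      rw [dz_jacobian_comm hU hφ p i l hz]

variable {ι ι' : Type} [LinearOrder ι] [LinearOrder ι']

/-- The derivative of the component `φ_c` with respect to the coordinates with the indices `a i`,
`i ∈ C`. -/
def blockWeight (φ : (Fin n → ℂ) → (Fin n → ℂ)) (a : ι → Fin n) (z : Fin n → ℂ) (C : Finset ι)
    (c : Fin n) : ℂ :=
  iterDz ((C.sort (· ≤ ·)).map a) (fun w => φ w c) z

theorem holomorphic_blockWeight (hU : IsOpen U) (hφ : DifferentiableOn ℂ φ U) (a : ι → Fin n)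
    (C : Finset ι) (c : Fin n) : DifferentiableOn ℂ (fun z => blockWeight φ a z C c) U :=
  holomorphic_iterDz hU (holomorphic_apply hφ c) _

/-- An index below all of `C` comes first in the sorted list, hence is the outermost derivative, and
nothing has to be commuted. For this reason indices are always added at the bottom. -/
theorem dz_blockWeight (a : ι → Fin n) {C : Finset ι} {i : ι} (hi : ∀ x ∈ C, i < x) (c : Fin n)
    (z : Fin n → ℂ) :
    dz (a i) (fun z => blockWeight φ a z C c) z = blockWeight φ a z (insert i C) c := by
  have h : (insert i C).sort (· ≤ ·) = i :: C.sort (· ≤ ·) :=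
    Finset.sort_insert _ (fun b hb => (hi b hb).le) fun h => lt_irrefl i (hi i h)
  simp only [blockWeight, h, List.map_cons]
  rfl

theorem blockWeight_singleton (hU : IsOpen U) (hφ : DifferentiableOn ℂ φ U) (a : ι → Fin n)
    (i : ι) (c : Fin n) {z : Fin n → ℂ} (hz : z ∈ U) :
    blockWeight φ a z {i} c = jacobian φ z c (a i) := by
  rw [blockWeight, Finset.sort_singleton]
  exact (jacobian_eq_dz hU hφ c (a i) hz).symm

/-- The sum over the set partitions of the barred indices in the derivative of a pullback. -/
def barSum (φ : (Fin n → ℂ) → (Fin n → ℂ)) (g : (Fin n → ℂ) → Matrix (Fin n) (Fin n) ℂ)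
    (b : ι' → Fin n) (B : Finset ι') (z : Fin n → ℂ) (α : Multiset (Fin n)) : ℂ :=
  blockSum (fun C c => star (blockWeight φ b z C c)) (fun β => kahlerDeriv g α β (φ z)) B

variable {a : ι → Fin n} {b : ι' → Fin n} {A : Finset ι} {B : Finset ι'} {α : Multiset (Fin n)}

theorem smooth_star_blockWeight (hU : IsOpen U) (hφ : DifferentiableOn ℂ φ U) (b : ι' → Fin n)
    (C : Finset ι') (c : Fin n) :
    ContDiffOn ℝ ∞ (fun z => star (blockWeight φ b z C c)) U :=
  smooth_star (smooth_of_holomorphic hU (holomorphic_blockWeight hU hφ b C c))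

theorem smooth_kahlerDeriv_comp (hU : IsOpen U) (hφ : DifferentiableOn ℂ φ U)
    (hUV : Set.MapsTo φ U V) (hg : IsKahlerOn g V) (hα : α ≠ 0) (hB : B.Nonempty)
    (β : Multiset (Fin n)) (hβ : β ≠ 0 ∨ B = ∅) :
    ContDiffOn ℝ ∞ (fun z => kahlerDeriv g α β (φ z)) U :=
  smooth_comp hU hφ hUV (hg.smooth_kahlerDeriv hα (hβ.resolve_right hB.ne_empty))

theorem smooth_barSum (hU : IsOpen U) (hφ : DifferentiableOn ℂ φ U) (hUV : Set.MapsTo φ U V)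
    (hg : IsKahlerOn g V) (hα : α ≠ 0) (hB : B.Nonempty) :
    ContDiffOn ℝ ∞ (fun z => barSum φ g b B z α) U :=
  smooth_blockSum (fun C _ _ c => smooth_star_blockWeight hU hφ b C c)
    (smooth_kahlerDeriv_comp hU hφ hUV hg hα hB)

/-- The conjugated block weights are antiholomorphic, so an unbarred derivative acts on the metric
factor alone. -/
theorem dz_barSum (hU : IsOpen U) (hφ : DifferentiableOn ℂ φ U) (hUV : Set.MapsTo φ U V)
    (hg : IsKahlerOn g V) (hα : α ≠ 0) (hB : B.Nonempty) (i : Fin n) {z : Fin n → ℂ}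
    (hz : z ∈ U) :
    dz i (fun z => barSum φ g b B z α) z =
      ∑ c, jacobian φ z c i * barSum φ g b B z (c ::ₘ α) := by
  have h := (isDerivationOn_dz hU i).blockSum_const (A := B)
    (S := fun z C c => star (blockWeight φ b z C c)) (F := fun z β => kahlerDeriv g α β (φ z))
    (F' := fun z β => ∑ c, jacobian φ z c i * kahlerDeriv g (c ::ₘ α) β (φ z))
    (fun C _ _ c => smooth_star_blockWeight hU hφ b C c)
    (smooth_kahlerDeriv_comp hU hφ hUV hg hα hB)
    (fun C _ _ c z hz => by
      rw [dz_star, dzbar_of_holomorphic hU (holomorphic_blockWeight hU hφ b C c) i hz, star_zero])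
    (fun β hβ z hz => by
      have hβ := hβ.resolve_right hB.ne_empty
      rw [dz_comp hU hg.isOpen hφ hUV (hg.smooth_kahlerDeriv hα hβ) hz]
      refine Finset.sum_congr rfl fun c _ => ?_
      rw [hg.dz_kahlerDeriv hα hβ c (hUV hz)]) hz
  refine h.trans ?_
  rw [blockSum_sum]
  rfl

/-- A barred derivative either falls on a block weight, so that `j` joins this block, or on the
metric factor, so that `j` forms a new block. -/
theorem dzbar_barSum (hU : IsOpen U) (hφ : DifferentiableOn ℂ φ U) (hUV : Set.MapsTo φ U V)
    (hg : IsKahlerOn g V) (hα : α ≠ 0) (hB : B.Nonempty) {j : ι'} (hj : ∀ x ∈ B, j < x)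
    {z : Fin n → ℂ} (hz : z ∈ U) :
    dzbar (b j) (fun z => barSum φ g b B z α) z = barSum φ g b (insert j B) z α := by
  refine (isDerivationOn_dzbar hU (b j)).blockSum_insert (A := B) (a := j)
    (S := fun z C c => star (blockWeight φ b z C c)) (F := fun z β => kahlerDeriv g α β (φ z)) hj
    (fun C _ _ c => smooth_star_blockWeight hU hφ b C c)
    (smooth_kahlerDeriv_comp hU hφ hUV hg hα hB)
    (fun C hC _ c z hz => by
      rw [dzbar_star, dz_blockWeight b (fun x hx => hj x (hC hx))])
    (fun β hβ z hz => ?_) hz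
  have hβ := hβ.resolve_right hB.ne_empty
  rw [dzbar_comp hU hg.isOpen hφ hUV (hg.smooth_kahlerDeriv hα hβ) hz]
  refine Finset.sum_congr rfl fun c _ => ?_
  rw [hg.dzbar_kahlerDeriv hα hβ c (hUV hz), blockWeight_singleton hU hφ b j c hz]

theorem barSum_singleton (hU : IsOpen U) (hφ : DifferentiableOn ℂ φ U) (j : ι') {z : Fin n → ℂ}
    (hz : z ∈ U) (α : Multiset (Fin n)) :
    barSum φ g b {j} z α = ∑ c, star (jacobian φ z c (b j)) * kahlerDeriv g α {c} (φ z) := by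
  have h := blockSum_insert (fun C c => star (blockWeight φ b z C c))
    (fun β => kahlerDeriv g α β (φ z)) (a := j) (A := ∅) (by simp)
  simp only [insert_empty_eq, Finset.powerset_empty, Finset.sum_singleton, Finset.sdiff_empty,
    blockSum_empty, Multiset.cons_zero] at h
  rw [barSum, h]
  exact Finset.sum_congr rfl fun c _ => by rw [blockWeight_singleton hU hφ b j c hz]

theorem map_insert_val {ι κ : Type} [DecidableEq ι] (a : ι → κ) {C : Finset ι} {i : ι}
    (hi : i ∉ C) : (insert i C).val.map a = a i ::ₘ C.val.map a := by
  rw [Finset.insert_val_of_notMem hi, Multiset.map_cons]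

theorem map_val_ne_zero {ι κ : Type} (a : ι → κ) {C : Finset ι} (hC : C.Nonempty) :
    C.val.map a ≠ 0 := by
  rw [Ne, Multiset.map_eq_zero, Finset.val_eq_zero]
  exact hC.ne_empty

variable (hU : IsOpen U) (hφ : DifferentiableOn ℂ φ U) (hUV : Set.MapsTo φ U V)
  (hg : IsKahlerOn g V) (hh : IsKahlerOn (pullback φ g) U)
include hU hφ hUV hg hh

theorem kahlerDeriv_pullback_singleton (i : Fin n) (hB : B.Nonempty) :
    Set.EqOn (kahlerDeriv (pullback φ g) {i} (B.val.map b))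
      (fun z => ∑ c, jacobian φ z c i * barSum φ g b B z {c}) U := by
  induction B using Finset.induction_on_min with
  | empty => exact absurd hB Finset.not_nonempty_empty
  | insert j B hj ih =>
    intro z hz
    rcases B.eq_empty_or_nonempty with rfl | hne
    · have h1 : ((insert j ∅ : Finset ι').val.map b) = {b j} := rfl
      rw [h1, hh.kahlerDeriv_singleton i (b j) hz]
      simp only [pullback, insert_empty_eq, barSum_singleton hU hφ j hz, Finset.mul_sum]
      refine Finset.sum_congr rfl fun p _ => Finset.sum_congr rfl fun q _ => ?_
      rw [hg.kahlerDeriv_singleton p q (hUV hz)]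
      ring
    · have hd := isDerivationOn_dzbar hU (b j)
      rw [map_insert_val b fun h => lt_irrefl j (hj j h),
        ← hh.dzbar_kahlerDeriv (Multiset.singleton_ne_zero i) (map_val_ne_zero b hne) (b j) hz,
        hd.congr _ _ (ih hne) hz,
        hd.sum _ _ (fun c _ => (smooth_jacobian hU hφ c i).mul
          (smooth_barSum hU hφ hUV hg (Multiset.singleton_ne_zero c) hne)) hz]
      refine Finset.sum_congr rfl fun c _ => ?_
      rw [hd.mul _ _ (smooth_jacobian hU hφ c i)
        (smooth_barSum hU hφ hUV hg (Multiset.singleton_ne_zero c) hne) z hz,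
        dzbar_jacobian hU hφ c i _ hz, zero_mul, zero_add,
        dzbar_barSum hU hφ hUV hg (Multiset.singleton_ne_zero c) hne hj hz]

/-- The formula of Faà di Bruno for the mixed derivatives of a metric in new coordinates. -/
theorem kahlerDeriv_pullback (hA : A.Nonempty) (hB : B.Nonempty) :
    Set.EqOn (kahlerDeriv (pullback φ g) (A.val.map a) (B.val.map b))
      (fun z => blockSum (blockWeight φ a z) (barSum φ g b B z) A) U := by
  induction A using Finset.induction_on_min with
  | empty => exact absurd hA Finset.not_nonempty_empty
  | insert i A hi ih =>
    intro z hz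
    rcases A.eq_empty_or_nonempty with rfl | hne
    · have h1 : ((insert i ∅ : Finset ι).val.map a) = {a i} := rfl
      rw [h1, kahlerDeriv_pullback_singleton hU hφ hUV hg hh (a i) hB hz]
      simp only
      rw [blockSum_insert _ _ (by simp)]
      simp only [insert_empty_eq, Finset.powerset_empty, Finset.sum_singleton,
        Finset.sdiff_empty, blockSum_empty, Multiset.cons_zero,
        blockWeight_singleton hU hφ a i _ hz]
    · have hd := isDerivationOn_dz hU (a i)
      rw [map_insert_val a fun h => lt_irrefl i (hi i h),
        ← hh.dz_kahlerDeriv (map_val_ne_zero a hne) (map_val_ne_zero b hB) (a i) hz,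
        hd.congr _ _ (ih hne) hz]
      refine hd.blockSum_insert hi
        (fun C _ _ c => smooth_of_holomorphic hU (holomorphic_blockWeight hU hφ a C c))
        (fun α hα => smooth_barSum hU hφ hUV hg (hα.resolve_right hne.ne_empty) hB)
        (fun C hC _ c z _ => dz_blockWeight a (fun x hx => hi x (hC hx)) c z)
        (fun α hα z hz => ?_) hz
      rw [dz_barSum hU hφ hUV hg (hα.resolve_right hne.ne_empty) hB _ hz]
      exact Finset.sum_congr rfl fun c _ => by rw [blockWeight_singleton hU hφ a i c hz]

end Pullback

/-! ### The tree sum computes derivatives in normal coordinates -/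

section TreeSum

variable {n k m : ℕ} {U V : Set (Fin n → ℂ)} {φ : (Fin n → ℂ) → (Fin n → ℂ)}
  {g : (Fin n → ℂ) → Matrix (Fin n) (Fin n) ℂ}

/-- The vanishing pure derivatives say that the block weights of `φ` solve the recursion unfolded by
hierarchies; the Jacobian matrix `1` gives its initial values. The tree sum then becomes the Faà di
Bruno expansion of the mixed derivative. The metric at the point need not be the identity, since the
inverse metric in the recursion takes care of it. -/
theorem eval_treeSum_of_pure_eq_zero (hk : 2 ≤ k) (hm : 2 ≤ m) (hφ : DifferentiableOn ℂ φ U)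
    (hUV : Set.MapsTo φ U V) (hg : IsKahlerOn g V) (hh : IsKahlerOn (pullback φ g) U)
    {z : Fin n → ℂ} (hz : z ∈ U) (hJ : jacobian φ z = 1)
    (hpure : ∀ (α : Multiset (Fin n)) (j : Fin n), 2 ≤ α.card → α.card ≤ k →
      kahlerDeriv (pullback φ g) α {j} z = 0)
    (hpure' : ∀ (i : Fin n) (β : Multiset (Fin n)), 2 ≤ β.card → β.card ≤ m →
      kahlerDeriv (pullback φ g) {i} β z = 0)
    (a : Fin k → Fin n) (b : Fin m → Fin n) :
    (treeSum n k m).eval g (φ z) a b =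
      metricDeriv (pullback φ g) (List.ofFn a) (List.ofFn b) z := by
  have hU := hh.isOpen
  have : NeZero m := ⟨by omega⟩
  have : NeZero k := ⟨by omega⟩
  set val := MetricVar.value g (φ z) with hval
  have hdet : IsUnit (g (φ z)).det := (hg.posDef _ (hUV hz)).det_pos.ne'.isUnit
  have hone : ∀ c i, jacobian φ z c i = if c = i then 1 else 0 := fun c i => by
    rw [hJ, Matrix.one_apply]
  have hG : ∀ i j, val (.deriv {i} {j}) = g (φ z) i j := fun i j =>
    hg.kahlerDeriv_singleton i j (hUV hz)
  -- With Jacobian matrix `1`, the expansion of a pure barred derivative consists of a single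
  -- `barSum`.
  have hbar0 : ∀ C : Finset (Fin m), 2 ≤ C.card → ∀ i, barSum φ g b C z {i} = 0 := by
    intro C hC i
    have h := kahlerDeriv_pullback_singleton hU hφ hUV hg hh (b := b) i
      (Finset.card_pos.1 (by omega : 0 < C.card)) hz
    rw [hpure' i _ (by simpa using hC) (by simpa using C.card_le_univ)] at h
    simpa [hone] using h.symm
  -- Solve `hbar0` for the weight of the full block: that weight is multiplied by the metric, and
  -- contraction with the inverse metric isolates it.
  have hbar : ∀ C ⊆ (Finset.univ : Finset (Fin m)), 2 ≤ C.card → ∀ s,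
      star (blockWeight φ b z C s) =
        -properBlockSum (fun C c => star (blockWeight φ b z C c)) (outVertex val s) C := by
    intro C _ hC s
    have hne : C.Nonempty := Finset.card_pos.1 (by omega)
    have h1 : ∀ r, properBlockSum (fun C c => star (blockWeight φ b z C c))
        (fun β => val (.deriv {r} β)) C = -∑ c, star (blockWeight φ b z C c) * g (φ z) r c := by
      intro r
      have h := hbar0 C hC r
      rw [barSum, blockSum_eq_proper_add _ _ hne] at h
      rw [eq_neg_iff_add_eq_zero, ← h]
      congr 1
      refine Finset.sum_congr rfl fun c _ => ?_
      rw [← hG]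
      rfl
    have h2 : outVertex val s = fun β => ∑ r, val (.inv r s) * val (.deriv {r} β) := rfl
    rw [h2, properBlockSum_sum _ _ _ _ hne]
    simp only [h1, mul_neg, Finset.sum_neg_distrib, neg_neg, Finset.mul_sum]
    rw [Finset.sum_comm]
    have h3 : ∀ c, ∑ r, val (.inv r s) * (star (blockWeight φ b z C c) * g (φ z) r c) =
        star (blockWeight φ b z C c) * ((g (φ z))⁻¹ * g (φ z)) s c := fun c => by
      rw [Matrix.mul_apply, Finset.mul_sum]
      refine Finset.sum_congr rfl fun r _ => ?_
      simp only [hval, MetricVar.value]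
      ring
    simp only [h3, Matrix.nonsing_inv_mul _ hdet, Matrix.one_apply]
    simp
  have hunb : ∀ C ⊆ (Finset.univ : Finset (Fin k)), 2 ≤ C.card → ∀ r,
      blockWeight φ a z C r = -properBlockSum (blockWeight φ a z) (inVertex val r) C := by
    intro C _ hC r
    have hne : C.Nonempty := Finset.card_pos.1 (by omega)
    have h1 : ∀ s, properBlockSum (blockWeight φ a z)
        (fun α => val (.deriv α {s})) C = -∑ c, blockWeight φ a z C c * g (φ z) c s := by
      intro s
      -- A single barred index is presented as a family over `Fin 1`, so that the general formula
      -- covers pure unbarred derivatives.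
      have h := kahlerDeriv_pullback hU hφ hUV hg hh (a := a) (b := fun _ : Fin 1 => s) hne
        (Finset.singleton_nonempty 0) hz
      have h4 : (({0} : Finset (Fin 1)).val.map fun _ => s) = {s} := rfl
      rw [h4, hpure _ s (by simpa using hC) (by simpa using C.card_le_univ)] at h
      have h5 : barSum φ g (fun _ : Fin 1 => s) {0} z = fun α => val (.deriv α {s}) := by
        funext α
        rw [barSum_singleton hU hφ 0 hz]
        simp only [hone, hval]
        simp [MetricVar.value, kahlerDeriv]
      simp only [h5] at h
      rw [blockSum_eq_proper_add _ _ hne] at h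
      rw [eq_neg_iff_add_eq_zero, h]
      congr 1
      exact Finset.sum_congr rfl fun c _ => by rw [hG]
    have h2 : inVertex val r = fun α => ∑ s, val (.inv r s) * val (.deriv α {s}) := rfl
    rw [h2, properBlockSum_sum _ _ _ _ hne]
    simp only [h1, mul_neg, Finset.sum_neg_distrib, neg_neg, Finset.mul_sum]
    rw [Finset.sum_comm]
    have h3 : ∀ c, ∑ s, val (.inv r s) * (blockWeight φ a z C c * g (φ z) c s) =
        blockWeight φ a z C c * (g (φ z) * (g (φ z))⁻¹) c r := fun c => by
      rw [Matrix.mul_apply, Finset.mul_sum]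
      refine Finset.sum_congr rfl fun s _ => ?_
      simp only [hval, MetricVar.value]
      ring
    simp only [h3, Matrix.mul_nonsing_inv _ hdet, Matrix.one_apply]
    simp
  have hS1 : ∀ j ∈ (Finset.univ : Finset (Fin k)), ∀ c,
      blockWeight φ a z {j} c = if c = a j then 1 else 0 := fun j _ c => by
    rw [blockWeight_singleton hU hφ a j c hz, hone]
  have hS2 : ∀ j ∈ (Finset.univ : Finset (Fin m)), ∀ c,
      star (blockWeight φ b z {j} c) = if c = b j then 1 else 0 := fun j _ c => by
    rw [blockWeight_singleton hU hφ b j c hz, hone]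
    split_ifs <;> simp
  have hF : (fun α => forestSum (outVertex val) b (fun β => val (.deriv α β)) Finset.univ) =
      barSum φ g b Finset.univ z := by
    funext α
    rw [forestSum_eq_blockSum hS2 hbar]
    rfl
  have hk' : (Finset.univ : Finset (Fin k)).Nonempty := Finset.univ_nonempty
  have hm' : (Finset.univ : Finset (Fin m)).Nonempty := Finset.univ_nonempty
  rw [PolyTensor.eval, eval_treeSum hk, hF,
    properForestSum_eq_properBlockSum (by simpa using hk) hS1 hunb]
  have h6 := kahlerDeriv_pullback hU hφ hUV hg hh (a := a) (b := b) hk' hm' hz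
  simp only at h6
  rw [Fin.univ_val_map, Fin.univ_val_map, hh.kahlerDeriv_coe _ _ hz,
    blockSum_eq_proper_add _ _ hk'] at h6
  rw [h6]
  -- The terms with all unbarred legs in one block contain `barSum` at a single label, which
  -- vanishes because `m ≥ 2`. This is why the tree sum only needs the proper hierarchies on the
  -- unbarred side.
  simp [hbar0 Finset.univ (by simpa using hm)]

end TreeSum

end KahlerTree

end

noncomputable section

namespace KahlerTree

set_option linter.unusedSectionVars false

/-! ### Iterated derivatives of a composition of holomorphic functions -/

section Composition

/-- Only label multisets of size at most `A.card` occur, so it is enough that two functions agree to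
finite order; needed because jets are prescribed to finite order only. -/
theorem blockSum_congr_value {ι κ : Type} [LinearOrder ι] [Fintype κ] (S : Finset ι → κ → ℂ)
    {F F' : Multiset κ → ℂ} {A : Finset ι}
    (h : ∀ α, α.card ≤ A.card → α ≠ 0 ∨ A = ∅ → F α = F' α) :
    blockSum S F A = blockSum S F' A := by
  induction hn : A.card using Nat.strong_induction_on generalizing A F F' with
  | _ N ih =>
    rcases A.eq_empty_or_nonempty with rfl | hne
    · rw [blockSum_empty, blockSum_empty]
      exact h 0 (by simp) (Or.inr rfl)
    obtain ⟨m, B, hB, rfl, hmB⟩ := exists_insert_lt hne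
    rw [blockSum_insert _ _ hB, blockSum_insert _ _ hB]
    refine Finset.sum_congr rfl fun D _ => Finset.sum_congr rfl fun c _ => ?_
    have hlt : (B \ D).card ≤ B.card := Finset.card_le_card Finset.sdiff_subset
    have hc : (insert m B).card = B.card + 1 := Finset.card_insert_of_notMem hmB
    rw [ih _ (by omega) (F := fun α => F (c ::ₘ α)) (F' := fun α => F' (c ::ₘ α))
      (fun α hα _ => h _ (by rw [Multiset.card_cons]; omega) (Or.inl Multiset.cons_ne_zero)) rfl]

variable {n : ℕ} {U V : Set (Fin n → ℂ)} {φ : (Fin n → ℂ) → (Fin n → ℂ)} {f : (Fin n → ℂ) → ℂ}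

theorem dz_iterDz_sort (hV : IsOpen V) (hf : ContDiffOn ℝ ∞ f V) (i : Fin n)
    (α : Multiset (Fin n)) :
    Set.EqOn (dz i (iterDz (α.sort (· ≤ ·)) f)) (iterDz ((i ::ₘ α).sort (· ≤ ·)) f) V := by
  have h : (i :: α.sort (· ≤ ·)).Perm ((i ::ₘ α).sort (· ≤ ·)) := by
    rw [← Multiset.coe_eq_coe, Multiset.sort_eq, ← Multiset.cons_coe, Multiset.sort_eq]
  have h1 := iterWirtinger_perm hV hf (-1) h
  rw [← iterDz_eq_iterWirtinger, ← iterDz_eq_iterWirtinger] at h1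
  exact h1

theorem smooth_iterDz (hV : IsOpen V) (hf : ContDiffOn ℝ ∞ f V) (α : List (Fin n)) :
    ContDiffOn ℝ ∞ (iterDz α f) V := by
  rw [iterDz_eq_iterWirtinger]
  exact smooth_iterWirtinger hV hf _ _

theorem iterDz_comp {ι : Type} [LinearOrder ι] (hU : IsOpen U) (hV : IsOpen V)
    (hφ : DifferentiableOn ℂ φ U) (hUV : Set.MapsTo φ U V) (hf : ContDiffOn ℝ ∞ f V)
    (a : ι → Fin n) (A : Finset ι) :
    Set.EqOn (iterDz ((A.sort (· ≤ ·)).map a) fun z => f (φ z))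
      (fun z => blockSum (blockWeight φ a z) (fun α => iterDz (α.sort (· ≤ ·)) f (φ z)) A) U := by
  induction A using Finset.induction_on_min with
  | empty =>
    intro z _
    simp [blockSum_empty, iterDz]
  | insert i A hi ih =>
    intro z hz
    have h : (insert i A).sort (· ≤ ·) = i :: A.sort (· ≤ ·) :=
      Finset.sort_insert _ (fun b hb => (hi b hb).le) fun h => lt_irrefl i (hi i h)
    have hd := isDerivationOn_dz hU (a i)
    rw [h, List.map_cons]
    change dz (a i) (iterDz ((A.sort (· ≤ ·)).map a) fun z => f (φ z)) z = _
    rw [hd.congr _ _ ih hz]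
    refine hd.blockSum_insert hi
      (F := fun z α => iterDz (α.sort (· ≤ ·)) f (φ z))
      (fun C _ _ c => smooth_of_holomorphic hU (holomorphic_blockWeight hU hφ a C c))
      (fun α _ => smooth_comp hU hφ hUV (smooth_iterDz hV hf _))
      (fun C hC _ c z _ => dz_blockWeight a (fun x hx => hi x (hC hx)) c z)
      (fun α _ z hz => ?_) hz
    rw [dz_comp hU hV hφ hUV (smooth_iterDz hV hf _) hz]
    refine Finset.sum_congr rfl fun c _ => ?_
    rw [blockWeight_singleton hU hφ a i c hz, dz_iterDz_sort hV hf c α (hUV hz)]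

theorem iterDz_congr (hU : IsOpen U) {g : (Fin n → ℂ) → ℂ} (hfg : Set.EqOn f g U)
    (α : List (Fin n)) : Set.EqOn (iterDz α f) (iterDz α g) U := by
  rw [iterDz_eq_iterWirtinger]
  exact iterWirtinger_congr hU hfg _ _

theorem iterDz_continuousLinearMap (Λ : (Fin n → ℂ) →L[ℂ] ℂ) {α : List (Fin n)}
    (hα : 2 ≤ α.length) : iterDz α Λ = 0 := by
  have hU : IsOpen (Set.univ : Set (Fin n → ℂ)) := isOpen_univ
  have h1 : ∀ i, dz i Λ = fun _ => Λ (Pi.single i 1) := fun i => by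
    funext z
    rw [dz_of_holomorphic hU Λ.differentiable.differentiableOn i (Set.mem_univ z)]
    simp only [ContinuousLinearMap.fderiv]
  have h2 : ∀ (c : ℂ) (i : Fin n), dz i (fun _ => c) = fun _ => 0 := fun c i => by
    funext z
    exact (isDerivationOn_dz hU i).const c z (Set.mem_univ z)
  have h3 : ∀ l : List (Fin n), 1 ≤ l.length → ∃ c, iterDz l Λ = fun _ => c := by
    intro l hl
    induction l with
    | nil => simp at hl
    | cons i l ih =>
      change ∃ c, dz i (iterDz l Λ) = _
      rcases l with _ | ⟨j, l⟩
      · exact ⟨_, h1 i⟩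
      · obtain ⟨c, hc⟩ := ih (by simp)
        exact ⟨0, by rw [hc, h2]⟩
  rcases α with _ | ⟨i, α⟩
  · simp at hα
  · obtain ⟨c, hc⟩ := h3 α (by simpa using hα)
    change dz i (iterDz α Λ) = _
    rw [hc, h2]
    rfl

end Composition

/-! ### Polynomials with prescribed derivatives at a point -/

section Jet

variable {n : ℕ}

/-- The Taylor coefficient of `P` multiplied by the factorials. -/
def jetCoeff (P : MvPolynomial (Fin n) ℂ) (s : Fin n →₀ ℕ) : ℂ :=
  (∏ i, ((s i).factorial : ℂ)) * P.coeff s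

/-- With the factorials included, differentiation is a mere shift of exponents, so iterated
derivatives at the center can be read off directly. -/
theorem jetCoeff_pderiv (P : MvPolynomial (Fin n) ℂ) (i : Fin n) (s : Fin n →₀ ℕ) :
    jetCoeff (MvPolynomial.pderiv i P) s = jetCoeff P (s + Finsupp.single i 1) := by
  have h : ∏ j, (((s + Finsupp.single i 1 : Fin n →₀ ℕ) j).factorial : ℂ) =
      (s i + 1) * ∏ j, ((s j).factorial : ℂ) := by
    rw [← Finset.mul_prod_erase _ _ (Finset.mem_univ i),
      ← Finset.mul_prod_erase _ (fun j => ((s j).factorial : ℂ)) (Finset.mem_univ i), ← mul_assoc]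
    congr 1
    · simp [Nat.factorial_succ]
    · refine Finset.prod_congr rfl fun j hj => ?_
      simp [(Finset.ne_of_mem_erase hj).symm]
  rw [jetCoeff, jetCoeff, h, MvPolynomial.coeff_pderiv]
  ring

theorem differentiable_eval (P : MvPolynomial (Fin n) ℂ) (p : Fin n → ℂ) :
    Differentiable ℂ fun w => MvPolynomial.eval (w - p) P := by
  induction P using MvPolynomial.induction_on with
  | C a => simp
  | add P Q hP hQ =>
    simp only [map_add]
    exact hP.add hQ
  | mul_X P j hP =>
    simp only [map_mul, MvPolynomial.eval_X, Pi.sub_apply]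
    exact hP.mul (by fun_prop)

theorem dz_eval (P : MvPolynomial (Fin n) ℂ) (p : Fin n → ℂ) (i : Fin n) :
    dz i (fun w => MvPolynomial.eval (w - p) P) =
      fun w => MvPolynomial.eval (w - p) (MvPolynomial.pderiv i P) := by
  have hd := isDerivationOn_dz (isOpen_univ : IsOpen (Set.univ : Set (Fin n → ℂ))) i
  have hs : ∀ P : MvPolynomial (Fin n) ℂ,
      ContDiffOn ℝ ∞ (fun w => MvPolynomial.eval (w - p) P) Set.univ := fun P =>
    smooth_of_holomorphic isOpen_univ (differentiable_eval P p).differentiableOn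
  induction P using MvPolynomial.induction_on with
  | C a =>
    funext z
    simpa using hd.const a z (Set.mem_univ z)
  | add P Q hP hQ =>
    funext z
    simp only [map_add]
    rw [hd.add _ _ (hs P) (hs Q) z (Set.mem_univ z), hP, hQ]
  | mul_X P j hP =>
    funext z
    have hX : DifferentiableOn ℂ (fun w : Fin n → ℂ => MvPolynomial.eval (w - p) (.X j))
        Set.univ := (differentiable_eval _ p).differentiableOn
    simp only [map_mul]
    rw [hd.mul _ _ (hs P) (hs (.X j)) z (Set.mem_univ z), hP,
      dz_of_holomorphic isOpen_univ hX i (Set.mem_univ z), MvPolynomial.pderiv_mul]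
    have h1 : HasFDerivAt (fun w : Fin n → ℂ => w j - p j)
        (ContinuousLinearMap.proj (R := ℂ) (φ := fun _ : Fin n => ℂ) j) z :=
      (ContinuousLinearMap.hasFDerivAt
        (ContinuousLinearMap.proj (R := ℂ) (φ := fun _ : Fin n => ℂ) j)).sub_const _
    simp only [MvPolynomial.eval_X, Pi.sub_apply, h1.fderiv, MvPolynomial.pderiv_X, map_add,
      map_mul, ContinuousLinearMap.proj_apply]
    rcases eq_or_ne i j with rfl | hij
    · simp
    · simp [Pi.single_eq_of_ne hij.symm]

theorem exists_holomorphic_jet (p : Fin n → ℂ) (c : Multiset (Fin n) → ℂ) (N : ℕ) :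
    ∃ h : (Fin n → ℂ) → ℂ, Differentiable ℂ h ∧
      ∀ l : List (Fin n), l.length ≤ N → iterDz l h p = c l := by
  classical
  -- The Taylor polynomial with the prescribed derivatives. The box of exponents at most `N` in each
  -- variable contains all exponents of total degree at most `N`.
  set P : MvPolynomial (Fin n) ℂ :=
    ∑ s ∈ Finset.Iic (Finsupp.equivFunOnFinite.symm fun _ : Fin n => N),
      MvPolynomial.monomial s (c (Finsupp.toMultiset s) / ∏ i, ((s i).factorial : ℂ)) with hP
  have hcoeff : ∀ s : Fin n →₀ ℕ, (∀ i, s i ≤ N) → jetCoeff P s = c (Finsupp.toMultiset s) := by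
    intro s hs
    have h0 : ∏ i, ((s i).factorial : ℂ) ≠ 0 :=
      Finset.prod_ne_zero_iff.2 fun i _ => Nat.cast_ne_zero.2 (Nat.factorial_ne_zero _)
    rw [jetCoeff, hP, MvPolynomial.coeff_sum, Finset.sum_eq_single s]
    · rw [MvPolynomial.coeff_monomial, if_pos rfl, mul_div_cancel₀ _ h0]
    · intro t _ ht
      rw [MvPolynomial.coeff_monomial, if_neg ht]
    · intro h
      exact absurd (Finset.mem_Iic.2 fun i => hs i) h
  have hiter : ∀ (l : List (Fin n)), iterDz l (fun w => MvPolynomial.eval (w - p) P) =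
      fun w => MvPolynomial.eval (w - p) (l.foldr (fun i => MvPolynomial.pderiv i) P) := by
    intro l
    induction l with
    | nil => rfl
    | cons i l ih =>
      change dz i (iterDz l _) = _
      rw [ih, dz_eval]
      rfl
  have hjet : ∀ (l : List (Fin n)) (s : Fin n →₀ ℕ),
      jetCoeff (l.foldr (fun i => MvPolynomial.pderiv i) P) s =
        jetCoeff P (s + Multiset.toFinsupp (l : Multiset (Fin n))) := by
    intro l
    induction l with
    | nil => simp
    | cons i l ih =>
      intro s
      rw [List.foldr_cons, jetCoeff_pderiv, ih, ← Multiset.cons_coe, ← Multiset.singleton_add,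
        map_add, Multiset.toFinsupp_singleton, add_assoc]
  refine ⟨_, differentiable_eval P p, fun l hl => ?_⟩
  rw [hiter]
  simp only [sub_self]
  have h1 := hjet l 0
  rw [zero_add, hcoeff _ fun i => ?_, Multiset.toFinsupp_toMultiset, jetCoeff] at h1
  · rw [← h1, ← MvPolynomial.constantCoeff_eq, MvPolynomial.eval_zero]
    simp
  · rw [Multiset.toFinsupp_apply]
    exact (Multiset.count_le_card _ _).trans (by simpa using hl)

end Jet

end KahlerTree

end

noncomputable section

namespace KahlerTree

/-! ### Existence of normal coordinates -/

section Jacobian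

variable {n : ℕ} {U V : Set (Fin n → ℂ)} {φ ψ : (Fin n → ℂ) → (Fin n → ℂ)}

theorem fderiv_eq_jacobian_mulVec (φ : (Fin n → ℂ) → (Fin n → ℂ)) (z v : Fin n → ℂ) :
    fderiv ℂ φ z v = (jacobian φ z).mulVec v := by
  have h : v = ∑ i, v i • (Pi.single i 1 : Fin n → ℂ) := by
    funext j
    simp [Finset.sum_apply, Pi.single_apply]
  conv_lhs => rw [h]
  rw [map_sum]
  funext c
  simp only [Finset.sum_apply, map_smul, Pi.smul_apply, smul_eq_mul, Matrix.mulVec, dotProduct,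
    jacobian]
  exact Finset.sum_congr rfl fun i _ => mul_comm _ _

theorem jacobian_comp (hU : IsOpen U) (hV : IsOpen V) (hφ : DifferentiableOn ℂ φ U)
    (hψ : DifferentiableOn ℂ ψ V) (hUV : Set.MapsTo φ U V) {z : Fin n → ℂ} (hz : z ∈ U) :
    jacobian (ψ ∘ φ) z = jacobian ψ (φ z) * jacobian φ z := by
  ext p i
  have h := fderiv_comp z (hψ.differentiableAt (hV.mem_nhds (hUV hz)))
    (hφ.differentiableAt (hU.mem_nhds hz))
  rw [jacobian, h, ContinuousLinearMap.comp_apply, fderiv_eq_jacobian_mulVec]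
  rfl

theorem jacobian_congr (hU : IsOpen U) (h : Set.EqOn φ ψ U) {z : Fin n → ℂ} (hz : z ∈ U) :
    jacobian φ z = jacobian ψ z := by
  ext p i
  have h1 : φ =ᶠ[nhds z] ψ := Filter.eventuallyEq_of_mem (hU.mem_nhds hz) h
  rw [jacobian, jacobian, h1.fderiv_eq]

theorem jacobian_id (z : Fin n → ℂ) : jacobian (fun z => z) z = 1 := by
  ext p i
  rw [jacobian, fderiv_fun_id, Matrix.one_apply]
  simp [Pi.single_apply]

theorem IsBiholomorphic.jacobian_mul (h : IsBiholomorphic φ U V) :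
    ∃ ψ, IsBiholomorphic ψ V U ∧ Set.LeftInvOn ψ φ U ∧ Set.RightInvOn ψ φ V ∧
      ∀ z ∈ U, jacobian ψ (φ z) * jacobian φ z = 1 := by
  obtain ⟨hU, hV, hφ, hUV, ψ, hψ, hVU, hl, hr⟩ := h
  refine ⟨ψ, ⟨hV, hU, hψ, hVU, φ, hφ, hUV, hr, hl⟩, hl, hr, fun z hz => ?_⟩
  rw [← jacobian_comp hU hV hφ hψ hUV hz,
    jacobian_congr hU (φ := ψ ∘ φ) (ψ := fun z => z) (fun w hw => hl hw) hz, jacobian_id]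

theorem IsBiholomorphic.isUnit_jacobian (h : IsBiholomorphic φ U V) {z : Fin n → ℂ}
    (hz : z ∈ U) : IsUnit (jacobian φ z) := by
  obtain ⟨ψ, -, -, -, h1⟩ := h.jacobian_mul
  exact IsUnit.of_mul_eq_one_right _ (h1 z hz)

theorem IsBiholomorphic.isKahlerOn_pullback (h : IsBiholomorphic φ U V)
    {g : (Fin n → ℂ) → Matrix (Fin n) (Fin n) ℂ} (hg : IsKahlerOn g V) :
    IsKahlerOn (pullback φ g) U :=
  KahlerTree.isKahlerOn_pullback h.1 h.2.2.1 h.2.2.2.1 hg fun _ hz => h.isUnit_jacobian hz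

theorem pullback_comp (hU : IsOpen U) (hV : IsOpen V) (hφ : DifferentiableOn ℂ φ U)
    (hψ : DifferentiableOn ℂ ψ V) (hUV : Set.MapsTo φ U V)
    (g : (Fin n → ℂ) → Matrix (Fin n) (Fin n) ℂ) :
    Set.EqOn (pullback φ (pullback ψ g)) (pullback (ψ ∘ φ) g) U := fun z hz => by
  rw [pullback_eq_mul, pullback_eq_mul, pullback_eq_mul, jacobian_comp hU hV hφ hψ hUV hz]
  simp only [Matrix.transpose_mul, star_mul, mul_assoc, Function.comp_apply]

theorem exists_local_inverse {h : (Fin n → ℂ) → (Fin n → ℂ)} (hh : Differentiable ℂ h)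
    {p : Fin n → ℂ} (hV : IsOpen V) (hp : p ∈ V) (hJ : IsUnit (jacobian h p)) :
    ∃ W W' ψ, IsBiholomorphic h W W' ∧ p ∈ W ∧ W ⊆ V ∧ DifferentiableOn ℂ ψ W' ∧
      Set.MapsTo ψ W' W ∧ Set.LeftInvOn ψ h W ∧ Set.RightInvOn ψ h W' := by
  have hc : ContDiff ℂ ∞ h := contDiff_pi.2 fun c => contDiffOn_univ.1
    (contDiffOn_of_differentiableOn isOpen_univ (differentiable_pi.1 hh c).differentiableOn)
  -- Shrinking to the open set where the derivative is invertible makes the local inverse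
  -- holomorphic on all of its domain.
  set D : Set (Fin n → ℂ) := fderiv ℂ h ⁻¹'
    Set.range ((↑) : ((Fin n → ℂ) ≃L[ℂ] (Fin n → ℂ)) → (Fin n → ℂ) →L[ℂ] (Fin n → ℂ)) with hD
  have hDo : IsOpen D :=
    ContinuousLinearEquiv.isOpen.preimage (hc.continuous_fderiv (by simp))
  have hpD : p ∈ D := by
    have hinj : Function.Injective (fderiv ℂ h p : (Fin n → ℂ) →ₗ[ℂ] (Fin n → ℂ)) := by
      have h1 := Matrix.mulVec_injective_iff_isUnit.2 hJ
      intro v w hvw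
      refine h1 ?_
      simpa [fderiv_eq_jacobian_mulVec] using hvw
    refine ⟨(LinearEquiv.ofInjectiveEndo _ hinj).toContinuousLinearEquiv, ?_⟩
    ext v c
    rfl
  obtain ⟨f', hf'⟩ := hpD
  have hd : HasFDerivAt h (f' : (Fin n → ℂ) →L[ℂ] (Fin n → ℂ)) p := by
    rw [hf']
    exact (hh p).hasFDerivAt
  set e := (hc.contDiffAt (x := p)).toOpenPartialHomeomorph h hd (by simp) with he
  have hpe : p ∈ e.source := ContDiffAt.mem_toOpenPartialHomeomorph_source _ hd (by simp)
  set e' := e.restrOpen (V ∩ D) (hV.inter hDo) with he'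
  have hcoe : ∀ x, e' x = h x := fun x => rfl
  have hsrc : e'.source = e.source ∩ (V ∩ D) := e.restrOpen_source _ _
  have hψ : DifferentiableOn ℂ e'.symm e'.target := by
    intro y hy
    have h1 : e'.symm y ∈ e'.source := e'.map_target hy
    rw [hsrc] at h1
    obtain ⟨f₁, hf₁⟩ := h1.2.2
    have h2 : HasFDerivAt e' (f₁ : (Fin n → ℂ) →L[ℂ] (Fin n → ℂ)) (e'.symm y) := by
      rw [hf₁]
      exact (hh _).hasFDerivAt
    exact (e'.hasFDerivAt_symm hy h2).differentiableAt.differentiableWithinAt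
  refine ⟨e'.source, e'.target, e'.symm, ⟨e'.open_source, e'.open_target, hh.differentiableOn,
    fun x hx => e'.map_source hx, e'.symm, hψ, fun y hy => e'.map_target hy,
    fun x hx => e'.left_inv hx, fun y hy => e'.right_inv hy⟩, ?_, ?_, hψ,
    fun y hy => e'.map_target hy,
    fun x hx => e'.left_inv hx, fun y hy => e'.right_inv hy⟩
  · rw [hsrc]
    exact ⟨hpe, hp, f', hf'⟩
  · rw [hsrc]
    exact fun x hx => hx.2.1

end Jacobian

-- Write `A = B^* B` and take the transpose of `L` to be the inverse of `B^*`.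
open scoped MatrixOrder Matrix.Norms.L2Operator in
theorem exists_conj_eq_one {n : ℕ} {A : Matrix (Fin n) (Fin n) ℂ} (hA : A.PosDef) :
    ∃ L : Matrix (Fin n) (Fin n) ℂ, IsUnit L ∧ L.transpose * A * star L.transpose = 1 := by
  obtain ⟨B, hB⟩ := CStarAlgebra.nonneg_iff_eq_star_mul_self.1
    (Matrix.nonneg_iff_posSemidef.2 hA.posSemidef)
  have hBu : IsUnit B.det := by
    have h1 := hA.isUnit
    rw [Matrix.isUnit_iff_isUnit_det, hB, Matrix.det_mul] at h1
    exact isUnit_of_mul_isUnit_right h1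
  have hB' : IsUnit (star B).det := by
    rw [Matrix.star_eq_conjTranspose, Matrix.det_conjTranspose]
    exact hBu.star
  refine ⟨((star B)⁻¹).transpose, ?_, ?_⟩
  · rw [Matrix.isUnit_transpose, Matrix.isUnit_nonsing_inv_iff, Matrix.isUnit_iff_isUnit_det]
    exact hB'
  · have h2 : star (star B)⁻¹ = B⁻¹ := by
      rw [Matrix.star_eq_conjTranspose, Matrix.star_eq_conjTranspose,
        Matrix.conjTranspose_nonsing_inv, Matrix.conjTranspose_conjTranspose]
    rw [Matrix.transpose_transpose, hB, h2, ← mul_assoc, Matrix.nonsing_inv_mul _ hB', one_mul,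
      Matrix.mul_nonsing_inv _ hBu]

section NormalCoordinates

variable {n : ℕ} {U V : Set (Fin n → ℂ)} {g : (Fin n → ℂ) → Matrix (Fin n) (Fin n) ℂ}

theorem IsKahlerOn.kahlerDeriv_bar (hg : IsKahlerOn g U) (i : Fin n) {β : Multiset (Fin n)}
    (hβ : β ≠ 0) :
    Set.EqOn (kahlerDeriv g {i} β) (fun z => star (kahlerDeriv g β {i} z)) U := by
  obtain ⟨j, l, rfl⟩ := exists_list_cons hβ
  intro z hz
  have h1 := hg.kahlerDeriv_coe [i] (j :: l) hz
  have h2 := hg.kahlerDeriv_coe (j :: l) [i] hz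
  rw [Multiset.coe_singleton] at h1 h2
  simp only
  rw [h1, h2, metricDeriv_cons, ← iterDzbar_eq_iterWirtinger]
  have h3 : Set.EqOn (iterDzbar l fun z => g z i j) (iterDzbar l fun z => star (g z j i)) U := by
    rw [iterDzbar_eq_iterWirtinger]
    exact iterWirtinger_congr hg.isOpen (fun w hw => hg.star_apply hw i j) _ _
  exact (h3 hz).trans (congrFun (iterDzbar_star l _) z)

/-- The new coordinates are, up to a linear map, holomorphic functions `h_q` with `∂_α h_q(p) = g_{α
q̄}(p)`. By Faà di Bruno a pure derivative of the pulled back metric is a combination of derivatives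
of the `h_q ∘ φ`, which are linear, so it vanishes from order two on. -/
theorem exists_normal_coordinates (hg : IsKahlerOn g V) {p : Fin n → ℂ} (hp : p ∈ V)
    {L : Matrix (Fin n) (Fin n) ℂ} (hL : IsUnit L) (N : ℕ) :
    ∃ φ U W, IsBiholomorphic φ U W ∧ W ⊆ V ∧ 0 ∈ U ∧ φ 0 = p ∧ jacobian φ 0 = L ∧
      (∀ (α : Multiset (Fin n)) (j : Fin n), 2 ≤ α.card → α.card ≤ N →
        kahlerDeriv (pullback φ g) α {j} 0 = 0) ∧
      ∀ (i : Fin n) (β : Multiset (Fin n)), 2 ≤ β.card → β.card ≤ N →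
        kahlerDeriv (pullback φ g) {i} β 0 = 0 := by
  classical
  -- The value `0` for the empty multiset puts the center at `H p = 0`. The order is `N + 1` so that
  -- the first derivatives, and with them the Jacobian matrix of `H`, are prescribed even for `N =
  -- 0`.
  choose h hh hjet using fun q => exists_holomorphic_jet p
    (fun α => if α = 0 then 0 else kahlerDeriv g α {q} p) (N + 1)
  set H : (Fin n → ℂ) → (Fin n → ℂ) := fun w q => h q w with hH
  have hHd : Differentiable ℂ H := differentiable_pi.2 hh
  have hHp : H p = 0 := funext fun q => (hjet q [] (by simp)).trans (by simp)
  set M : Matrix (Fin n) (Fin n) ℂ := (g p).transpose with hM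
  have hMu : IsUnit M := (Matrix.isUnit_transpose _).2 (hg.posDef p hp).isUnit
  have hJ : jacobian H p = M := by
    ext q i
    refine (jacobian_eq_dz isOpen_univ hHd.differentiableOn q i (Set.mem_univ p)).trans ?_
    have h1 := hjet q [i] (by simp)
    rw [if_neg (by simp), Multiset.coe_singleton, hg.kahlerDeriv_singleton i q hp] at h1
    exact h1
  obtain ⟨W, W', ψ, hHW, hpW, hWV, hψ, hψm, hψl, hψr⟩ :=
    exists_local_inverse hHd hg.isOpen hp (hJ ▸ hMu)
  have hML : IsUnit (M * L).det := (Matrix.isUnit_iff_isUnit_det _).1 (hMu.mul hL)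
  -- As `H ∘ φ = Λ` and `H` has Jacobian matrix `M` at `p`, this choice gives `φ` the Jacobian
  -- matrix `L` at `0`.
  set Λ : (Fin n → ℂ) →L[ℂ] (Fin n → ℂ) := (Matrix.toLin' (M * L)).toContinuousLinearMap with hΛ
  set Λ' : (Fin n → ℂ) →L[ℂ] (Fin n → ℂ) := (Matrix.toLin' (M * L)⁻¹).toContinuousLinearMap
    with hΛ'
  have hΛv : ∀ v, Λ v = (M * L).mulVec v := fun v => rfl
  have hΛv' : ∀ v, Λ' v = (M * L)⁻¹.mulVec v := fun v => rfl
  have hΛl : ∀ v, Λ' (Λ v) = v := fun v => by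
    rw [hΛv, hΛv', Matrix.mulVec_mulVec, Matrix.nonsing_inv_mul _ hML, Matrix.one_mulVec]
  have hΛr : ∀ v, Λ (Λ' v) = v := fun v => by
    rw [hΛv, hΛv', Matrix.mulVec_mulVec, Matrix.mul_nonsing_inv _ hML, Matrix.one_mulVec]
  have hJΛ : ∀ z, jacobian Λ z = M * L := fun z => by
    ext q i
    rw [jacobian, ContinuousLinearMap.fderiv, hΛv]
    simp
  set φ : (Fin n → ℂ) → (Fin n → ℂ) := fun z => ψ (Λ z) with hφ
  set U : Set (Fin n → ℂ) := Λ ⁻¹' W' with hU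
  have hUo : IsOpen U := hHW.2.1.preimage Λ.continuous
  have hφd : DifferentiableOn ℂ φ U := hψ.comp Λ.differentiable.differentiableOn fun z hz => hz
  have hφm : Set.MapsTo φ U W := fun z hz => hψm hz
  have hHφ : ∀ z ∈ U, H (φ z) = Λ z := fun z hz => hψr hz
  have hbi : IsBiholomorphic φ U W := by
    refine ⟨hUo, hHW.1, hφd, hφm, fun w => Λ' (H w),
      (Λ'.differentiable.comp hHd).differentiableOn, fun w hw => ?_, fun z hz => ?_, fun w hw => ?_⟩
    · change Λ (Λ' (H w)) ∈ W'
      rw [hΛr]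
      exact hHW.2.2.2.1 hw
    · simp only
      rw [hHφ z hz, hΛl]
    · change ψ (Λ (Λ' (H w))) = w
      rw [hΛr]
      exact hψl hw
  have h0 : (0 : Fin n → ℂ) ∈ U := by
    change Λ 0 ∈ W'
    rw [map_zero, ← hHp]
    exact hHW.2.2.2.1 hpW
  have hφ0 : φ 0 = p := by
    change ψ (Λ 0) = p
    rw [map_zero, ← hHp]
    exact hψl hpW
  have hgW : IsKahlerOn g W := ⟨hHW.1, fun i j => (hg.smooth i j).mono hWV,
    fun z hz => hg.posDef z (hWV hz), fun z hz => hg.closed z (hWV hz)⟩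
  have hK := hbi.isKahlerOn_pullback hgW
  have hpure : ∀ (α : Multiset (Fin n)) (j : Fin n), 2 ≤ α.card → α.card ≤ N →
      kahlerDeriv (pullback φ g) α {j} 0 = 0 := by
    intro α j h2 hN
    induction α using Quotient.inductionOn with
    | _ l =>
    change 2 ≤ l.length at h2
    change l.length ≤ N at hN
    have hne : (Finset.univ : Finset (Fin l.length)).Nonempty :=
      ⟨⟨0, by omega⟩, Finset.mem_univ _⟩
    -- The derivatives of `g` with barred index `q` may be replaced by those of `h q`, and the block
    -- sum is then a derivative of the linear function `h q ∘ φ`.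
    have hblock : ∀ q, blockSum (blockWeight φ l.get 0) (fun α => kahlerDeriv g α {q} p)
        Finset.univ = 0 := by
      intro q
      have h1 := iterDz_comp (f := h q) hUo isOpen_univ hφd (Set.mapsTo_univ _ _)
        (smooth_of_holomorphic isOpen_univ (hh q).differentiableOn) l.get Finset.univ h0
      have h3 : Set.EqOn (fun z => h q (φ z))
          ((ContinuousLinearMap.proj (R := ℂ) (φ := fun _ : Fin n => ℂ) q).comp Λ) U :=
        fun z hz => congrFun (hHφ z hz) q
      rw [iterDz_congr hUo h3 _ h0, iterDz_continuousLinearMap _ (by simpa using h2)] at h1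
      refine Eq.trans ?_ h1.symm
      refine blockSum_congr_value _ fun α hα hα0 => ?_
      have h4 := hjet q (α.sort (· ≤ ·)) (by
        rw [Multiset.length_sort]
        rw [Finset.card_univ, Fintype.card_fin] at hα
        omega)
      rw [Multiset.sort_eq, if_neg (hα0.resolve_right hne.ne_empty)] at h4
      rw [hφ0, h4]
    have h5 := kahlerDeriv_pullback hUo hφd hφm hgW hK (a := l.get)
      (b := fun _ : Fin 1 => j) hne (Finset.singleton_nonempty 0) h0
    have h6 : (({0} : Finset (Fin 1)).val.map fun _ => j) = {j} := rfl
    have h7 : barSum φ g (fun _ : Fin 1 => j) {0} 0 =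
        fun α => ∑ d, star (jacobian φ 0 d j) * kahlerDeriv g α {d} p := by
      funext α
      rw [barSum_singleton hUo hφd 0 h0, hφ0]
    rw [h6, Fin.univ_val_map, List.ofFn_get] at h5
    simp only [h7, blockSum_sum, hblock, mul_zero, Finset.sum_const_zero] at h5
    exact h5
  refine ⟨φ, U, W, hbi, hWV, h0, hφ0, ?_, hpure, fun i β h2 hN => ?_⟩
  · have h1 : jacobian (H ∘ φ) 0 = jacobian H (φ 0) * jacobian φ 0 :=
      jacobian_comp hUo isOpen_univ hφd hHd.differentiableOn (Set.mapsTo_univ _ _) h0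
    rw [jacobian_congr hUo (φ := H ∘ φ) (ψ := Λ) (fun z hz => hHφ z hz) h0, hJΛ, hφ0, hJ] at h1
    exact (hMu.mul_left_cancel h1).symm
  · have h1 := hK.kahlerDeriv_bar i (β := β) (by rintro rfl; simp at h2) h0
    rw [h1]
    simp only [hpure β i h2 hN, star_zero]

end NormalCoordinates

end KahlerTree

end

noncomputable section

namespace KahlerTree

/-! ### Linear changes of coordinates -/

section Linear

variable {n : ℕ} {U V : Set (Fin n → ℂ)} {φ : (Fin n → ℂ) → (Fin n → ℂ)}

theorem sum_fin_succ_fun {κ : Type} [Fintype κ] {k : ℕ} (F : (Fin (k + 1) → κ) → ℂ) :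
    ∑ c, F c = ∑ p, ∑ c : Fin k → κ, F (Fin.cons p c) := by
  rw [← (Fin.consEquiv fun _ => κ).sum_comp, Fintype.sum_prod_type]
  rfl

variable {D : Fin n → ((Fin n → ℂ) → ℂ) → (Fin n → ℂ) → ℂ}

theorem smooth_foldr (hD : ∀ i, IsDerivationOn U (D i)) {f : (Fin n → ℂ) → ℂ}
    (hf : ContDiffOn ℝ ∞ f U) (l : List (Fin n)) : ContDiffOn ℝ ∞ (l.foldr D f) U := by
  induction l with
  | nil => exact hf
  | cons i l ih => exact (hD i).smooth _ ih

theorem foldr_congr (hD : ∀ i, IsDerivationOn U (D i)) {f g : (Fin n → ℂ) → ℂ}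
    (hfg : Set.EqOn f g U) (l : List (Fin n)) : Set.EqOn (l.foldr D f) (l.foldr D g) U := by
  induction l with
  | nil => exact hfg
  | cons i l ih => exact (hD i).congr _ _ ih

theorem IsDerivationOn.const_mul_sum {δ : ((Fin n → ℂ) → ℂ) → (Fin n → ℂ) → ℂ}
    (h : IsDerivationOn U δ) {τ : Type*} [Fintype τ] (w : τ → ℂ) {F : τ → (Fin n → ℂ) → ℂ}
    (hF : ∀ t, ContDiffOn ℝ ∞ (F t) U) :
    Set.EqOn (δ fun z => ∑ t, w t * F t z) (fun z => ∑ t, w t * δ (F t) z) U := by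
  intro z hz
  rw [h.sum _ _ (fun t _ => contDiffOn_const.mul (hF t)) hz]
  refine Finset.sum_congr rfl fun t _ => ?_
  rw [h.mul _ _ contDiffOn_const (hF t) z hz, h.const _ z hz, zero_mul, zero_add]

theorem foldr_const_mul_sum (hD : ∀ i, IsDerivationOn U (D i)) {τ : Type*} [Fintype τ]
    (w : τ → ℂ) {F : τ → (Fin n → ℂ) → ℂ} (hF : ∀ t, ContDiffOn ℝ ∞ (F t) U)
    (l : List (Fin n)) :
    Set.EqOn (l.foldr D fun z => ∑ t, w t * F t z) (fun z => ∑ t, w t * l.foldr D (F t) z) U := by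
  induction l with
  | nil => exact fun _ _ => rfl
  | cons i l ih =>
    refine ((hD i).congr _ _ ih).trans ?_
    exact (hD i).const_mul_sum w fun t => smooth_foldr hD (hF t) l

/-- Iterated derivatives of a composition with a map whose Jacobian matrix is constant. -/
theorem foldr_comp (hU : ∀ i, IsDerivationOn U (D i)) (hV : ∀ i, IsDerivationOn V (D i))
    (hs : ∀ f : (Fin n → ℂ) → ℂ, ContDiffOn ℝ ∞ f V → ContDiffOn ℝ ∞ (fun z => f (φ z)) U)
    (K : Matrix (Fin n) (Fin n) ℂ)
    (hc : ∀ f : (Fin n → ℂ) → ℂ, ContDiffOn ℝ ∞ f V → ∀ z ∈ U, ∀ i,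
      D i (fun z => f (φ z)) z = ∑ c, K c i * D c f (φ z))
    {f : (Fin n → ℂ) → ℂ} (hf : ContDiffOn ℝ ∞ f V) {k : ℕ} (a : Fin k → Fin n) :
    Set.EqOn ((List.ofFn a).foldr D fun z => f (φ z))
      (fun z => ∑ c : Fin k → Fin n, (∏ i, K (c i) (a i)) * (List.ofFn c).foldr D f (φ z)) U := by
  induction k with
  | zero =>
    intro z _
    simp
  | succ k ih =>
    intro z hz
    rw [List.ofFn_succ, List.foldr_cons, (hU _).congr _ _ (ih fun i => a i.succ) hz,
      (hU _).const_mul_sum _ (fun c => hs _ (smooth_foldr hV hf _)) hz]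
    simp only [sum_fin_succ_fun, Fin.prod_univ_succ, Fin.cons_zero, Fin.cons_succ, List.ofFn_succ,
      List.foldr_cons]
    rw [Finset.sum_comm]
    refine Finset.sum_congr rfl fun c _ => ?_
    rw [hc _ (smooth_foldr hV hf _) z hz, Finset.mul_sum]
    exact Finset.sum_congr rfl fun p _ => by ring

/-- With a constant Jacobian matrix no derivative ever falls on the coordinate change, so every
index, of the metric or of a derivative, transforms by one factor of `L`. -/
theorem metricDeriv_pullback_linear {L : Matrix (Fin n) (Fin n) ℂ} (hU : IsOpen U)
    (hφ : DifferentiableOn ℂ φ U) (hUV : Set.MapsTo φ U V)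
    {g : (Fin n → ℂ) → Matrix (Fin n) (Fin n) ℂ} (hg : IsKahlerOn g V)
    (hL : ∀ z ∈ U, jacobian φ z = L) {k m : ℕ} [NeZero k] [NeZero m] (a : Fin k → Fin n)
    (b : Fin m → Fin n) {z : Fin n → ℂ} (hz : z ∈ U) :
    metricDeriv (pullback φ g) (List.ofFn a) (List.ofFn b) z =
      ∑ c : Fin k → Fin n, ∑ d : Fin m → Fin n,
        metricDeriv g (List.ofFn c) (List.ofFn d) (φ z) * (∏ i, L (c i) (a i)) *
          ∏ j, star (L (d j) (b j)) := by
  obtain ⟨k, rfl⟩ := Nat.exists_eq_succ_of_ne_zero (NeZero.ne k)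
  obtain ⟨m, rfl⟩ := Nat.exists_eq_succ_of_ne_zero (NeZero.ne m)
  have hs : ∀ f : (Fin n → ℂ) → ℂ, ContDiffOn ℝ ∞ f V → ContDiffOn ℝ ∞ (fun z => f (φ z)) U := fun f hf =>
    smooth_comp hU hφ hUV hf
  have h1 : Set.EqOn (fun z => pullback φ g z (a 0) (b 0))
      (fun z => ∑ t : Fin n × Fin n, (L t.1 (a 0) * star (L t.2 (b 0))) * g (φ z) t.1 t.2) U := by
    intro z hz
    simp only [pullback, hL z hz, Fintype.sum_prod_type]
    exact Finset.sum_congr rfl fun p _ => Finset.sum_congr rfl fun q _ => by ring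
  have hbU := isDerivationOn_dzbar hU
  have hbV := isDerivationOn_dzbar hg.isOpen
  have hdU := isDerivationOn_dz hU
  have hdV := isDerivationOn_dz hg.isOpen
  have h2 : Set.EqOn (iterDzbar (List.ofFn fun j => b j.succ)
      fun z => pullback φ g z (a 0) (b 0))
      (fun z => ∑ t : (Fin n × Fin n) × (Fin m → Fin n),
        (L t.1.1 (a 0) * star (L t.1.2 (b 0)) * ∏ j, star (L (t.2 j) (b j.succ))) *
          iterDzbar (List.ofFn t.2) (fun w => g w t.1.1 t.1.2) (φ z)) U := by
    refine (foldr_congr hbU h1 _).trans ((foldr_const_mul_sum hbU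
      (fun t : Fin n × Fin n => L t.1 (a 0) * star (L t.2 (b 0)))
      (F := fun t z => g (φ z) t.1 t.2) (fun t => hs _ (hg.smooth t.1 t.2)) _).trans ?_)
    intro z hz
    refine Eq.trans ?_ (Fintype.sum_prod_type _).symm
    refine Finset.sum_congr rfl fun t _ => ?_
    rw [foldr_comp (φ := φ) hbU hbV hs (L.map star)
      (fun f hf z hz i => by rw [dzbar_comp hU hg.isOpen hφ hUV hf hz, hL z hz]; rfl)
      (hg.smooth t.1 t.2) _ hz, Finset.mul_sum]
    refine Finset.sum_congr rfl fun d _ => ?_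
    rw [← mul_assoc]
    rfl
  have h3 := (foldr_congr hdU h2 (List.ofFn fun i => a i.succ)).trans (foldr_const_mul_sum hdU
    (fun t : (Fin n × Fin n) × (Fin m → Fin n) =>
      L t.1.1 (a 0) * star (L t.1.2 (b 0)) * ∏ j, star (L (t.2 j) (b j.succ)))
    (F := fun t z => iterDzbar (List.ofFn t.2) (fun w => g w t.1.1 t.1.2) (φ z))
    (fun t => hs _ (smooth_foldr hbV (hg.smooth t.1.1 t.1.2) _)) _)
  have h4 : metricDeriv (pullback φ g) (List.ofFn a) (List.ofFn b) z =
      (List.ofFn fun i => a i.succ).foldr dz (iterDzbar (List.ofFn fun j => b j.succ)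
        fun z => pullback φ g z (a 0) (b 0)) z := by
    rw [List.ofFn_succ, List.ofFn_succ]
    rfl
  rw [h4, h3 hz]
  simp only [sum_fin_succ_fun, Fin.prod_univ_succ, Fin.cons_zero, Fin.cons_succ, List.ofFn_succ,
    Fintype.sum_prod_type]
  refine Finset.sum_congr rfl fun p _ => ?_
  have h5 : ∀ (q : Fin n) (d : Fin m → Fin n),
      (List.ofFn fun i => a i.succ).foldr dz
        (fun z => iterDzbar (List.ofFn d) (fun w => g w p q) (φ z)) z =
      ∑ c : Fin k → Fin n, (∏ i, L (c i) (a i.succ)) *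
        metricDeriv g (p :: List.ofFn c) (q :: List.ofFn d) (φ z) := fun q d =>
    foldr_comp (φ := φ) hdU hdV hs L
      (fun f hf z hz i => by rw [dz_comp hU hg.isOpen hφ hUV hf hz, hL z hz])
      (smooth_foldr hbV (hg.smooth p q) _) _ hz
  simp only [h5, Finset.mul_sum]
  rw [Finset.sum_congr rfl fun q _ => Finset.sum_comm, Finset.sum_comm]
  refine Finset.sum_congr rfl fun c _ => Finset.sum_congr rfl fun q _ =>
    Finset.sum_congr rfl fun d _ => ?_
  ring

end Linear

/-! ### Invariance and uniqueness -/

section Main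

variable {n k m : ℕ} {U V : Set (Fin n → ℂ)} {φ : (Fin n → ℂ) → (Fin n → ℂ)}
  {g g' : (Fin n → ℂ) → Matrix (Fin n) (Fin n) ℂ}

theorem metricDeriv_congr (hU : IsOpen U) (h : Set.EqOn g g' U) (α β : List (Fin n)) :
    Set.EqOn (metricDeriv g α β) (metricDeriv g' α β) U := by
  rcases α with _ | ⟨i, α⟩
  · exact fun _ _ => rfl
  rcases β with _ | ⟨j, β⟩
  · exact fun _ _ => rfl
  rw [metricDeriv_cons, metricDeriv_cons]
  exact iterWirtinger_congr hU (iterWirtinger_congr hU (fun z hz => by simp only [h hz]) _ _) _ _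

theorem PolyTensor.eval_congr (D : PolyTensor n k m) (hU : IsOpen U) (h : Set.EqOn g g' U)
    {p : Fin n → ℂ} (hp : p ∈ U) (a : Fin k → Fin n) (b : Fin m → Fin n) :
    D.eval g p a b = D.eval g' p a b := by
  have h1 : MetricVar.value g p = MetricVar.value g' p := by
    funext x
    cases x with
    | deriv A B => exact metricDeriv_congr hU h _ _ hp
    | inv r s => simp only [MetricVar.value, h hp]
  rw [PolyTensor.eval, PolyTensor.eval, h1]

theorem pullback_congr {ψ : (Fin n → ℂ) → (Fin n → ℂ)} (hU : IsOpen U) (h : Set.EqOn φ ψ U)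
    (g : (Fin n → ℂ) → Matrix (Fin n) (Fin n) ℂ) :
    Set.EqOn (pullback φ g) (pullback ψ g) U := fun z hz => by
  rw [pullback_eq_mul, pullback_eq_mul, jacobian_congr hU h hz, h hz]

theorem pullback_id (g : (Fin n → ℂ) → Matrix (Fin n) (Fin n) ℂ) :
    pullback (fun z => z) g = g := by
  funext z
  rw [pullback_eq_mul, jacobian_id]
  simp

theorem IsKahlerOn.mono (hg : IsKahlerOn g V) (hU : IsOpen U) (h : U ⊆ V) : IsKahlerOn g U :=
  ⟨hU, fun i j => (hg.smooth i j).mono h, fun z hz => hg.posDef z (h hz),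
    fun z hz => hg.closed z (h hz)⟩

theorem IsKahlerOn.kahlerDeriv_congr (hg : IsKahlerOn g U) (h : Set.EqOn g' g U)
    (α β : Multiset (Fin n)) : Set.EqOn (kahlerDeriv g' α β) (kahlerDeriv g α β) U :=
  metricDeriv_congr hg.isOpen h _ _

/-- The case in which `φ` is the identity: the given coordinates are already the ones required. -/
theorem eval_treeSum_of_isNormalAt (hk : 2 ≤ k) (hm : 2 ≤ m) (hg : IsKahlerOn g U)
    {p : Fin n → ℂ} (hp : p ∈ U) {N : ℕ} (hN : k + m ≤ N) (h : IsNormalAt N g p)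
    (a : Fin k → Fin n) (b : Fin m → Fin n) :
    (treeSum n k m).eval g p a b = metricDeriv g (List.ofFn a) (List.ofFn b) p := by
  have h1 := eval_treeSum_of_pure_eq_zero (U := U) (V := U) (φ := fun z => z) (g := g) (z := p)
    hk hm differentiableOn_id (Set.mapsTo_id U) hg (by rwa [pullback_id]) hp (jacobian_id p)
  rw [pullback_id] at h1
  refine h1 (fun α j h2 hα => ?_) (fun i β h2 hβ => ?_) a b
  · obtain ⟨i, l, rfl⟩ := exists_list_cons (α := α) (by rintro rfl; simp at h2)
    rw [Multiset.coe_card, List.length_cons] at h2 hα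
    rw [← Multiset.coe_singleton, hg.kahlerDeriv_coe _ _ hp]
    exact h.dz_eq_zero i j l (by omega) (by omega)
  · obtain ⟨j, l, rfl⟩ := exists_list_cons (α := β) (by rintro rfl; simp at h2)
    rw [Multiset.coe_card, List.length_cons] at h2 hβ
    rw [← Multiset.coe_singleton, hg.kahlerDeriv_coe _ _ hp]
    exact h.dzbar_eq_zero i j l (by omega) (by omega)

/-- Pure derivatives of order at most `N` that vanish in some coordinates also vanish after a linear
change of coordinates. -/
theorem kahlerDeriv_pullback_linear_eq_zero {L : Matrix (Fin n) (Fin n) ℂ} (hU : IsOpen U)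
    (hφ : DifferentiableOn ℂ φ U) (hUV : Set.MapsTo φ U V) (hg : IsKahlerOn g V)
    (hh : IsKahlerOn (pullback φ g) U) (hL : ∀ z ∈ U, jacobian φ z = L) {z : Fin n → ℂ}
    (hz : z ∈ U) {α β : Multiset (Fin n)} (hα : α ≠ 0) (hβ : β ≠ 0)
    (h : ∀ α' β' : Multiset (Fin n), α'.card = α.card → β'.card = β.card →
      kahlerDeriv g α' β' (φ z) = 0) :
    kahlerDeriv (pullback φ g) α β z = 0 := by
  induction α using Quotient.inductionOn with
  | _ l =>
  induction β using Quotient.inductionOn with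
  | _ l' =>
  have : NeZero l.length := ⟨fun h => hα (by simpa using h)⟩
  have : NeZero l'.length := ⟨fun h => hβ (by simpa using h)⟩
  have h1 := metricDeriv_pullback_linear hU hφ hUV hg hL l.get l'.get hz
  rw [List.ofFn_get, List.ofFn_get] at h1
  refine (hh.kahlerDeriv_coe l l' hz).trans (h1.trans ?_)
  refine Finset.sum_eq_zero fun c _ => Finset.sum_eq_zero fun d _ => ?_
  rw [← hg.kahlerDeriv_coe _ _ (hUV hz), h _ _ (by simp) (by simp), zero_mul, zero_mul]

/-- Both sides are mixed derivatives in adapted coordinates: `φ` for `g` at `χ z`, and `χ⁻¹ ∘ φ ∘ Λ`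
for `χ^* g` at `z`. The two pulled back metrics differ by the linear map `Λ`, the differential of
`χ` at `z`, and linear maps act tensorially on derivatives. -/
theorem isInvariant_treeSum (hk : 2 ≤ k) (hm : 2 ≤ m) : (treeSum n k m).IsInvariant := by
  intro χ U V hχ g hg z hz a b
  have : NeZero k := ⟨by omega⟩
  have : NeZero m := ⟨by omega⟩
  have hχg := hχ.isKahlerOn_pullback hg
  obtain ⟨ξ, hξ, hξl, hξr, hξJ⟩ := hχ.jacobian_mul
  obtain ⟨φ, U₁, W, hφ, hWV, h0, hφ0, hJ, hp, hp'⟩ :=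
    exists_normal_coordinates hg (hχ.2.2.2.1 hz) isUnit_one (k + m)
  set h₁ := pullback φ g with hh₁
  have hK₁ : IsKahlerOn h₁ U₁ := hφ.isKahlerOn_pullback (hg.mono hφ.2.1 hWV)
  set L := jacobian χ z with hL
  have hLu : IsUnit L := hχ.isUnit_jacobian hz
  set Λ : (Fin n → ℂ) →L[ℂ] (Fin n → ℂ) := (Matrix.toLin' L).toContinuousLinearMap with hΛ
  have hJΛ : ∀ z, jacobian Λ z = L := fun z => by
    ext q i
    rw [jacobian, ContinuousLinearMap.fderiv]
    change (L.mulVec (Pi.single i 1)) q = L q i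
    simp
  set U₂ : Set (Fin n → ℂ) := Λ ⁻¹' U₁ with hU₂
  have hU₂o : IsOpen U₂ := hφ.1.preimage Λ.continuous
  have hΛd : DifferentiableOn ℂ Λ U₂ := Λ.differentiable.differentiableOn
  have hΛm : Set.MapsTo Λ U₂ U₁ := fun _ h => h
  have hK₂ : IsKahlerOn (pullback Λ h₁) U₂ :=
    isKahlerOn_pullback hU₂o hΛd hΛm hK₁ fun z _ => (hJΛ z).symm ▸ hLu
  have h02 : (0 : Fin n → ℂ) ∈ U₂ := by
    change Λ 0 ∈ U₁
    rwa [map_zero]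
  have hφm : Set.MapsTo φ U₁ V := fun w hw => hWV (hφ.2.2.2.1 hw)
  have hφΛ : DifferentiableOn ℂ (φ ∘ Λ) U₂ := hφ.2.2.1.comp hΛd hΛm
  have hφΛm : Set.MapsTo (φ ∘ Λ) U₂ V := hφm.comp hΛm
  -- Composing with `Λ` makes the Jacobian matrix at `0` equal to `L⁻¹ L = 1`, as the tree sum
  -- formula demands; linearity of `Λ` keeps the pure derivatives zero.
  set φ₂ : (Fin n → ℂ) → (Fin n → ℂ) := ξ ∘ (φ ∘ Λ) with hφ₂
  have hφ₂d : DifferentiableOn ℂ φ₂ U₂ := hξ.2.2.1.comp hφΛ hφΛm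
  have hφ₂m : Set.MapsTo φ₂ U₂ U := hξ.2.2.2.1.comp hφΛm
  have hφ₂0 : φ₂ 0 = z := by
    change ξ (φ (Λ 0)) = z
    rw [map_zero, hφ0]
    exact hξl hz
  have hJ₂ : jacobian φ₂ 0 = 1 := by
    rw [hφ₂, jacobian_comp hU₂o hξ.1 hφΛ hξ.2.2.1 hφΛm h02,
      jacobian_comp hU₂o hφ.1 hΛd hφ.2.2.1 hΛm h02, hJΛ, map_zero, hJ, one_mul]
    change jacobian ξ (φ (Λ 0)) * L = 1
    rw [map_zero, hφ0]
    exact hξJ z hz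
  have hpull : Set.EqOn (pullback φ₂ (pullback χ g)) (pullback Λ h₁) U₂ := by
    refine (pullback_comp hU₂o hχ.1 hφ₂d hχ.2.2.1 hφ₂m g).trans ?_
    refine (pullback_congr hU₂o (ψ := φ ∘ Λ) (fun w hw => ?_) g).trans
      (pullback_comp hU₂o hφ.1 hΛd hφ.2.2.1 hΛm g).symm
    exact hξr (hφΛm hw)
  have hK₂' : IsKahlerOn (pullback φ₂ (pullback χ g)) U₂ := by
    refine isKahlerOn_pullback hU₂o hφ₂d hφ₂m hχg fun w hw => ?_
    rw [hφ₂, jacobian_comp hU₂o hξ.1 hφΛ hξ.2.2.1 hφΛm hw,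
      jacobian_comp hU₂o hφ.1 hΛd hφ.2.2.1 hΛm hw, hJΛ]
    exact (hξ.isUnit_jacobian (hφΛm hw)).mul ((hφ.isUnit_jacobian (hΛm hw)).mul hLu)
  have hvan : ∀ α β : Multiset (Fin n), α ≠ 0 → β ≠ 0 →
      (∀ α' β' : Multiset (Fin n), α'.card = α.card → β'.card = β.card →
        kahlerDeriv h₁ α' β' 0 = 0) →
      kahlerDeriv (pullback φ₂ (pullback χ g)) α β 0 = 0 := fun α β hα hβ h => by
    rw [hK₂.kahlerDeriv_congr hpull α β h02]
    refine kahlerDeriv_pullback_linear_eq_zero hU₂o hΛd hΛm hK₁ hK₂ (fun z _ => hJΛ z) h02 hα hβ ?_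
    rwa [map_zero]
  have key₁ : ∀ c d, (treeSum n k m).eval g (χ z) c d =
      metricDeriv h₁ (List.ofFn c) (List.ofFn d) 0 := fun c d => by
    rw [← hφ0]
    exact eval_treeSum_of_pure_eq_zero hk hm hφ.2.2.1 hφm hg hK₁ h0 hJ
      (fun α j h2 hα => hp α j h2 (by omega)) (fun i β h2 hβ => hp' i β h2 (by omega)) c d
  have key₂ : (treeSum n k m).eval (pullback χ g) z a b =
      metricDeriv (pullback Λ h₁) (List.ofFn a) (List.ofFn b) 0 := by
    rw [← metricDeriv_congr hU₂o hpull _ _ h02]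
    have h3 := eval_treeSum_of_pure_eq_zero hk hm hφ₂d hφ₂m hχg hK₂' h02 hJ₂
      (fun α j h2 hα => hvan α {j} (by rintro rfl; simp at h2) (Multiset.singleton_ne_zero j)
        fun α' β' h4 h5 => by
          obtain ⟨j', rfl⟩ := Multiset.card_eq_one.1 (h5.trans (Multiset.card_singleton j))
          exact hp α' j' (by omega) (by omega))
      (fun i β h2 hβ => hvan {i} β (Multiset.singleton_ne_zero i) (by rintro rfl; simp at h2)
        fun α' β' h4 h5 => by
          obtain ⟨i', rfl⟩ := Multiset.card_eq_one.1 (h4.trans (Multiset.card_singleton i))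
          exact hp' i' β' (by omega) (by omega)) a b
    rwa [hφ₂0] at h3
  rw [key₂, metricDeriv_pullback_linear hU₂o hΛd hΛm hK₁ (fun z _ => hJΛ z) a b h02, map_zero]
  simp only [key₁]

theorem isCanonicalInvariant_treeSum (hk : 2 ≤ k) (hm : 2 ≤ m) :
    (treeSum n k m).IsCanonicalInvariant :=
  ⟨isInvariant_treeSum hk hm, k + m, fun _ _ hg _ hp h a b =>
    eval_treeSum_of_isNormalAt hk hm hg hp le_rfl h a b⟩

theorem exists_isNormalAt (hg : IsKahlerOn g V) {p : Fin n → ℂ} (hp : p ∈ V) (N : ℕ) :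
    ∃ φ U W, IsBiholomorphic φ U W ∧ W ⊆ V ∧ 0 ∈ U ∧ φ 0 = p ∧ IsNormalAt N (pullback φ g) 0 := by
  obtain ⟨L, hL, hLg⟩ := exists_conj_eq_one (hg.posDef p hp)
  -- Normality counts only the derivatives, whereas the multisets also contain the index of the
  -- metric itself; hence `N + 1`.
  obtain ⟨φ, U, W, hφ, hWV, h0, hφ0, hJ, hd, hd'⟩ := exists_normal_coordinates hg hp hL (N + 1)
  have hK := hφ.isKahlerOn_pullback (hg.mono hφ.2.1 hWV)
  refine ⟨φ, U, W, hφ, hWV, h0, hφ0, ?_, fun i j α h1 hα => ?_, fun i j α h1 hα => ?_⟩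
  · rw [pullback_eq_mul, hφ0, hJ, hLg]
  · exact (hK.kahlerDeriv_coe (i :: α) [j] h0).symm.trans
      (hd _ j (by simpa using h1) (by simpa using hα))
  · exact (hK.kahlerDeriv_coe [i] (j :: α) h0).symm.trans
      (hd' i _ (by simpa using h1) (by simpa using hα))

/-- Two canonical invariants agree, because they agree in normal coordinates. -/
theorem PolyTensor.IsCanonicalInvariant.eval_eq {D D' : PolyTensor n k m}
    (hD : D.IsCanonicalInvariant) (hD' : D'.IsCanonicalInvariant) (hg : IsKahlerOn g U)
    {p : Fin n → ℂ} (hp : p ∈ U) (a : Fin k → Fin n) (b : Fin m → Fin n) :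
    D.eval g p a b = D'.eval g p a b := by
  obtain ⟨hinv, N, hN⟩ := hD
  obtain ⟨hinv', N', hN'⟩ := hD'
  obtain ⟨φ, U₁, W, hφ, hWU, h0, hφ0, h⟩ := exists_isNormalAt hg hp (max N N')
  have hK := hφ.isKahlerOn_pullback (hg.mono hφ.2.1 hWU)
  have hmono : ∀ {M}, M ≤ max N N' → IsNormalAt M (pullback φ g) 0 := fun hM =>
    ⟨h.metric_eq_one, fun i j α h1 hα => h.dz_eq_zero i j α h1 (hα.trans hM),
      fun i j α h1 hα => h.dzbar_eq_zero i j α h1 (hα.trans hM)⟩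
  obtain ⟨ψ, hψ, hl, hr, -⟩ := hφ.jacobian_mul
  have hpW : p ∈ W := hφ0 ▸ hφ.2.2.2.1 h0
  have hψp : ψ p = 0 := by rw [← hφ0, hl h0]
  -- Near `p` the metric is the pullback of its normal form by the inverse `ψ`, so invariance under
  -- `ψ` expresses both values at `p` through those at the center, where they coincide.
  have hpull : Set.EqOn g (pullback ψ (pullback φ g)) W := by
    have h1 := pullback_comp hψ.1 hψ.2.1 hψ.2.2.1 hφ.2.2.1 hψ.2.2.2.1 g
    have h2 := pullback_congr hψ.1 (φ := φ ∘ ψ) (ψ := fun z => z) (fun w hw => hr hw) g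
    rw [pullback_id] at h2
    exact (h1.trans h2).symm
  rw [D.eval_congr hφ.2.1 hpull hpW, D'.eval_congr hφ.2.1 hpull hpW,
    hinv ψ W U₁ hψ _ hK p hpW, hinv' ψ W U₁ hψ _ hK p hpW, hψp]
  simp only [hN _ _ hK 0 h0 (hmono (le_max_left _ _)),
    hN' _ _ hK 0 h0 (hmono (le_max_right _ _))]

end Main

end KahlerTree

end
theorem theorem2p5 (n k m : ℕ) (hk : 2 ≤ k) (hm : 2 ≤ m) :
    (KahlerTree.treeSum n k m).IsCanonicalInvariant ∧
      ∀ D : KahlerTree.PolyTensor n k m, D.IsCanonicalInvariant →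
        ∀ (g : (Fin n → ℂ) → Matrix (Fin n) (Fin n) ℂ) (U : Set (Fin n → ℂ)),
          KahlerTree.IsKahlerOn g U → ∀ p ∈ U, ∀ (a : Fin k → Fin n) (b : Fin m → Fin n),
            D.eval g p a b = (KahlerTree.treeSum n k m).eval g p a b :=
  ⟨KahlerTree.isCanonicalInvariant_treeSum hk hm, fun _ hD _ _ hg _ hp a b =>
    hD.eval_eq (KahlerTree.isCanonicalInvariant_treeSum hk hm) hg hp a b⟩
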